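/- **Setting.** Consider an $m$-player general-sum Markov game ($m\ge1$) with horizon $H$, $S$ states, finite nonempty action sets of sizes $A_1,\dots,A_m$, transition kernels $P_h(\cdot\mid s,\mathbf a)$, deterministic rewards $r_{h,i}(s,\mathbf a)\in[0,1]$ and a fixed initial state $s_1$. For a product Markov policy $\pi=(\pi_1,\dots,\pi_m)$ let $V_{1,i}(\pi)$ be the expected total reward of player $i$ from $s_1$. The policy $\pi$ is an $\epsilon$-Nash policy if $V_{1,i}(\mu,\pi_{-i})-V_{1,i}(\pi)\le\epsilon$ for all $i$ and all Markov policies $\mu$ of player $i$; it is pure if all its action choices are deterministic. The game is a Markov potential game with potential $\Phi$ if $V_{1,i}(\mu,\pi_{-i})-V_{1,i}(\pi)=\Phi(\mu,\pi_{-i})-\Phi(\pi)$ for all $i$, $\pi$, $\mu$. Put $\Phi_{\max}=\sup_\pi\Phi(\pi)$, $\Phi_{\min}=\inf_\pi\Phi(\pi)$, and, for $0<\epsilon\le H$ and $p\in(0,1]$, $$\iota=\log\frac{H^2\,S\,m\max_iA_i}{\epsilon p}.$$ **Algorithm (best-response dynamics).** Start from any pure Markov policy $\pi$ and repeat the following,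 with $\delta=\epsilon/8$. For every player $i$: (a) with $\pi_{-i}$ fixed, run the single-agent algorithm UCBVI-UPLOW for $K_i=\lfloor c_K\frac{H^3SA_i\iota}{\delta^2}(1+\delta S\iota)\rfloor$ episodes to get a pure policy $\hat\pi_i$; (b) play $N=\lfloor c_NH^2\iota/\delta^2\rfloor$ episodes with $(\hat\pi_i,\pi_{-i})$ and $N$ episodes with $\pi$, and let $\Delta_i=\hat V_{1,i}(\hat\pi_i,\pi_{-i})-\hat V_{1,i}(\pi)$ be the difference of the two empirical mean returns of player $i$. Let $j$ maximize $\Delta_i$. If $\Delta_j>\epsilon/2$, replace $\pi_j$ by $\hat\pi_j$; otherwise output $\pi$ and stop. Here UCBVI-UPLOW keeps transition counts $N_h(s,a,s')$, $N_h(s,a)$, the empirical kernels $\hat P_h$ and the observed rewards of player $i$. Before each episode it sets $\overline V_{H+1}=\underline V_{H+1}=0$ and, for $h=H,\dots,1$, $$\overline Q_h=\min\{r_h+\hat P_h\overline V_{h+1}+\gamma_h+\beta_h,\,H\},\qquad \underline Q_h=\max\{r_h+\hat P_h\underline V_{h+1}-\gamma_h-\beta_h,\,0\}$$ (and $\overline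 Q_h=H$, $\underline Q_h=0$ at unvisited pairs $(s,a)$), where $$\beta_h=c_1\Big(\sqrt{\widehat{\mathrm{Var}}_h\big[\tfrac12(\overline V_{h+1}+\underline V_{h+1})\big]\,\iota/N_h}+H^2S\iota/N_h\Big),\qquad \gamma_h=\tfrac{c_2}{H}\hat P_h(\overline V_{h+1}-\underline V_{h+1}),$$ and $\overline V_h(s)=\overline Q_h(s,\pi_h(s))$, $\underline V_h(s)=\underline Q_h(s,\pi_h(s))$ with $\pi_h(s)\in\arg\max_a\overline Q_h(s,a)$. It plays the episode with this greedy policy, and at the end it returns the greedy policy of the episode for which $\overline V_1(s_1)-\underline V_1(s_1)$ was smallest (its initial policy if this never was below $H$). **Theorem.** There are absolute constants $c_1,c_2,c_K,c_N,C>0$ such that for every Markov potential game as above, every $0<\epsilon\le H$, every $p\in(0,1]$ and every initial pure policy, with probability at least $1-p$ the algorithm stops and outputs a pure $\epsilon$-Nash policy $\hat\pi$ after at most $$C\,\frac{(\Phi_{\max}-\Phi_{\min}+\epsilon)\,H^3S\,\sum_{i=1}^mA_i\;\iota}{\epsilon^3}\,(1+\epsilon S\iota)$$ episodes. (In particular it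 is $\mathcal O\big((\Phi_{\max}-\Phi_{\min})H^3S\sum_iA_i\,\iota/\epsilon^3\big)$ when $\epsilon\le\Phi_{\max}-\Phi_{\min}$ and $\epsilon S\iota\le1$.) -/

import Mathlib

noncomputable section

/-! ### Markov games, policies, values, Nash equilibria, potentials -/

/-- An `m`-player general-sum Markov game with horizon `H`, states `Fin S`, action sets
`Fin (A i)`, time-dependent transition kernels `P`, deterministic rewards `r i h s a ∈ [0,1]`
depending on the joint action, and a fixed initial state. -/
structure MarkovGame (H S : ℕ) {m : ℕ} (A : Fin m → ℕ) where
  P : Fin H → Fin S → (∀ i, Fin (A i)) → PMF (Fin S)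
  r : Fin m → Fin H → Fin S → (∀ i, Fin (A i)) → ℝ
  r_mem : ∀ i h s a, r i h s a ∈ Set.Icc (0 : ℝ) 1
  init : Fin S

/-- A (randomized) product Markov policy: one Markov policy for each player. -/
abbrev Policy (H S : ℕ) {m : ℕ} (A : Fin m → ℕ) : Type :=
  ∀ i : Fin m, Fin H → Fin S → PMF (Fin (A i))

/-- A pure (deterministic) Markov policy for a single player with `a` actions. -/
abbrev PlayerPure (H S a : ℕ) : Type := Fin H → Fin S → Fin a

/-- A pure Markov policy profile. -/
abbrev PurePolicy (H S : ℕ) {m : ℕ} (A : Fin m → ℕ) : Type :=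
  ∀ i : Fin m, PlayerPure H S (A i)

/-- A pure policy profile seen as a product policy. -/
def PurePolicy.toPolicy {H S m : ℕ} {A : Fin m → ℕ} (π : PurePolicy H S A) : Policy H S A :=
  fun i h s => PMF.pure (π i h s)

namespace MarkovGame

variable {H S m : ℕ} {A : Fin m → ℕ}

/-- Expected total reward of player `i` under `π`, from state `s`, when `n` steps remain.
With `n + 1` steps remaining the current (zero-based) step is `H - 1 - n`, that is
`Fin.rev ⟨n, _⟩`. -/
def valueToGo (G : MarkovGame H S A) (π : Policy H S A) (i : Fin m) : ℕ → Fin S → ℝ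
  | 0, _ => 0
  | n + 1, s =>
    if hn : n < H then
      ∑ a : (∀ j, Fin (A j)), (∏ j, (π j (Fin.rev ⟨n, hn⟩) s (a j)).toReal) *
        (G.r i (Fin.rev ⟨n, hn⟩) s a +
          ∑ s' : Fin S, (G.P (Fin.rev ⟨n, hn⟩) s a s').toReal * valueToGo G π i n s')
    else 0

/-- The value `V_{1,i}(π)` of player `i` at the initial state. -/
def value (G : MarkovGame H S A) (i : Fin m) (π : Policy H S A) : ℝ :=
  G.valueToGo π i H G.init

/-- `π` is an `ε`-Nash equilibrium: no player gains more than `ε` by a unilateral deviation to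
any (randomized) Markov policy. -/
def IsNash (G : MarkovGame H S A) (ε : ℝ) (π : Policy H S A) : Prop :=
  ∀ (i : Fin m) (μ : Fin H → Fin S → PMF (Fin (A i))),
    G.value i (Function.update π i μ) - G.value i π ≤ ε

/-- `Φ` is a potential for `G` (only the values at the initial state matter);
`G` is a Markov potential game if it has one. -/
def IsPotential (G : MarkovGame H S A) (Φ : Policy H S A → ℝ) : Prop :=
  ∀ (i : Fin m) (π : Policy H S A) (μ : Fin H → Fin S → PMF (Fin (A i))),
    G.value i (Function.update π i μ) - G.value i π = Φ (Function.update π i μ) - Φ π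

end MarkovGame

/-- The potential range `Φ_max - Φ_min`. -/
def potentialRange {H S m : ℕ} {A : Fin m → ℕ} (Φ : Policy H S A → ℝ) : ℝ :=
  (⨆ π, Φ π) - ⨅ π, Φ π

/-! ### Playing episodes

Learning algorithms are programs in the monad `Learn`: randomized computations with a counter
for the number of episodes played. They do not take the game as an argument and reach
it only through an oracle that plays one episode with a given pure policy profile and returns the
observed trajectory. -/

/-- What is observed in one step: step, state, joint action, all players' rewards, next state. -/
structure Transition (H S : ℕ) {m : ℕ} (A : Fin m → ℕ) where
  h : Fin H
  s : Fin S
  a : ∀ i, Fin (A i)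
  r : Fin m → ℝ
  s' : Fin S

/-- Randomized computations that count the episodes played. -/
abbrev Learn (α : Type) : Type := StateT ℕ PMF α

/-- An oracle that plays one episode. -/
abbrev Oracle (H S : ℕ) {m : ℕ} (A : Fin m → ℕ) : Type :=
  PurePolicy H S A → Learn (List (Transition H S A))

namespace MarkovGame

variable {H S m : ℕ} {A : Fin m → ℕ}

/-- The random trajectory under `π` over the last `n` steps, from state `s`. -/
def rollout (G : MarkovGame H S A) (π : PurePolicy H S A) :
    ℕ → Fin S → PMF (List (Transition H S A))
  | 0, _ => PMF.pure []
  | n + 1, s =>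
    if hn : n < H then
      let h : Fin H := Fin.rev ⟨n, hn⟩
      let a : ∀ i, Fin (A i) := fun i => π i h s
      (G.P h s a).bind fun s' =>
        (rollout G π n s').map fun τ => ⟨h, s, a, fun i => G.r i h s a, s'⟩ :: τ
    else PMF.pure []

/-- Play one episode from the initial state; the episode counter increases by one. -/
def play (G : MarkovGame H S A) : Oracle H S A :=
  fun π count => (G.rollout π H G.init).map fun τ => (τ, count + 1)

end MarkovGame

/-! ### The single-agent subroutine UCBVI-UPLOW

Optimistic value iteration with upper and lower confidence values, Bernstein-type bonuses, and
output of the greedy policy whose certified gap at the initial state was smallest. -/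

/-- The data collected by one agent with `a` actions: transition counts `N_h(s,a,s')` and
observed rewards `r_h(s,a)`. -/
structure AgentData (H S a : ℕ) where
  N : Fin H → Fin S → Fin a → Fin S → ℕ
  R : Fin H → Fin S → Fin a → ℝ

/-- No data. -/
def AgentData.empty {H S a : ℕ} : AgentData H S a := ⟨fun _ _ _ _ => 0, fun _ _ _ => 0⟩

open Classical in
/-- Player `i` records one observed transition. -/
def AgentData.record {H S m : ℕ} {A : Fin m → ℕ} (i : Fin m)
    (D : AgentData H S (A i)) (x : Transition H S A) : AgentData H S (A i) where
  N h s b s' := D.N h s b s' + if h = x.h ∧ s = x.s ∧ b = x.a i ∧ s' = x.s' then 1 else 0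
  R h s b := if h = x.h ∧ s = x.s ∧ b = x.a i then x.r i else D.R h s b

/-- The constants of UCBVI-UPLOW: `bonus` multiplies the Bernstein bonus, `corr` the correction
term, and `iota` is the logarithmic factor. -/
structure BonusParams where
  bonus : ℝ
  corr : ℝ
  iota : ℝ

/-- Some maximizer of `f`. -/
def argmaxFin {a : ℕ} [NeZero a] (f : Fin a → ℝ) : Fin a :=
  Classical.choose (Finite.exists_max f)

namespace AgentData

variable {H S a : ℕ}

/-- The number of visits `N_h(s,b)`. -/
def visits (D : AgentData H S a) (h : Fin H) (s : Fin S) (b : Fin a) : ℕ :=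
  ∑ s' : Fin S, D.N h s b s'

/-- The empirical expectation of `f` at the next state (used only if `(h,s,b)` was visited). -/
def empMean (D : AgentData H S a) (h : Fin H) (s : Fin S) (b : Fin a) (f : Fin S → ℝ) : ℝ :=
  ∑ s' : Fin S, (D.N h s b s' : ℝ) / (D.visits h s b : ℝ) * f s'

/-- The empirical variance of `f` at the next state. -/
def empVar (D : AgentData H S a) (h : Fin H) (s : Fin S) (b : Fin a) (f : Fin S → ℝ) : ℝ :=
  D.empMean h s b fun s' => (f s' - D.empMean h s b f) ^ 2

/-- The total exploration bonus `β + γ`, where `up`, `low` are the upper and lower value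
functions at the next step. -/
def totalBonus (q : BonusParams) (D : AgentData H S a) (h : Fin H) (up low : Fin S → ℝ)
    (s : Fin S) (b : Fin a) : ℝ :=
  q.bonus *
      (Real.sqrt (D.empVar h s b (fun s' => (up s' + low s') / 2) * q.iota / D.visits h s b) +
        (H : ℝ) ^ 2 * S * q.iota / D.visits h s b) +
    q.corr / H * D.empMean h s b (fun s' => up s' - low s')

/-- Upper confidence `Q`-value. -/
def qUp (q : BonusParams) (D : AgentData H S a) (h : Fin H) (up low : Fin S → ℝ)
    (s : Fin S) (b : Fin a) : ℝ :=
  if D.visits h s b = 0 then H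
  else min (D.R h s b + D.empMean h s b up + D.totalBonus q h up low s b) H

/-- Lower confidence `Q`-value. -/
def qLow (q : BonusParams) (D : AgentData H S a) (h : Fin H) (up low : Fin S → ℝ)
    (s : Fin S) (b : Fin a) : ℝ :=
  if D.visits h s b = 0 then 0
  else max (D.R h s b + D.empMean h s b low - D.totalBonus q h up low s b) 0

variable [NeZero a]

/-- The action that is greedy for the upper confidence `Q`-value. -/
def greedyAct (q : BonusParams) (D : AgentData H S a) (h : Fin H) (up low : Fin S → ℝ)
    (s : Fin S) : Fin a :=
  argmaxFin fun b => D.qUp q h up low s b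

/-- The upper and lower value functions when `n` steps remain. -/
def upLow (q : BonusParams) (D : AgentData H S a) : ℕ → (Fin S → ℝ) × (Fin S → ℝ)
  | 0 => (fun _ => 0, fun _ => 0)
  | n + 1 =>
    if hn : n < H then
      let h : Fin H := Fin.rev ⟨n, hn⟩
      let V := upLow q D n
      (fun s => D.qUp q h V.1 V.2 s (D.greedyAct q h V.1 V.2 s),
        fun s => D.qLow q h V.1 V.2 s (D.greedyAct q h V.1 V.2 s))
    else (fun _ => 0, fun _ => 0)

/-- The greedy policy; after step `h` there remain `H - 1 - h`, that is `h.rev`, steps. -/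
def greedyPolicy (q : BonusParams) (D : AgentData H S a) : PlayerPure H S a :=
  fun h s => D.greedyAct q h (D.upLow q h.rev).1 (D.upLow q h.rev).2 s

/-- The certified gap between upper and lower value at the initial state. -/
def gap (q : BonusParams) (D : AgentData H S a) (s₁ : Fin S) : ℝ :=
  (D.upLow q H).1 s₁ - (D.upLow q H).2 s₁

end AgentData

/-! ### Monte Carlo evaluation and best-response dynamics -/

/-- The sum of the returns of player `i` in `N` episodes played with `π`. -/
def sumReturns {H S m : ℕ} {A : Fin m → ℕ} (play : Oracle H S A) (π : PurePolicy H S A)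
    (i : Fin m) : ℕ → Learn ℝ
  | 0 => pure 0
  | N + 1 => do
    let τ ← play π
    let rest ← sumReturns play π i N
    pure ((τ.map fun x => x.r i).sum + rest)

/-- Monte Carlo estimate of the value of player `i` under `π` from `N` episodes. -/
def mcValue {H S m : ℕ} {A : Fin m → ℕ} (play : Oracle H S A) (π : PurePolicy H S A)
    (i : Fin m) (N : ℕ) : Learn ℝ := do
  let total ← sumReturns play π i N
  pure (total / N)

/-- A player, a new policy for that player, and the estimated gain `Δ`. -/
structure Candidate (H S : ℕ) {m : ℕ} (A : Fin m → ℕ) where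
  player : Fin m
  policy : PlayerPure H S (A player)
  gain : ℝ

/-- The absolute constants of the best-response algorithm: those of the bonus, and the factors
in the numbers of UCBVI-UPLOW episodes and of Monte Carlo episodes. -/
structure Consts where
  bonus : ℝ
  corr : ℝ
  train : ℝ
  eval : ℝ

/-- The number of UCBVI-UPLOW episodes for a player with `a` actions at accuracy `δ`. -/
def trainEpisodes (k : Consts) (H S a : ℕ) (ι δ : ℝ) : ℕ :=
  ⌊k.train * ((H : ℝ) ^ 3 * S * a * ι / δ ^ 2) * (1 + δ * S * ι)⌋₊

/-- The number of Monte Carlo episodes per estimate at accuracy `δ`. -/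
def evalEpisodes (k : Consts) (H : ℕ) (ι δ : ℝ) : ℕ :=
  ⌊k.eval * ((H : ℝ) ^ 2 * ι / δ ^ 2)⌋₊

section Algorithm

variable {H S m : ℕ} {A : Fin m → ℕ} [∀ i, NeZero (A i)]

/-- `K` further episodes of UCBVI-UPLOW for player `i`, the other players following `π`.
`D` is the data so far, `best` the smallest certified gap so far and `out` the policy to which
it belongs. -/
def ucbviLoop (play : Oracle H S A) (s₁ : Fin S) (q : BonusParams) (π : PurePolicy H S A)
    (i : Fin m) : ℕ → AgentData H S (A i) → ℝ → PlayerPure H S (A i) →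
      Learn (PlayerPure H S (A i))
  | 0, _, _, out => pure out
  | K + 1, D, best, out => do
    let τ ← play (Function.update π i (D.greedyPolicy q))
    let D' := τ.foldl (AgentData.record i) D
    if D.gap q s₁ < best then
      ucbviLoop play s₁ q π i K D' (D.gap q s₁) (D.greedyPolicy q)
    else
      ucbviLoop play s₁ q π i K D' best out

/-- UCBVI-UPLOW for player `i`, run for `K` episodes with the other players fixed to `π`. -/
def ucbviUpLow (play : Oracle H S A) (s₁ : Fin S) (q : BonusParams) (K : ℕ)
    (π : PurePolicy H S A) (i : Fin m) : Learn (PlayerPure H S (A i)) :=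
  ucbviLoop play s₁ q π i K AgentData.empty H (π i)

/-- The estimate for player `i`: an approximate best response `π̂ᵢ` to `π` by UCBVI-UPLOW, and
the difference of the Monte Carlo values of `(π̂ᵢ, π₋ᵢ)` and `π`. -/
def estimateGain (k : Consts) (play : Oracle H S A) (s₁ : Fin S) (ι δ : ℝ)
    (π : PurePolicy H S A) (i : Fin m) : Learn (Candidate H S A) := do
  let new ← ucbviUpLow play s₁ ⟨k.bonus, k.corr, ι⟩ (trainEpisodes k H S (A i) ι δ) π i
  let vNew ← mcValue play (Function.update π i new) i (evalEpisodes k H ι δ)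
  let vOld ← mcValue play π i (evalEpisodes k H ι δ)
  pure ⟨i, new, vNew - vOld⟩

/-- Estimate_NE-Gap: the candidate with the largest estimated gain
(`none` only if there are no players). -/
def estimateNEGap (k : Consts) (play : Oracle H S A) (s₁ : Fin S) (ι δ : ℝ)
    (π : PurePolicy H S A) : Learn (Option (Candidate H S A)) := do
  let cands ← (List.finRange m).mapM (estimateGain k play s₁ ι δ π)
  pure (cands.argmax Candidate.gain)

/-- Best-response dynamics started at `π`, cut off after `T` passes through its loop: the result
is `some π̂` if the algorithm has stopped with output `π̂`, and `none` if it is still running. -/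
def bestResponse (k : Consts) (play : Oracle H S A) (s₁ : Fin S) (ι ε : ℝ) :
    ℕ → PurePolicy H S A → Learn (Option (PurePolicy H S A))
  | 0, _ => pure none
  | T + 1, π => do
    match ← estimateNEGap k play s₁ ι (ε / 8) π with
    | none => pure (some π)
    | some c =>
      if c.gain > ε / 2 then
        bestResponse k play s₁ ι ε T (Function.update π c.player c.policy)
      else
        pure (some π)

end Algorithm

/-- The logarithmic factor `ι = log (H² S m (max_i A_i) / (ε p))`. -/
def logFactor (H S : ℕ) {m : ℕ} (A : Fin m → ℕ) (ε p : ℝ) : ℝ :=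
  Real.log ((H : ℝ) ^ 2 * S * m * (Finset.univ.sup A : ℕ) / (ε * p))

/-- The bound on the number of episodes, up to an absolute constant; `range` is
`Φ_max - Φ_min`. -/
def episodeBound (H S : ℕ) {m : ℕ} (A : Fin m → ℕ) (range ε p : ℝ) : ℝ :=
  (range + ε) * (H : ℝ) ^ 3 * S * (∑ i, (A i : ℝ)) * logFactor H S A ε p / ε ^ 3 *
    (1 + ε * S * logFactor H S A ε p)

end

/-! Every accepted replacement raises the potential by more than ε/4, and the potential has bounded
range, so only about 4(Φ_max − Φ_min)/ε replacements can occur. When none is accepted, all estimated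
gains are at most ε/2, and accurate estimates then make the profile ε-Nash. It remains to show that
one round is accurate with very high probability and to take a union bound over rounds and players.
The number of rounds in this bound must not depend on Φ. This holds because the range of Φ is at
most mH: Φ changes by at most H when one player changes policy.

With the opponents fixed, player i faces a Markov decision process (`indP`, `indR`), and randomized
deviations cannot beat its optimal value (`valueToGo_update_le`). Accuracy thus means that
UCBVI-UPLOW finds a δ-optimal policy there and that two Monte Carlo estimates are δ-accurate.

The analysis of UCBVI-UPLOW has four ingredients. Concentration: a supermartingale maximal
inequality (`ville`) gives, at all times of the adaptive run, a Bernstein bound for the fixed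
function V* and a relative bound for every transition frequency (`Confident`). Optimism: the bonus
makes the upper value exceed V* and keeps the lower value below the value of the greedy policy
(`sandwich`). The certified gap therefore bounds the suboptimality. Width: the gap satisfies a
recursion with factor 1 + 8/H, so it is at most e⁸ times the expected total of the bonuses, written
with the true variance of V* (`gap_le`). Counting: sorting the visits by cell and applying
Cauchy-Schwarz bounds the observed bonuses by the root of the total variance
(`histSum_widthBonus_le`). That variance is at most H² per episode in expectation, not H³
(`polEval_nextVar_optVal_le`). Expected and observed totals are compared up to constant factors.
Since the smallest gap is at most the average one, K episodes of order H³SAι/δ²·(1 + δSι) suffice.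

All failure probabilities are e^(−160ι), a high negative power of the argument of the logarithm,
while all counts in the union bounds are polynomial in it. If that argument is below 2 this fails,
but then the game has no choice or randomness. -/

open scoped ENNReal

/-! ### Expectations and failure probabilities under a `PMF` -/

namespace PMF

variable {α β : Type}

/-- The expectation of a nonnegative extended real function. -/
noncomputable def lexp (μ : PMF α) (f : α → ℝ≥0∞) : ℝ≥0∞ := ∑' a, μ a * f a

theorem lexp_pure (a : α) (f : α → ℝ≥0∞) : (PMF.pure a).lexp f = f a := by
  unfold lexp
  rw [tsum_eq_single a]
  · simp
  · intro b hb
    simp [hb]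

theorem lexp_bind (μ : PMF α) (κ : α → PMF β) (f : β → ℝ≥0∞) :
    (μ.bind κ).lexp f = μ.lexp fun a => (κ a).lexp f := by
  unfold lexp
  simp only [PMF.bind_apply, ← ENNReal.tsum_mul_left, ← ENNReal.tsum_mul_right]
  rw [ENNReal.tsum_comm]
  simp only [mul_assoc]

theorem lexp_map (μ : PMF α) (g : α → β) (f : β → ℝ≥0∞) :
    (μ.map g).lexp f = μ.lexp fun a => f (g a) := by
  rw [← PMF.bind_pure_comp, lexp_bind]
  simp only [Function.comp, lexp_pure]

theorem lexp_mono (μ : PMF α) {f g : α → ℝ≥0∞} (h : ∀ a ∈ μ.support, f a ≤ g a) :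
    μ.lexp f ≤ μ.lexp g := by
  refine ENNReal.tsum_le_tsum fun a => ?_
  by_cases ha : a ∈ μ.support
  · gcongr
    exact h a ha
  · rw [(PMF.apply_eq_zero_iff μ a).2 ha]
    simp

theorem lexp_congr (μ : PMF α) {f g : α → ℝ≥0∞} (h : ∀ a ∈ μ.support, f a = g a) :
    μ.lexp f = μ.lexp g :=
  le_antisymm (μ.lexp_mono fun a ha => (h a ha).le) (μ.lexp_mono fun a ha => (h a ha).ge)

theorem lexp_const (μ : PMF α) (c : ℝ≥0∞) : μ.lexp (fun _ => c) = c := by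
  simp [lexp, ENNReal.tsum_mul_right]

theorem lexp_const_mul (μ : PMF α) (c : ℝ≥0∞) (f : α → ℝ≥0∞) :
    μ.lexp (fun a => c * f a) = c * μ.lexp f := by
  simp only [lexp, ← ENNReal.tsum_mul_left]
  exact tsum_congr fun a => by ring

theorem lexp_add (μ : PMF α) (f g : α → ℝ≥0∞) :
    μ.lexp (fun a => f a + g a) = μ.lexp f + μ.lexp g := by
  simp only [lexp, mul_add, ENNReal.tsum_add]

theorem toOuterMeasure_bind_eq_lexp (μ : PMF α) (κ : α → PMF β) (s : Set β) :
    (μ.bind κ).toOuterMeasure s = μ.lexp fun a => (κ a).toOuterMeasure s :=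
  toOuterMeasure_bind_apply _ _ _

theorem toOuterMeasure_eq_lexp (μ : PMF α) (s : Set α) :
    μ.toOuterMeasure s = μ.lexp (s.indicator fun _ => 1) := by
  rw [toOuterMeasure_apply, lexp]
  refine tsum_congr fun a => ?_
  by_cases ha : a ∈ s <;> simp [ha]

theorem toOuterMeasure_le_one (μ : PMF α) (s : Set α) : μ.toOuterMeasure s ≤ 1 := by
  rw [toOuterMeasure_eq_lexp]
  refine (μ.lexp_mono (g := fun _ => 1) fun a _ => ?_).trans (μ.lexp_const 1).le
  exact Set.indicator_le_self' (fun _ _ => zero_le) a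

theorem toOuterMeasure_add_compl (μ : PMF α) (s : Set α) :
    μ.toOuterMeasure s + μ.toOuterMeasure sᶜ = 1 := by
  rw [toOuterMeasure_eq_lexp, toOuterMeasure_eq_lexp, ← lexp_add]
  refine (μ.lexp_congr (g := fun _ => 1) fun a _ => ?_).trans (μ.lexp_const 1)
  by_cases ha : a ∈ s <;> simp [ha]

/-- Markov's inequality. -/
theorem toOuterMeasure_le_lexp (μ : PMF α) (f : α → ℝ≥0∞) (s : Set α) (h : ∀ a ∈ s, 1 ≤ f a) :
    μ.toOuterMeasure s ≤ μ.lexp f := by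
  rw [toOuterMeasure_eq_lexp]
  refine μ.lexp_mono fun a _ => ?_
  by_cases ha : a ∈ s <;> simp [ha, h]

/-- Exponential Markov inequality. -/
theorem toOuterMeasure_le_exp (μ : PMF α) (Y : α → ℝ) (ℓ : ℝ)
    (h : μ.lexp (fun a => ENNReal.ofReal (Real.exp (Y a))) ≤ 1) :
    μ.toOuterMeasure {a | ℓ ≤ Y a} ≤ ENNReal.ofReal (Real.exp (-ℓ)) := by
  refine (μ.toOuterMeasure_le_lexp
    (fun a => ENNReal.ofReal (Real.exp (-ℓ)) * ENNReal.ofReal (Real.exp (Y a))) _ ?_).trans ?_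
  · intro a ha
    rw [← ENNReal.ofReal_mul (Real.exp_pos _).le, ← Real.exp_add, ENNReal.one_le_ofReal]
    exact Real.one_le_exp (by have : ℓ ≤ Y a := ha; linarith)
  · rw [lexp_const_mul]
    exact mul_le_of_le_one_right (zero_le) h

theorem lexp_ofReal_of_fintype [Fintype α] (μ : PMF α) (f : α → ℝ) (hf : ∀ a, 0 ≤ f a) :
    μ.lexp (fun a => ENNReal.ofReal (f a)) = ENNReal.ofReal (∑ a, (μ a).toReal * f a) := by
  rw [lexp, tsum_fintype, ENNReal.ofReal_sum_of_nonneg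
    (fun a _ => mul_nonneg ENNReal.toReal_nonneg (hf a))]
  refine Finset.sum_congr rfl fun a _ => ?_
  rw [ENNReal.ofReal_mul ENNReal.toReal_nonneg, ENNReal.ofReal_toReal (μ.apply_ne_top a)]

theorem sum_toReal_of_fintype [Fintype α] (μ : PMF α) : ∑ a, (μ a).toReal = 1 := by
  rw [← ENNReal.toReal_sum fun a _ => μ.apply_ne_top a, ← tsum_fintype (L := .unconditional _),
    μ.tsum_coe, ENNReal.toReal_one]

end PMF

/-! ### Union bounds for programs -/

/-- Started with counter `n`, the program `prog` violates `Good` with probability at most `q`. -/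
def Learn.FailsWithin {α : Type} (prog : Learn α) (n : ℕ) (Good : α → ℕ → Prop) (q : ℝ≥0∞) :
    Prop :=
  (prog n : PMF (α × ℕ)).toOuterMeasure {x | ¬ Good x.1 x.2} ≤ q

namespace Learn.FailsWithin

variable {α β : Type} {prog : Learn α} {f : α → Learn β} {n : ℕ} {Good Good' : α → ℕ → Prop}
  {Post : β → ℕ → Prop} {q q' : ℝ≥0∞}

theorem pure {a : α} (h : Good a n) : FailsWithin (pure a : Learn α) n Good 0 := by
  change (PMF.pure (a, n) : PMF (α × ℕ)).toOuterMeasure _ ≤ 0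
  rw [PMF.toOuterMeasure_pure_apply, if_neg (by simpa using h)]

theorem mono (h : FailsWithin prog n Good q) (hG : ∀ a k, Good a k → Good' a k) (hq : q ≤ q') :
    FailsWithin prog n Good' q' := by
  refine le_trans (MeasureTheory.measure_mono ?_) (le_trans h hq)
  exact fun x hx hx' => hx (hG _ _ hx')

/-- A run fails either because the first program misses `Good`, or because the continuation fails
from a good state; the two probabilities add. The counter is part of `Good`, so episode counts
travel through the same argument. -/
theorem bind (h : FailsWithin prog n Good q)
    (hf : ∀ a k, Good a k → FailsWithin (f a) k Post q') :
    FailsWithin (prog >>= f) n Post (q + q') := by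
  change ((prog n).bind fun x => f x.1 x.2).toOuterMeasure _ ≤ _
  rw [PMF.toOuterMeasure_bind_eq_lexp]
  calc _ ≤ (prog n).lexp fun x =>
        ({x : α × ℕ | ¬ Good x.1 x.2}.indicator (fun _ => 1) x) + q' := by
        refine PMF.lexp_mono _ fun x _ => ?_
        by_cases hx : Good x.1 x.2
        · exact (hf _ _ hx).trans le_add_self
        · rw [Set.indicator_of_mem (by exact hx)]
          exact (PMF.toOuterMeasure_le_one _ _).trans le_self_add
    _ ≤ q + q' := by
        rw [PMF.lexp_add, PMF.lexp_const, ← PMF.toOuterMeasure_eq_lexp]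
        gcongr
        exact h

end Learn.FailsWithin

/-! ### Adaptive repetition and Ville's inequality -/

/-- Repeat a random experiment `K` times, where each experiment may depend on the list of the
earlier outcomes, most recent first. -/
noncomputable def adaptiveRun {α : Type} (step : List α → PMF α) : ℕ → List α → PMF (List α)
  | 0, h => PMF.pure h
  | K + 1, h => (step h).bind fun τ => adaptiveRun step K (τ :: h)

section Ville

variable {α : Type} {step : List α → PMF α}

/-- Histories grow at the head, so the suffixes of a history are exactly its earlier stages.
Statements uniform over time become statements about all suffixes. -/
theorem suffix_of_mem_support_adaptiveRun {K : ℕ} {h h' : List α}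
    (hh : h' ∈ (adaptiveRun step K h).support) : h <:+ h' := by
  induction K generalizing h with
  | zero =>
    rw [adaptiveRun, PMF.mem_support_pure_iff] at hh
    exact hh ▸ List.suffix_rfl
  | succ K ih =>
    rw [adaptiveRun, PMF.mem_support_bind_iff] at hh
    obtain ⟨τ, _, hτ⟩ := hh
    exact (List.suffix_cons τ h).trans (ih hτ)

theorem length_of_mem_support_adaptiveRun {K : ℕ} {h h' : List α}
    (hh : h' ∈ (adaptiveRun step K h).support) : h'.length = h.length + K := by
  induction K generalizing h with
  | zero =>
    rw [adaptiveRun, PMF.mem_support_pure_iff] at hh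
    simp [hh]
  | succ K ih =>
    rw [adaptiveRun, PMF.mem_support_bind_iff] at hh
    obtain ⟨τ, _, hτ⟩ := hh
    rw [ih hτ, List.length_cons]
    ring

/-- Every outcome in an adaptive run is in the support of its experiment. -/
theorem mem_support_of_cons_suffix_adaptiveRun {K : ℕ} {h h' : List α}
    (hh : h' ∈ (adaptiveRun step K h).support) {τ : α} {q : List α} (hq : τ :: q <:+ h')
    (hl : h.length ≤ q.length) : τ ∈ (step q).support := by
  induction K generalizing h with
  | zero =>
    rw [adaptiveRun, PMF.mem_support_pure_iff] at hh
    have := hq.length_le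
    rw [hh, List.length_cons] at this
    omega
  | succ K ih =>
    rw [adaptiveRun, PMF.mem_support_bind_iff] at hh
    obtain ⟨σ, hσ, hh⟩ := hh
    have hs := suffix_of_mem_support_adaptiveRun hh
    rcases hl.eq_or_lt with hl | hl
    · have hlen : (τ :: q).length = (σ :: h).length := by simp [hl]
      have heq : τ :: q = σ :: h :=
        (List.suffix_of_suffix_length_le hq hs hlen.le).eq_of_length hlen
      obtain ⟨rfl, rfl⟩ := List.cons.inj heq
      exact hσ
    · exact ih hh (by simpa using hl)

/-- Stop at the first history where X reaches 1. If this has happened already, the bound exceeds 1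
and is trivial; otherwise the crossing lies beyond the next outcome, and averaging the bound there
uses the supermartingale property. -/
theorem ville (X : List α → ℝ≥0∞) (hX : ∀ h, (step h).lexp (fun τ => X (τ :: h)) ≤ X h)
    (K : ℕ) (h : List α) :
    (adaptiveRun step K h).toOuterMeasure
      {h' | ∃ q, q <:+ h' ∧ h.length ≤ q.length ∧ 1 ≤ X q} ≤ X h := by
  induction K generalizing h with
  | zero =>
    rw [adaptiveRun, PMF.toOuterMeasure_pure_apply]
    split_ifs with hh
    · obtain ⟨q, hq, hl, h1⟩ := hh
      rwa [hq.eq_of_length_le hl] at h1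
    · exact zero_le
  | succ K ih =>
    by_cases h1 : 1 ≤ X h
    · exact (PMF.toOuterMeasure_le_one _ _).trans h1
    rw [adaptiveRun, PMF.toOuterMeasure_bind_eq_lexp]
    refine le_trans (PMF.lexp_mono _ fun τ _ => ?_) (hX h)
    refine le_trans (PMF.toOuterMeasure_mono _ ?_) (ih (τ :: h))
    rintro h' ⟨⟨q, hq, hl, hXq⟩, hs⟩
    refine ⟨q, hq, ?_, hXq⟩
    rcases hl.eq_or_lt with hl | hl
    · have hs' := (List.suffix_cons τ h).trans (suffix_of_mem_support_adaptiveRun hs)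
      rw [(List.suffix_of_suffix_length_le hq hs' hl.ge).eq_of_length hl.symm] at hXq
      exact absurd hXq h1
    · simpa using hl

/-- Ville's inequality for exponential supermartingales. -/
theorem ville_exp (Y : List α → ℝ) (h0 : Y [] = 0)
    (hY : ∀ h, (step h).lexp (fun τ => ENNReal.ofReal (Real.exp (Y (τ :: h) - Y h))) ≤ 1)
    (K : ℕ) (ℓ : ℝ) :
    (adaptiveRun step K []).toOuterMeasure {h' | ∃ q, q <:+ h' ∧ ℓ ≤ Y q} ≤
      ENNReal.ofReal (Real.exp (-ℓ)) := by
  have key := ville (step := step) (fun h => ENNReal.ofReal (Real.exp (Y h - ℓ))) (fun h => by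
    have : ∀ τ, ENNReal.ofReal (Real.exp (Y (τ :: h) - ℓ)) = ENNReal.ofReal (Real.exp (Y h - ℓ)) *
        ENNReal.ofReal (Real.exp (Y (τ :: h) - Y h)) := fun τ => by
      rw [← ENNReal.ofReal_mul (Real.exp_pos _).le, ← Real.exp_add]
      ring_nf
    simp only [this, PMF.lexp_const_mul]
    exact mul_le_of_le_one_right (zero_le) (hY h)) K []
  rw [h0, zero_sub] at key
  refine le_trans (MeasureTheory.measure_mono ?_) key
  rintro h' ⟨q, hq, hl⟩
  refine ⟨q, hq, by simp, ?_⟩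
  rw [ENNReal.one_le_ofReal]
  exact Real.one_le_exp (by linarith)

end Ville

/-! ### Finite-horizon Markov decision processes -/

theorem argmaxFin_spec {a : ℕ} [NeZero a] (f : Fin a → ℝ) (b : Fin a) : f b ≤ f (argmaxFin f) :=
  Classical.choose_spec (Finite.exists_max f) b

namespace MDP

variable {H S a : ℕ} (p : Fin H → Fin S → Fin a → PMF (Fin S))

/-- The expectation of `f` at the next state. -/
noncomputable def nextMean (h : Fin H) (s : Fin S) (b : Fin a) (f : Fin S → ℝ) : ℝ :=
  ∑ s', (p h s b s').toReal * f s'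

/-- The variance of `f` at the next state. -/
noncomputable def nextVar (h : Fin H) (s : Fin S) (b : Fin a) (f : Fin S → ℝ) : ℝ :=
  nextMean p h s b fun s' => (f s' - nextMean p h s b f) ^ 2

/-- The expected total of `g` along the last `n` steps, from state `s`, under the pure
policy `ν`. -/
noncomputable def polEval (ν : PlayerPure H S a) (g : Fin H → Fin S → Fin a → ℝ) :
    ℕ → Fin S → ℝ
  | 0, _ => 0
  | n + 1, s =>
    if hn : n < H then
      g (Fin.rev ⟨n, hn⟩) s (ν (Fin.rev ⟨n, hn⟩) s) +
        nextMean p (Fin.rev ⟨n, hn⟩) s (ν (Fin.rev ⟨n, hn⟩) s) (polEval ν g n)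
    else 0

/-- The optimal value with `n` steps remaining. -/
noncomputable def optVal [NeZero a] (r : Fin H → Fin S → Fin a → ℝ) : ℕ → Fin S → ℝ
  | 0, _ => 0
  | n + 1, s =>
    if hn : n < H then
      let Q := fun b => r (Fin.rev ⟨n, hn⟩) s b + nextMean p (Fin.rev ⟨n, hn⟩) s b (optVal r n)
      Q (argmaxFin Q)
    else 0

variable {p} {h : Fin H} {s : Fin S} {b : Fin a} {f g : Fin S → ℝ} {c : ℝ}

theorem nextMean_const : nextMean p h s b (fun _ => c) = c := by
  rw [nextMean, ← Finset.sum_mul, PMF.sum_toReal_of_fintype, one_mul]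

theorem nextMean_mono (hfg : ∀ s', f s' ≤ g s') : nextMean p h s b f ≤ nextMean p h s b g :=
  Finset.sum_le_sum fun s' _ => mul_le_mul_of_nonneg_left (hfg s') ENNReal.toReal_nonneg

theorem nextMean_nonneg (hf : ∀ s', 0 ≤ f s') : 0 ≤ nextMean p h s b f :=
  Finset.sum_nonneg fun s' _ => mul_nonneg ENNReal.toReal_nonneg (hf s')

theorem nextMean_le (hf : ∀ s', f s' ≤ c) : nextMean p h s b f ≤ c :=
  (nextMean_mono hf).trans nextMean_const.le

theorem le_nextMean (hf : ∀ s', c ≤ f s') : c ≤ nextMean p h s b f :=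
  nextMean_const.ge.trans (nextMean_mono hf)

theorem nextMean_add :
    nextMean p h s b (fun s' => f s' + g s') = nextMean p h s b f + nextMean p h s b g := by
  simp only [nextMean, mul_add, Finset.sum_add_distrib]

theorem nextMean_sub :
    nextMean p h s b (fun s' => f s' - g s') = nextMean p h s b f - nextMean p h s b g := by
  simp only [nextMean, mul_sub, Finset.sum_sub_distrib]

theorem nextMean_const_mul :
    nextMean p h s b (fun s' => c * f s') = c * nextMean p h s b f := by
  simp only [nextMean, Finset.mul_sum]
  exact Finset.sum_congr rfl fun _ _ => by ring

theorem nextVar_nonneg : 0 ≤ nextVar p h s b f := nextMean_nonneg fun _ => sq_nonneg _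

theorem nextMean_sub_sq :
    nextMean p h s b (fun s' => (f s' - c) ^ 2) =
      nextMean p h s b (fun s' => f s' ^ 2) - 2 * c * nextMean p h s b f + c ^ 2 := by
  have : (fun s' => (f s' - c) ^ 2) = fun s' => (f s' ^ 2 - (2 * c) * f s') + c ^ 2 := by
    funext s'; ring
  rw [this, nextMean_add (g := fun _ => c ^ 2), nextMean_sub (g := fun s' => (2 * c) * f s'),
    nextMean_const_mul, nextMean_const]

theorem nextVar_eq :
    nextVar p h s b f = nextMean p h s b (fun s' => f s' ^ 2) - nextMean p h s b f ^ 2 := by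
  rw [nextVar, nextMean_sub_sq]
  ring

theorem nextVar_le_sub_sq (c : ℝ) :
    nextVar p h s b f ≤ nextMean p h s b (fun s' => (f s' - c) ^ 2) := by
  rw [nextMean_sub_sq, nextVar_eq]
  nlinarith [sq_nonneg (nextMean p h s b f - c)]

theorem polEval_nonneg {ν : PlayerPure H S a} {g : Fin H → Fin S → Fin a → ℝ}
    (hg : ∀ h s b, 0 ≤ g h s b) (n : ℕ) (s : Fin S) : 0 ≤ polEval p ν g n s := by
  induction n generalizing s with
  | zero => exact le_rfl
  | succ n ih =>
    rw [polEval]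
    split_ifs
    · exact add_nonneg (hg _ _ _) (nextMean_nonneg ih)
    · exact le_rfl

theorem polEval_le {ν : PlayerPure H S a} {g : Fin H → Fin S → Fin a → ℝ} {c : ℝ} (hc : 0 ≤ c)
    (hg : ∀ h s b, g h s b ≤ c) (n : ℕ) (s : Fin S) : polEval p ν g n s ≤ n * c := by
  induction n generalizing s with
  | zero => simp [polEval]
  | succ n ih =>
    rw [polEval]
    split_ifs
    · push_cast
      linarith [hg (Fin.rev ⟨n, by assumption⟩) s (ν (Fin.rev ⟨n, by assumption⟩) s),
        nextMean_le (p := p) (h := Fin.rev ⟨n, by assumption⟩) (s := s)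
          (b := ν (Fin.rev ⟨n, by assumption⟩) s) ih]
    · positivity

section Optimal

variable [NeZero a] {r : Fin H → Fin S → Fin a → ℝ}

theorem le_optVal_succ {n : ℕ} (hn : n < H) (s : Fin S) (b : Fin a) :
    r (Fin.rev ⟨n, hn⟩) s b + nextMean p (Fin.rev ⟨n, hn⟩) s b (optVal p r n) ≤
      optVal p r (n + 1) s := by
  rw [optVal, dif_pos hn]
  exact argmaxFin_spec
    (fun b => r (Fin.rev ⟨n, hn⟩) s b + nextMean p (Fin.rev ⟨n, hn⟩) s b (optVal p r n)) b

theorem optVal_succ_le {n : ℕ} (hn : n < H) (s : Fin S) (h : ∀ b,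
    r (Fin.rev ⟨n, hn⟩) s b + nextMean p (Fin.rev ⟨n, hn⟩) s b (optVal p r n) ≤ c) :
    optVal p r (n + 1) s ≤ c := by
  rw [optVal, dif_pos hn]
  exact h _

theorem optVal_of_le {n : ℕ} (hn : H ≤ n) (s : Fin S) : optVal p r (n + 1) s = 0 := by
  rw [optVal, dif_neg (not_lt.2 hn)]

theorem polEval_le_optVal (ν : PlayerPure H S a) (n : ℕ) (s : Fin S) :
    polEval p ν r n s ≤ optVal p r n s := by
  induction n generalizing s with
  | zero => exact le_rfl
  | succ n ih =>
    by_cases hn : n < H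
    · rw [polEval, dif_pos hn]
      exact (add_le_add_right (nextMean_mono ih) _).trans (le_optVal_succ hn s _)
    · rw [polEval, dif_neg hn, optVal_of_le (not_lt.1 hn)]

variable (hr : ∀ h s b, r h s b ∈ Set.Icc (0 : ℝ) 1)
include hr

theorem optVal_nonneg (n : ℕ) (s : Fin S) : 0 ≤ optVal p r n s :=
  (polEval_nonneg (fun h s b => (hr h s b).1) n s).trans
    (polEval_le_optVal (fun _ _ => 0) n s)

theorem optVal_le (n : ℕ) (s : Fin S) : optVal p r n s ≤ n := by
  induction n generalizing s with
  | zero => simp [optVal]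
  | succ n ih =>
    by_cases hn : n < H
    · refine optVal_succ_le hn s fun b => ?_
      push_cast
      linarith [(hr (Fin.rev ⟨n, hn⟩) s b).2,
        nextMean_le (p := p) (h := Fin.rev ⟨n, hn⟩) (s := s) (b := b) ih]
    · rw [optVal_of_le (not_lt.1 hn)]
      positivity

theorem optVal_le_horizon {n : ℕ} (hn : n ≤ H) (s : Fin S) : optVal p r n s ≤ H :=
  (optVal_le hr n s).trans (by exact_mod_cast hn)

theorem nextMean_optVal_le {n : ℕ} (hn : n < H) (s : Fin S) (b : Fin a) :
    nextMean p (Fin.rev ⟨n, hn⟩) s b (optVal p r n) ≤ optVal p r (n + 1) s := by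
  linarith [le_optVal_succ (p := p) (r := r) hn s b, (hr (Fin.rev ⟨n, hn⟩) s b).1]

/-- Along any policy, the variances of the optimal value function add up to at most `H ^ 2`. -/
theorem polEval_nextVar_optVal_le (ν : PlayerPure H S a) (s : Fin S) :
    polEval p ν (fun h s b => nextVar p h s b (optVal p r h.rev)) H s ≤ (H : ℝ) ^ 2 := by
  -- The function 2HV* − V*² serves as a potential. It is increasing in V* on [0, H] and PV* ≤ V*
  -- since rewards are nonnegative, so its drop in one step pays for the variance P(V*²) − (PV*)².
  -- Its maximum is H².
  have key : ∀ n, n ≤ H → ∀ s,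
      polEval p ν (fun h s b => nextVar p h s b (optVal p r h.rev)) n s ≤
        2 * H * optVal p r n s - optVal p r n s ^ 2 := by
    intro n
    induction n with
    | zero => intro _ s; simp [polEval, optVal]
    | succ n ih =>
      intro hn s
      have hn' : n < H := hn
      rw [polEval, dif_pos hn']
      set h := Fin.rev ⟨n, hn'⟩ with hh
      have hrev : ((h.rev : Fin H) : ℕ) = n := by simp [hh]
      simp only [hrev]
      set b := ν h s
      have h1 : nextMean p h s b
          (polEval p ν (fun h s b => nextVar p h s b (optVal p r h.rev)) n) ≤
          2 * H * nextMean p h s b (optVal p r n) -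
            nextMean p h s b (fun s' => optVal p r n s' ^ 2) := by
        rw [← nextMean_const_mul, ← nextMean_sub]
        exact nextMean_mono (ih hn'.le)
      rw [nextVar_eq]
      have h2 := nextMean_optVal_le (p := p) hr hn' s b
      have h3 := optVal_le_horizon (p := p) hr hn s
      nlinarith
  nlinarith [key H le_rfl s, sq_nonneg ((H : ℝ) - optVal p r H s)]

end Optimal

end MDP

/-! ### One player against fixed opponents -/

namespace MarkovGame

open MDP

variable {H S m : ℕ} {A : Fin m → ℕ} (G : MarkovGame H S A) (π : PurePolicy H S A) (i : Fin m)

/-- The transition kernels faced by player `i` when the others follow `π`. -/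
noncomputable def indP (h : Fin H) (s : Fin S) (b : Fin (A i)) : PMF (Fin S) :=
  G.P h s (Function.update (fun j => π j h s) i b)

/-- The rewards of player `i` when the others follow `π`. -/
noncomputable def indR (h : Fin H) (s : Fin S) (b : Fin (A i)) : ℝ :=
  G.r i h s (Function.update (fun j => π j h s) i b)

theorem indR_mem (h : Fin H) (s : Fin S) (b : Fin (A i)) :
    G.indR π i h s b ∈ Set.Icc (0 : ℝ) 1 := G.r_mem _ _ _ _

variable {G π i}

theorem update_apply_apply (ν : PlayerPure H S (A i)) (h : Fin H) (s : Fin S) :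
    (fun j => Function.update π i ν j h s) = Function.update (fun j => π j h s) i (ν h s) := by
  funext j
  by_cases hj : j = i
  · subst hj; simp
  · simp [hj]

theorem rollout_succ (ν : PlayerPure H S (A i)) {n : ℕ} (hn : n < H) (s : Fin S) :
    G.rollout (Function.update π i ν) (n + 1) s =
      (G.indP π i (Fin.rev ⟨n, hn⟩) s (ν (Fin.rev ⟨n, hn⟩) s)).bind fun s' =>
        (G.rollout (Function.update π i ν) n s').map fun τ =>
          ⟨Fin.rev ⟨n, hn⟩, s,
            Function.update (fun j => π j (Fin.rev ⟨n, hn⟩) s) i (ν (Fin.rev ⟨n, hn⟩) s),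
            fun j => G.r j (Fin.rev ⟨n, hn⟩) s
              (Function.update (fun j => π j (Fin.rev ⟨n, hn⟩) s) i (ν (Fin.rev ⟨n, hn⟩) s)),
            s'⟩ :: τ := by
  rw [rollout, dif_pos hn]
  simp only [update_apply_apply, indP]

theorem rollout_of_le (ρ : PurePolicy H S A) {n : ℕ} (hn : ¬ n < H) (s : Fin S) :
    G.rollout ρ (n + 1) s = PMF.pure [] := by
  rw [rollout, dif_neg hn]

/-- Exponentials of additive functionals that are supermartingale increments in every step. -/
theorem lexp_rollout_exp_le_one (ν : PlayerPure H S (A i))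
    (g : Fin H → Fin S → Fin (A i) → Fin S → ℝ)
    (hg : ∀ h s b, nextMean (G.indP π i) h s b (fun s' => Real.exp (g h s b s')) ≤ 1)
    (n : ℕ) (s : Fin S) :
    (G.rollout (Function.update π i ν) n s).lexp (fun τ => ENNReal.ofReal
      (Real.exp ((τ.map fun x => g x.h x.s (x.a i) x.s').sum))) ≤ 1 := by
  induction n generalizing s with
  | zero => rw [rollout, PMF.lexp_pure]; simp
  | succ n ih =>
    by_cases hn : n < H
    · rw [rollout_succ ν hn, PMF.lexp_bind]
      simp only [PMF.lexp_map, List.map_cons, List.sum_cons, Real.exp_add,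
        ENNReal.ofReal_mul (Real.exp_pos _).le, PMF.lexp_const_mul, Function.update_self]
      refine le_trans (PMF.lexp_mono _ fun s' _ => mul_le_of_le_one_right zero_le (ih s')) ?_
      rw [PMF.lexp_ofReal_of_fintype _ _ (fun _ => (Real.exp_pos _).le)]
      exact ENNReal.ofReal_le_one.2 (hg _ s _)
    · rw [rollout_of_le _ hn, PMF.lexp_pure]; simp

/-- The offset t is large enough to keep the integrand nonnegative along every trajectory, so
truncation by `ENNReal.ofReal` does nothing and the expectation is linear. The induction moves each
reward into t, which costs at most c. -/
theorem lexp_rollout_affine (ν : PlayerPure H S (A i)) (g : Fin H → Fin S → Fin (A i) → ℝ)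
    {c : ℝ} (hc : 0 ≤ c) (hg : ∀ h s b, -c ≤ g h s b) (n : ℕ) (s : Fin S) (t : ℝ)
    (ht : n * c ≤ t) :
    (G.rollout (Function.update π i ν) n s).lexp (fun τ => ENNReal.ofReal
      (t + (τ.map fun x => g x.h x.s (x.a i)).sum)) =
      ENNReal.ofReal (t + polEval (G.indP π i) ν g n s) := by
  induction n generalizing s t with
  | zero => rw [rollout, PMF.lexp_pure]; simp [polEval]
  | succ n ih =>
    by_cases hn : n < H
    · rw [rollout_succ ν hn, PMF.lexp_bind, polEval, dif_pos hn]
      set h := Fin.rev ⟨n, hn⟩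
      have hg' := hg h s (ν h s)
      push_cast at ht
      simp only [PMF.lexp_map, List.map_cons, List.sum_cons, Function.update_self, ← add_assoc]
      have ih' := fun s' => ih s' (t + g h s (ν h s)) (by linarith)
      simp only [ih']
      have hp : ∀ n s, -(n * c) ≤ polEval (G.indP π i) ν g n s := by
        intro n
        induction n with
        | zero => intro s; simp [polEval]
        | succ n ihn =>
          intro s
          rw [polEval]
          split_ifs with hn
          · push_cast
            linarith [hg (Fin.rev ⟨n, hn⟩) s (ν (Fin.rev ⟨n, hn⟩) s),
              le_nextMean (p := G.indP π i) (h := Fin.rev ⟨n, hn⟩) (s := s)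
                (b := ν (Fin.rev ⟨n, hn⟩) s) ihn]
          · have : (0 : ℝ) ≤ ((n + 1 : ℕ) : ℝ) * c := by positivity
            linarith
      rw [PMF.lexp_ofReal_of_fintype _ _ (fun s' => by linarith [hp n s'])]
      congr 1
      change nextMean (G.indP π i) h s (ν h s) (fun s' => _) = _
      rw [nextMean_add (f := fun _ => t + g h s (ν h s)), nextMean_const]
    · rw [rollout_of_le _ hn, PMF.lexp_pure, polEval, dif_neg hn]; simp

/-- What can be observed when player `i` follows `ν` and the others follow `π`. -/
theorem rollout_support (ν : PlayerPure H S (A i)) {n : ℕ} {s : Fin S}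
    {τ : List (Transition H S A)}
    (hτ : τ ∈ (G.rollout (Function.update π i ν) n s).support) :
    (∀ x ∈ τ, (x.h.rev : ℕ) < n ∧ x.a i = ν x.h x.s ∧ x.r i = G.indR π i x.h x.s (x.a i)) ∧
      (τ.map Transition.h).Nodup := by
  induction n generalizing s τ with
  | zero =>
    rw [rollout, PMF.mem_support_pure_iff] at hτ
    subst hτ; simp
  | succ n ih =>
    by_cases hn : n < H
    · rw [rollout_succ ν hn] at hτ
      simp only [PMF.mem_support_bind_iff, PMF.mem_support_map_iff] at hτ
      obtain ⟨s', _, σ, hσ, rfl⟩ := hτ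
      obtain ⟨h1, h2⟩ := ih hσ
      refine ⟨?_, ?_⟩
      · intro x hx
        rcases List.mem_cons.1 hx with rfl | hx
        · simp [indR]
        · exact ⟨(h1 x hx).1.trans (Nat.lt_succ_self n), (h1 x hx).2⟩
      · rw [List.map_cons, List.nodup_cons]
        -- The number of remaining steps is n at the head and smaller than n at all later
        -- transitions, so no step index repeats.
        refine ⟨?_, h2⟩
        intro hmem
        obtain ⟨x, hx, hxh⟩ := List.mem_map.1 hmem
        have := (h1 x hx).1
        rw [hxh] at this
        simp at this
    · rw [rollout_of_le _ hn, PMF.mem_support_pure_iff] at hτ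
      subst hτ; simp

/-! ### Values of the game in terms of the induced decision process -/

theorem toPolicy_update (ν : PlayerPure H S (A i)) :
    PurePolicy.toPolicy (Function.update π i ν) =
      Function.update π.toPolicy i (fun h s => PMF.pure (ν h s)) := by
  funext j
  by_cases hj : j = i
  · subst hj
    rw [Function.update_self]
    funext h s
    rw [PurePolicy.toPolicy, Function.update_self]
  · rw [Function.update_of_ne hj]
    funext h s
    rw [PurePolicy.toPolicy, PurePolicy.toPolicy, Function.update_of_ne hj]

theorem sum_prod_toReal (q : ∀ j, PMF (Fin (A j))) :
    ∑ a : (∀ j, Fin (A j)), ∏ j, (q j (a j)).toReal = 1 := by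
  have := Finset.prod_univ_sum (fun j => (Finset.univ : Finset (Fin (A j))))
    (fun j b => (q j b).toReal)
  rw [Fintype.piFinset_univ] at this
  rw [← this]
  simp [PMF.sum_toReal_of_fintype]

/-- A weighted mean over joint actions in which only player `i` randomizes. -/
theorem sum_prod_update_le (σ : Fin H → Fin S → PMF (Fin (A i))) (h : Fin H) (s : Fin S)
    (f : (∀ j, Fin (A j)) → ℝ) {c : ℝ}
    (hf : ∀ b, σ h s b ≠ 0 → f (Function.update (fun j => π j h s) i b) ≤ c) :
    ∑ a : (∀ j, Fin (A j)),
      (∏ j, (Function.update π.toPolicy i σ j h s (a j)).toReal) * f a ≤ c := by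
  have hc : c = ∑ a : (∀ j, Fin (A j)),
      (∏ j, (Function.update π.toPolicy i σ j h s (a j)).toReal) * c := by
    rw [← Finset.sum_mul, sum_prod_toReal (fun j => Function.update π.toPolicy i σ j h s), one_mul]
  rw [hc]
  refine Finset.sum_le_sum fun a _ => ?_
  by_cases h0 : ∏ j, (Function.update π.toPolicy i σ j h s (a j)).toReal = 0
  · rw [h0]; simp
  refine mul_le_mul_of_nonneg_left ?_ (Finset.prod_nonneg fun _ _ => ENNReal.toReal_nonneg)
  have hne := Finset.prod_ne_zero_iff.1 h0
  -- A joint action of nonzero weight agrees with the pure policies of all opponents.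
  have ha : a = Function.update (fun j => π j h s) i (a i) := by
    funext j
    by_cases hj : j = i
    · subst hj; simp
    · have := hne j (Finset.mem_univ j)
      rw [Function.update_of_ne hj] at this ⊢
      by_contra hcon
      exact this (by simp [PurePolicy.toPolicy, PMF.pure_apply_of_ne _ _ hcon])
  rw [ha]
  refine hf (a i) fun h0 => hne i (Finset.mem_univ i) ?_
  rw [Function.update_self, h0]; simp

theorem sum_prod_update_ge (σ : Fin H → Fin S → PMF (Fin (A i))) (h : Fin H) (s : Fin S)
    (f : (∀ j, Fin (A j)) → ℝ) {c : ℝ}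
    (hf : ∀ b, σ h s b ≠ 0 → c ≤ f (Function.update (fun j => π j h s) i b)) :
    c ≤ ∑ a : (∀ j, Fin (A j)),
      (∏ j, (Function.update π.toPolicy i σ j h s (a j)).toReal) * f a := by
  have := sum_prod_update_le σ h s (fun a => - f a) (c := -c) fun b hb => neg_le_neg (hf b hb)
  simp only [mul_neg, Finset.sum_neg_distrib] at this
  linarith

/-- An average over actions is at most the maximum. Hence near-optimality in the induced process
controls all randomized Markov deviations, as the Nash property requires. -/
theorem valueToGo_update_le [NeZero (A i)] (σ : Fin H → Fin S → PMF (Fin (A i))) (n : ℕ)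
    (s : Fin S) :
    G.valueToGo (Function.update π.toPolicy i σ) i n s ≤
      optVal (G.indP π i) (G.indR π i) n s := by
  induction n generalizing s with
  | zero => simp [valueToGo, optVal]
  | succ n ih =>
    by_cases hn : n < H
    · rw [valueToGo, dif_pos hn]
      refine sum_prod_update_le σ _ s _ fun b _ => le_trans ?_ (le_optVal_succ hn s b)
      exact add_le_add (le_refl (G.indR π i (Fin.rev ⟨n, hn⟩) s b))
        (nextMean_mono (p := G.indP π i) (h := Fin.rev ⟨n, hn⟩) (s := s) (b := b) ih)
    · rw [valueToGo, dif_neg hn, optVal_of_le (not_lt.1 hn)]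

theorem valueToGo_pure_update (ν : PlayerPure H S (A i)) (n : ℕ) (s : Fin S) :
    G.valueToGo (PurePolicy.toPolicy (Function.update π i ν)) i n s =
      polEval (G.indP π i) ν (G.indR π i) n s := by
  induction n generalizing s with
  | zero => simp [valueToGo, polEval]
  | succ n ih =>
    by_cases hn : n < H
    · rw [valueToGo, dif_pos hn, polEval, dif_pos hn, toPolicy_update]
      simp only [toPolicy_update] at ih
      simp only [ih]
      refine le_antisymm (sum_prod_update_le _ _ s _ fun b hb => le_of_eq ?_)
        (sum_prod_update_ge _ _ s _ fun b hb => le_of_eq ?_)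
      all_goals
        have : b = ν (Fin.rev ⟨n, hn⟩) s := by
          by_contra hcon
          exact hb (PMF.pure_apply_of_ne _ _ hcon)
        subst this
        rfl
    · rw [valueToGo, dif_neg hn, polEval, dif_neg hn]

end MarkovGame

/-! ### The data collected by UCBVI-UPLOW -/

namespace AgentData

variable {H S a : ℕ}

/-- The total of `f` over the observed successors of `(h, s, b)`. -/
noncomputable def succSum (D : AgentData H S a) (h : Fin H) (s : Fin S) (b : Fin a)
    (f : Fin S → ℝ) : ℝ :=
  ∑ s', (D.N h s b s' : ℝ) * f s'

variable {D : AgentData H S a} {h : Fin H} {s : Fin S} {b : Fin a} {f : Fin S → ℝ}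

theorem succSum_const (c : ℝ) : D.succSum h s b (fun _ => c) = D.visits h s b * c := by
  rw [succSum, ← Finset.sum_mul, visits]
  push_cast
  rfl

theorem succSum_eq_zero (h0 : D.visits h s b = 0) : D.succSum h s b f = 0 := by
  rw [visits, Finset.sum_eq_zero_iff] at h0
  refine Finset.sum_eq_zero fun s' hs' => ?_
  rw [h0 s' hs']; simp

theorem succSum_empty : (empty : AgentData H S a).succSum h s b f = 0 := by
  simp [succSum, empty]

theorem succSum_eq (h0 : D.visits h s b ≠ 0) :
    D.succSum h s b f = D.visits h s b * D.empMean h s b f := by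
  have : (D.visits h s b : ℝ) ≠ 0 := by exact_mod_cast h0
  rw [succSum, empMean, Finset.mul_sum]
  exact Finset.sum_congr rfl fun s' _ => by field_simp

theorem succSum_sub_const (c : ℝ) :
    D.succSum h s b (fun s' => f s' - c) = D.succSum h s b f - D.visits h s b * c := by
  rw [← succSum_const]
  simp only [succSum, mul_sub, Finset.sum_sub_distrib]

theorem succSum_const_mul (c : ℝ) :
    D.succSum h s b (fun s' => c * f s') = c * D.succSum h s b f := by
  simp only [succSum, Finset.mul_sum]
  exact Finset.sum_congr rfl fun _ _ => by ring

theorem succSum_single (s' : Fin S) :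
    D.succSum h s b (fun t => if t = s' then 1 else 0) = D.N h s b s' := by
  simp [succSum]

variable {m : ℕ} {A : Fin m → ℕ} {i : Fin m}

-- This writes the statistics of a cell as an additive functional of trajectories, to which the
-- supermartingale bounds for rollouts apply. Working with totals instead of empirical means avoids
-- division by zero visits.
open Classical in
theorem succSum_foldl_record (D : AgentData H S (A i)) (τ : List (Transition H S A)) (h : Fin H)
    (s : Fin S) (b : Fin (A i)) (f : Fin S → ℝ) :
    (τ.foldl (record i) D).succSum h s b f = D.succSum h s b f +
      (τ.map fun x => if x.h = h ∧ x.s = s ∧ x.a i = b then f x.s' else 0).sum := by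
  induction τ generalizing D with
  | nil => simp
  | cons x τ ih =>
    rw [List.foldl_cons, ih, List.map_cons, List.sum_cons, ← add_assoc]
    congr 1
    simp only [succSum, record]
    push_cast
    simp only [add_mul, Finset.sum_add_distrib]
    congr 1
    by_cases hx : x.h = h ∧ x.s = s ∧ x.a i = b
    · obtain ⟨rfl, rfl, rfl⟩ := hx
      simp
    · rw [if_neg hx]
      refine Finset.sum_eq_zero fun s' _ => ?_
      rw [if_neg fun hc => hx ⟨hc.1.symm, hc.2.1.symm, hc.2.2.1.symm⟩, zero_mul]

open Classical in
theorem visits_foldl_record (D : AgentData H S (A i)) (τ : List (Transition H S A)) (h : Fin H)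
    (s : Fin S) (b : Fin (A i)) :
    ((τ.foldl (record i) D).visits h s b : ℝ) = D.visits h s b +
      (τ.map fun x => if x.h = h ∧ x.s = s ∧ x.a i = b then (1 : ℝ) else 0).sum := by
  have := succSum_foldl_record D τ h s b fun _ => 1
  simpa only [succSum_const, mul_one] using this

/-- Every recorded reward is the true one. -/
def RewardsEq (D : AgentData H S a) (r : Fin H → Fin S → Fin a → ℝ) : Prop :=
  ∀ h s b, D.visits h s b ≠ 0 → D.R h s b = r h s b

theorem RewardsEq.foldl_record {D : AgentData H S (A i)} {r : Fin H → Fin S → Fin (A i) → ℝ}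
    (hD : D.RewardsEq r) {τ : List (Transition H S A)}
    (hτ : ∀ x ∈ τ, x.r i = r x.h x.s (x.a i)) : (τ.foldl (record i) D).RewardsEq r := by
  induction τ generalizing D with
  | nil => exact hD
  | cons x τ ih =>
    refine ih (fun h s b hv => ?_) fun y hy => hτ y (List.mem_cons_of_mem _ hy)
    by_cases hx : h = x.h ∧ s = x.s ∧ b = x.a i
    · obtain ⟨rfl, rfl, rfl⟩ := hx
      simp [record, hτ x List.mem_cons_self]
    · have hN : (record i D x).visits h s b = D.visits h s b := by
        simp only [visits, record]
        refine Finset.sum_congr rfl fun s' _ => ?_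
        rw [if_neg fun hc => hx ⟨hc.1, hc.2.1, hc.2.2.1⟩, add_zero]
      rw [hN] at hv
      simp only [record, if_neg hx]
      exact hD h s b hv

end AgentData

section Training

variable {H S m : ℕ} {A : Fin m → ℕ}

/-- The data of player `i` after the given episodes, most recent first. -/
noncomputable def trainData (i : Fin m) : List (List (Transition H S A)) → AgentData H S (A i)
  | [] => AgentData.empty
  | τ :: h => τ.foldl (AgentData.record i) (trainData i h)

/-! ### Concentration -/

section Concentration

open MDP MarkovGame

variable {G : MarkovGame H S A} {π : PurePolicy H S A} {i : Fin m}

theorem exp_le_quadratic {x : ℝ} (hx : |x| ≤ 1) : Real.exp x ≤ 1 + x + x ^ 2 := by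
  have := (abs_le.1 (Real.abs_exp_sub_one_sub_id_le hx)).2
  linarith

/-- Expand by exp x ≤ 1 + x + x² for |x| ≤ 1: the centred linear term averages to zero, and 1 + t²v
≤ exp(t²v). -/
theorem nextMean_exp_bernstein {a : ℕ} {p : Fin H → Fin S → Fin a → PMF (Fin S)} {h : Fin H}
    {s : Fin S} {b : Fin a} {f : Fin S → ℝ} {B t : ℝ} (hf : ∀ s', f s' ∈ Set.Icc 0 B)
    (ht : |t| * B ≤ 1) :
    nextMean p h s b (fun s' => Real.exp (t * (f s' - nextMean p h s b f) -
      t ^ 2 * nextVar p h s b f)) ≤ 1 := by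
  set μ := nextMean p h s b f with hμ
  set v := nextVar p h s b f
  have hμ0 : 0 ≤ μ := nextMean_nonneg fun s' => (hf s').1
  have hμB : μ ≤ B := nextMean_le fun s' => (hf s').2
  have h1 : ∀ s', Real.exp (t * (f s' - μ) - t ^ 2 * v) ≤
      Real.exp (-(t ^ 2 * v)) * (1 + t * (f s' - μ) + t ^ 2 * (f s' - μ) ^ 2) := fun s' => by
    rw [sub_eq_neg_add, Real.exp_add]
    refine mul_le_mul_of_nonneg_left ?_ (Real.exp_pos _).le
    rw [← mul_pow]
    refine exp_le_quadratic ?_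
    rw [abs_mul]
    refine le_trans (mul_le_mul_of_nonneg_left ?_ (abs_nonneg t)) ht
    rw [abs_le]
    constructor <;> linarith [(hf s').1, (hf s').2]
  refine (nextMean_mono h1).trans ?_
  rw [nextMean_const_mul, nextMean_add (f := fun s' => 1 + t * (f s' - μ)),
    nextMean_add (f := fun _ => 1), nextMean_const, nextMean_const_mul, nextMean_const_mul,
    nextMean_sub (g := fun _ => μ), nextMean_const, ← hμ]
  change _ * (1 + t * (μ - μ) + t ^ 2 * v) ≤ 1
  have h2 := Real.add_one_le_exp (t ^ 2 * v)
  calc _ ≤ Real.exp (-(t ^ 2 * v)) * Real.exp (t ^ 2 * v) := by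
        refine mul_le_mul_of_nonneg_left ?_ (Real.exp_pos _).le
        linarith
    _ = 1 := by rw [← Real.exp_add]; simp

theorem polEval_const_mul {a : ℕ} {p : Fin H → Fin S → Fin a → PMF (Fin S)}
    {ν : PlayerPure H S a} {g : Fin H → Fin S → Fin a → ℝ} (c : ℝ) (n : ℕ) (s : Fin S) :
    polEval p ν (fun h s b => c * g h s b) n s = c * polEval p ν g n s := by
  induction n generalizing s with
  | zero => simp [polEval]
  | succ n ih =>
    rw [polEval, polEval]
    split_ifs
    · have : polEval p ν (fun h s b => c * g h s b) n = fun s => c * polEval p ν g n s := funext ih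
      rw [this, nextMean_const_mul]
      ring
    · simp

/-- The total of `F` along a trajectory, seen by player `i`. -/
noncomputable def trajSum (i : Fin m) (F : Fin H → Fin S → Fin (A i) → ℝ)
    (τ : List (Transition H S A)) : ℝ :=
  (τ.map fun x => F x.h x.s (x.a i)).sum

theorem trajSum_const_mul (F : Fin H → Fin S → Fin (A i) → ℝ) (c : ℝ)
    (τ : List (Transition H S A)) :
    trajSum i (fun h s b => c * F h s b) τ = c * trajSum i F τ := by
  rw [trajSum, trajSum, List.sum_map_mul_left]

theorem length_le_of_mem_support_rollout {ν : PlayerPure H S (A i)} {n : ℕ} {s : Fin S}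
    {τ : List (Transition H S A)}
    (hτ : τ ∈ (G.rollout (Function.update π i ν) n s).support) : τ.length ≤ H := by
  simpa using (rollout_support ν hτ).2.length_le_card

theorem trajSum_mem {F : Fin H → Fin S → Fin (A i) → ℝ} {c : ℝ} (hc : 0 ≤ c)
    (hF : ∀ h s b, F h s b ∈ Set.Icc 0 c) {τ : List (Transition H S A)} (hτ : τ.length ≤ H) :
    trajSum i F τ ∈ Set.Icc 0 (H * c) := by
  constructor
  · exact List.sum_nonneg fun y hy => by
      obtain ⟨x, _, rfl⟩ := List.mem_map.1 hy
      exact (hF _ _ _).1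
  · refine (List.sum_le_card_nsmul _ c fun y hy => ?_).trans ?_
    · obtain ⟨x, _, rfl⟩ := List.mem_map.1 hy
      exact (hF _ _ _).2
    · rw [List.length_map, nsmul_eq_mul]
      gcongr

/-! ### Multiplicative comparison of observed and expected totals of an episode -/

section TrajSum

variable (ν : PlayerPure H S (A i)) {F : Fin H → Fin S → Fin (A i) → ℝ} {c : ℝ}

/-- With L = Hc and y = total/(2L) in [0, 1/2], exp(−y) ≤ 1 − y + y² ≤ 1 − y/2, and 1 − U/(4L) ≤
exp(−U/(4L)). Nonnegative totals thus satisfy expected ≤ 2·observed plus a logarithmic term, without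
any variance. -/
theorem lexp_exp_lower (hH : 0 < H) (hc : 0 < c) (hF : ∀ h s b, F h s b ∈ Set.Icc 0 c) :
    (G.rollout (Function.update π i ν) H G.init).lexp (fun τ => ENNReal.ofReal (Real.exp
      (polEval (G.indP π i) ν F H G.init / (4 * (H * c)) - trajSum i F τ / (2 * (H * c))))) ≤
      1 := by
  have hH' : (0 : ℝ) < H := by exact_mod_cast hH
  set L := (H : ℝ) * c with hL
  have hLpos : 0 < L := by positivity
  set U := polEval (G.indP π i) ν F H G.init
  have h1 : ∀ τ ∈ (G.rollout (Function.update π i ν) H G.init).support,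
      ENNReal.ofReal (Real.exp (U / (4 * L) - trajSum i F τ / (2 * L))) ≤
        ENNReal.ofReal (Real.exp (U / (4 * L))) *
          ENNReal.ofReal (1 + trajSum i (fun h s b => -(1 / (4 * L)) * F h s b) τ) := by
    intro τ hτ
    obtain ⟨h0, h1⟩ := trajSum_mem hc.le hF (length_le_of_mem_support_rollout hτ)
    rw [← hL] at h1
    rw [← ENNReal.ofReal_mul (Real.exp_pos _).le, sub_eq_add_neg, Real.exp_add, trajSum_const_mul]
    refine ENNReal.ofReal_le_ofReal (mul_le_mul_of_nonneg_left ?_ (Real.exp_pos _).le)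
    set y := trajSum i F τ / (2 * L) with hy
    have hy0 : 0 ≤ y := by positivity
    have hy1 : y ≤ 1 / 2 := by
      rw [hy, div_le_div_iff₀ (by positivity) (by norm_num)]; linarith
    have hy2 : -(1 / (4 * L)) * trajSum i F τ = -(y / 2) := by rw [hy]; field_simp; ring
    rw [hy2]
    have := exp_le_quadratic (x := -y) (by rw [abs_neg, abs_of_nonneg hy0]; linarith)
    nlinarith
  refine (PMF.lexp_mono _ h1).trans ?_
  rw [PMF.lexp_const_mul]
  have h2 := lexp_rollout_affine (G := G) (π := π) ν (fun h s b => -(1 / (4 * L)) * F h s b)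
    (c := c / (4 * L)) (by positivity) (fun h s b => by
      have := (hF h s b).2
      rw [neg_mul, one_div_mul_eq_div]
      exact neg_le_neg (by gcongr)) H G.init 1 (by
      rw [← mul_div_assoc, ← hL, div_le_one (by positivity)]; linarith)
  simp only [trajSum]
  rw [h2, polEval_const_mul, ← ENNReal.ofReal_mul (Real.exp_pos _).le, ENNReal.ofReal_le_one]
  have h3 := Real.add_one_le_exp (-(U / (4 * L)))
  calc _ ≤ Real.exp (U / (4 * L)) * Real.exp (-(U / (4 * L))) := by
        refine mul_le_mul_of_nonneg_left (le_trans (le_of_eq ?_) h3) (Real.exp_pos _).le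
        ring
    _ = 1 := by rw [← Real.exp_add]; simp

/-- The converse comparison, from exp y ≤ 1 + y + y² ≤ 1 + 2y with y = total/L in [0, 1]. -/
theorem lexp_exp_upper (hH : 0 < H) (hc : 0 < c) (hF : ∀ h s b, F h s b ∈ Set.Icc 0 c) :
    (G.rollout (Function.update π i ν) H G.init).lexp (fun τ => ENNReal.ofReal (Real.exp
      (trajSum i F τ / (H * c) - 2 * polEval (G.indP π i) ν F H G.init / (H * c)))) ≤ 1 := by
  have hH' : (0 : ℝ) < H := by exact_mod_cast hH
  set L := (H : ℝ) * c with hL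
  have hLpos : 0 < L := by positivity
  set U := polEval (G.indP π i) ν F H G.init
  have h1 : ∀ τ ∈ (G.rollout (Function.update π i ν) H G.init).support,
      ENNReal.ofReal (Real.exp (trajSum i F τ / L - 2 * U / L)) ≤
        ENNReal.ofReal (Real.exp (-(2 * U / L))) *
          ENNReal.ofReal (1 + trajSum i (fun h s b => (2 / L) * F h s b) τ) := by
    intro τ hτ
    obtain ⟨h0, h1⟩ := trajSum_mem hc.le hF (length_le_of_mem_support_rollout hτ)
    rw [← hL] at h1
    rw [← ENNReal.ofReal_mul (Real.exp_pos _).le, sub_eq_neg_add, Real.exp_add, trajSum_const_mul]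
    refine ENNReal.ofReal_le_ofReal (mul_le_mul_of_nonneg_left ?_ (Real.exp_pos _).le)
    set y := trajSum i F τ / L with hy
    have hy0 : 0 ≤ y := by positivity
    have hy1 : y ≤ 1 := by rw [hy, div_le_one hLpos]; linarith
    have hy2 : 2 / L * trajSum i F τ = 2 * y := by rw [hy]; ring
    rw [hy2]
    have := exp_le_quadratic (x := y) (by rw [abs_of_nonneg hy0]; linarith)
    nlinarith
  refine (PMF.lexp_mono _ h1).trans ?_
  rw [PMF.lexp_const_mul]
  have h2 := lexp_rollout_affine (G := G) (π := π) ν (fun h s b => (2 / L) * F h s b)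
    (c := 0) le_rfl (fun h s b => by
      have := (hF h s b).1
      rw [neg_zero]
      positivity) H G.init 1 (by simp)
  simp only [trajSum]
  rw [h2, polEval_const_mul, ← ENNReal.ofReal_mul (Real.exp_pos _).le, ENNReal.ofReal_le_one]
  have h3 := Real.add_one_le_exp (2 * U / L)
  calc _ ≤ Real.exp (-(2 * U / L)) * Real.exp (2 * U / L) := by
        refine mul_le_mul_of_nonneg_left (le_trans (le_of_eq ?_) h3) (Real.exp_pos _).le
        ring
    _ = 1 := by rw [← Real.exp_add]; simp

end TrajSum

/-- The total of `w` over the episodes of a history, each seen with the earlier ones. -/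
noncomputable def histSum {α : Type} (w : List α → α → ℝ) : List α → ℝ
  | [] => 0
  | τ :: h => histSum w h + w h τ

theorem ville_histSum {α : Type} {step : List α → PMF α} (w : List α → α → ℝ)
    (hw : ∀ h, (step h).lexp (fun τ => ENNReal.ofReal (Real.exp (w h τ))) ≤ 1) (K : ℕ) (ℓ : ℝ) :
    (adaptiveRun step K []).toOuterMeasure {h | ℓ ≤ histSum w h} ≤
      ENNReal.ofReal (Real.exp (-ℓ)) := by
  refine le_trans (MeasureTheory.measure_mono ?_) (ville_exp (histSum w) rfl (fun h => ?_) K ℓ)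
  · exact fun h hh => ⟨h, List.suffix_rfl, hh⟩
  · simpa [histSum] using hw h

theorem histSum_sub_mul {α : Type} (w w' : List α → α → ℝ) (c d : ℝ) (h : List α) :
    histSum (fun h τ => c * w h τ - d * w' h τ) h = c * histSum w h - d * histSum w' h := by
  induction h with
  | nil => simp [histSum]
  | cons τ h ih => rw [histSum, histSum, histSum, ih]; ring

/-! ### UCBVI-UPLOW as an adaptive run -/

variable [∀ i, NeZero (A i)]

/-- The episode that UCBVI-UPLOW plays after the given ones. -/
noncomputable def trainStep (G : MarkovGame H S A) (q : BonusParams) (π : PurePolicy H S A)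
    (i : Fin m) (h : List (List (Transition H S A))) : PMF (List (Transition H S A)) :=
  G.rollout (Function.update π i ((trainData i h).greedyPolicy q)) H G.init

open Classical in
/-- The smallest certified gap and its policy after the given episodes. -/
noncomputable def trainResult (s₁ : Fin S) (q : BonusParams) (π : PurePolicy H S A) (i : Fin m) :
    List (List (Transition H S A)) → ℝ × PlayerPure H S (A i)
  | [] => (H, π i)
  | _ :: h =>
    if (trainData i h).gap q s₁ < (trainResult s₁ q π i h).1 then
      ((trainData i h).gap q s₁, (trainData i h).greedyPolicy q)
    else trainResult s₁ q π i h

/-- Data, best gap and output are functions of the list of past episodes, so the program is the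
image of an adaptive run, and `ville` becomes available for it. -/
theorem ucbviLoop_eq (G : MarkovGame H S A) (s₁ : Fin S) (q : BonusParams) (π : PurePolicy H S A)
    (i : Fin m) (K : ℕ) (h : List (List (Transition H S A))) (n : ℕ) :
    ucbviLoop G.play s₁ q π i K (trainData i h) (trainResult s₁ q π i h).1
      (trainResult s₁ q π i h).2 n =
      (adaptiveRun (trainStep G q π i) K h).map
        (fun h' => ((trainResult s₁ q π i h').2, n + K)) := by
  induction K generalizing h n with
  | zero =>
    rw [adaptiveRun, PMF.pure_map]
    rfl
  | succ K ih =>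
    rw [adaptiveRun, PMF.map_bind, ucbviLoop]
    change ((G.rollout _ H G.init).map _).bind _ = _
    rw [PMF.bind_map]
    refine congrArg _ (funext fun τ => ?_)
    have := ih (τ :: h) (n + 1)
    rw [show n + 1 + K = n + (K + 1) by ring] at this
    rw [← this]
    simp only [Function.comp, trainResult]
    split_ifs <;> rfl

/-- Bernstein's inequality for the empirical successors of `(h, s, b)`, uniformly over time. -/
theorem measure_bernstein_le (q : BonusParams) (h : Fin H) (s : Fin S) (b : Fin (A i))
    {f : Fin S → ℝ} {B t : ℝ} (hf : ∀ s', f s' ∈ Set.Icc 0 B) (ht : |t| * B ≤ 1) (K : ℕ) (ℓ : ℝ) :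
    (adaptiveRun (trainStep G q π i) K []).toOuterMeasure
      {w | ∃ w', w' <:+ w ∧ ℓ ≤ t * ((trainData i w').succSum h s b f -
        (trainData i w').visits h s b * nextMean (G.indP π i) h s b f) -
          t ^ 2 * nextVar (G.indP π i) h s b f * (trainData i w').visits h s b} ≤
      ENNReal.ofReal (Real.exp (-ℓ)) := by
  classical
  set φ : Fin S → ℝ := fun s' => t * (f s' - nextMean (G.indP π i) h s b f) -
    t ^ 2 * nextVar (G.indP π i) h s b f with hφ
  -- The whole exponent is a successor total of one function φ, so each episode adds φ at its visits
  -- to this cell and nothing elsewhere.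
  have hY : ∀ w', t * ((trainData i w').succSum h s b f -
      (trainData i w').visits h s b * nextMean (G.indP π i) h s b f) -
        t ^ 2 * nextVar (G.indP π i) h s b f * (trainData i w').visits h s b =
      (trainData i w').succSum h s b φ := fun w' => by
    rw [hφ, AgentData.succSum_sub_const, AgentData.succSum_const_mul, AgentData.succSum_sub_const]
    ring
  simp only [hY]
  refine ville_exp (fun w' => (trainData i w').succSum h s b φ) AgentData.succSum_empty
    (fun w => ?_) K ℓ
  refine le_trans (PMF.lexp_mono _ fun τ _ => le_of_eq ?_)
    (lexp_rollout_exp_le_one (G := G) (π := π) (i := i) ((trainData i w).greedyPolicy q)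
      (fun h' s₀ b' s' => if h' = h ∧ s₀ = s ∧ b' = b then φ s' else 0) (fun h' s₀ b' => ?_)
      H G.init)
  · rw [trainData, AgentData.succSum_foldl_record]
    congr 2
    ring
  · by_cases hc : h' = h ∧ s₀ = s ∧ b' = b
    · obtain ⟨rfl, rfl, rfl⟩ := hc
      simpa using nextMean_exp_bernstein (p := G.indP π i) (h := h') (s := s₀) (b := b') hf ht
    · simp only [if_neg hc, Real.exp_zero, nextMean_const, le_refl]

end Concentration

end Training

/-! ### Optimism and the width of the confidence intervals -/

namespace AgentData

open MDP

variable {H S a : ℕ} {D : AgentData H S a} {h : Fin H} {s : Fin S} {b : Fin a}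
  {f g : Fin S → ℝ} {c : ℝ}

theorem empMean_mono (hfg : ∀ s', f s' ≤ g s') : D.empMean h s b f ≤ D.empMean h s b g :=
  Finset.sum_le_sum fun s' _ => mul_le_mul_of_nonneg_left (hfg s') (by positivity)

theorem empMean_nonneg (hf : ∀ s', 0 ≤ f s') : 0 ≤ D.empMean h s b f :=
  Finset.sum_nonneg fun s' _ => mul_nonneg (by positivity) (hf s')

theorem empMean_add :
    D.empMean h s b (fun s' => f s' + g s') = D.empMean h s b f + D.empMean h s b g := by
  simp only [empMean, mul_add, Finset.sum_add_distrib]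

theorem empMean_sub :
    D.empMean h s b (fun s' => f s' - g s') = D.empMean h s b f - D.empMean h s b g := by
  simp only [empMean, mul_sub, Finset.sum_sub_distrib]

theorem empMean_const_mul :
    D.empMean h s b (fun s' => c * f s') = c * D.empMean h s b f := by
  simp only [empMean, Finset.mul_sum]
  exact Finset.sum_congr rfl fun _ _ => by ring

theorem empMean_const (hv : D.visits h s b ≠ 0) : D.empMean h s b (fun _ => c) = c := by
  have hv' : (D.visits h s b : ℝ) ≠ 0 := by exact_mod_cast hv
  have := succSum_const (D := D) (h := h) (s := s) (b := b) c
  rw [succSum_eq hv] at this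
  exact mul_left_cancel₀ hv' this

theorem empVar_nonneg : 0 ≤ D.empVar h s b f := empMean_nonneg fun _ => sq_nonneg _

theorem empVar_le_sub_sq (hv : D.visits h s b ≠ 0) (c : ℝ) :
    D.empVar h s b f ≤ D.empMean h s b (fun s' => (f s' - c) ^ 2) := by
  have key : ∀ c : ℝ, D.empMean h s b (fun s' => (f s' - c) ^ 2) =
      D.empMean h s b (fun s' => f s' ^ 2) - 2 * c * D.empMean h s b f + c ^ 2 := fun c => by
    have : (fun s' => (f s' - c) ^ 2) = fun s' => (f s' ^ 2 - (2 * c) * f s') + c ^ 2 := by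
      funext s'; ring
    rw [this, empMean_add (g := fun _ => c ^ 2), empMean_sub (g := fun s' => (2 * c) * f s'),
      empMean_const_mul, empMean_const hv]
  rw [empVar, key, key]
  nlinarith [sq_nonneg (D.empMean h s b f - c)]

theorem empVar_le_two_mul (hv : D.visits h s b ≠ 0) :
    D.empVar h s b f ≤
      2 * D.empVar h s b g + 2 * D.empMean h s b (fun s' => (f s' - g s') ^ 2) := by
  refine (empVar_le_sub_sq hv (D.empMean h s b g)).trans ?_
  rw [empVar, ← empMean_const_mul, ← empMean_const_mul, ← empMean_add]
  refine empMean_mono fun s' => ?_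
  nlinarith [sq_nonneg ((f s' - g s') - (g s' - D.empMean h s b g))]

/-- The empirical model is close to the true one, with `ℓ` the logarithm of the inverse failure
probability. -/
structure Confident [NeZero a] (D : AgentData H S a) (p : Fin H → Fin S → Fin a → PMF (Fin S))
    (r : Fin H → Fin S → Fin a → ℝ) (ℓ : ℝ) : Prop where
  rewards : D.RewardsEq r
  bern : ∀ h s b, |D.succSum h s b (optVal p r h.rev) -
    D.visits h s b * nextMean p h s b (optVal p r h.rev)| ≤
      2 * Real.sqrt (ℓ * nextVar p h s b (optVal p r h.rev) * D.visits h s b) + H * ℓ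
  mult : ∀ h s b s', |(D.N h s b s' : ℝ) - D.visits h s b * (p h s b s').toReal| ≤
    D.visits h s b * (p h s b s').toReal / (2 * H) + 2 * H * ℓ

namespace Confident

variable [NeZero a] {p : Fin H → Fin S → Fin a → PMF (Fin S)} {r : Fin H → Fin S → Fin a → ℝ}
  {ℓ : ℝ} {B : ℝ}

section Cell

variable (hD : D.Confident p r ℓ) (hH : 0 < H) (hℓ : 0 ≤ ℓ) (hv : D.visits h s b ≠ 0)
include hD hH hv

/-- The relative error 1/(2H) is small enough to be compounded over H steps; the absolute error is
of lower order in the number of visits. -/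
theorem emp_le (s' : Fin S) : (D.N h s b s' : ℝ) / D.visits h s b ≤
    (1 + 1 / (2 * H)) * (p h s b s').toReal + 2 * H * (ℓ / D.visits h s b) := by
  have hn : (0 : ℝ) < D.visits h s b := by exact_mod_cast Nat.pos_of_ne_zero hv
  have h1 := (abs_le.1 (hD.mult h s b s')).2
  rw [div_le_iff₀ hn]
  have : (1 + 1 / (2 * H)) * (p h s b s').toReal * D.visits h s b +
      2 * H * (ℓ / D.visits h s b) * D.visits h s b =
      D.visits h s b * (p h s b s').toReal +
        (D.visits h s b * (p h s b s').toReal / (2 * H) + 2 * H * ℓ) := by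
    field_simp
    ring
  linarith

theorem le_emp (s' : Fin S) : (p h s b s').toReal ≤
    2 * ((D.N h s b s' : ℝ) / D.visits h s b) + 4 * H * (ℓ / D.visits h s b) := by
  have hn : (0 : ℝ) < D.visits h s b := by exact_mod_cast Nat.pos_of_ne_zero hv
  have hH1 : (1 : ℝ) ≤ H := by exact_mod_cast hH
  have h1 := (abs_le.1 (hD.mult h s b s')).1
  have h2 : D.visits h s b * (p h s b s').toReal / (2 * H) ≤
      D.visits h s b * (p h s b s').toReal / 2 := by
    gcongr
    linarith
  have h3 : 2 * ((D.N h s b s' : ℝ) / D.visits h s b) + 4 * H * (ℓ / D.visits h s b) =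
      (2 * D.N h s b s' + 4 * H * ℓ) / D.visits h s b := by ring
  rw [h3, le_div_iff₀ hn]
  linarith

-- The true probability in the error bound is replaced by the empirical one, so that the error is
-- expressed through a quantity the algorithm sees.
include hℓ in
theorem abs_emp_sub_le (s' : Fin S) :
    |(D.N h s b s' : ℝ) / D.visits h s b - (p h s b s').toReal| ≤
      (D.N h s b s' : ℝ) / D.visits h s b / H + 4 * H * (ℓ / D.visits h s b) := by
  have hn : (0 : ℝ) < D.visits h s b := by exact_mod_cast Nat.pos_of_ne_zero hv
  have hH1 : (1 : ℝ) ≤ H := by exact_mod_cast hH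
  have h1 := hD.mult h s b s'
  have h2 := hD.le_emp hH hv s'
  have hk : 0 ≤ ℓ / D.visits h s b := div_nonneg hℓ hn.le
  have h3 : |(D.N h s b s' : ℝ) / D.visits h s b - (p h s b s').toReal| =
      |(D.N h s b s' : ℝ) - D.visits h s b * (p h s b s').toReal| / D.visits h s b := by
    rw [← abs_of_pos hn, ← abs_div, abs_of_pos hn]
    congr 1
    field_simp
  rw [h3]
  have h4 : |(D.N h s b s' : ℝ) - D.visits h s b * (p h s b s').toReal| / D.visits h s b ≤
      (p h s b s').toReal / (2 * H) + 2 * H * (ℓ / D.visits h s b) := by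
    rw [div_le_iff₀ hn]
    refine h1.trans (le_of_eq ?_)
    field_simp
  refine h4.trans ?_
  have h5 : (p h s b s').toReal / (2 * H) ≤
      (2 * ((D.N h s b s' : ℝ) / D.visits h s b) + 4 * H * (ℓ / D.visits h s b)) / (2 * H) := by
    gcongr
  have h6 : (2 * ((D.N h s b s' : ℝ) / D.visits h s b) + 4 * H * (ℓ / D.visits h s b)) / (2 * H) =
      (D.N h s b s' : ℝ) / D.visits h s b / H + 2 * (ℓ / D.visits h s b) := by
    field_simp
    ring
  nlinarith

include hℓ

/-- Unlike the Bernstein bound, this holds for every function at once, including data-dependent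
ones. The price is a factor S in the lower-order term, from summing the frequency bounds over
successors. -/
theorem empMean_le (hf : ∀ s', f s' ∈ Set.Icc 0 B) : D.empMean h s b f ≤
    (1 + 1 / (2 * H)) * nextMean p h s b f + 2 * H * S * B * (ℓ / D.visits h s b) := by
  have hn : (0 : ℝ) < D.visits h s b := by exact_mod_cast Nat.pos_of_ne_zero hv
  have hk : 0 ≤ ℓ / D.visits h s b := div_nonneg hℓ hn.le
  calc _ ≤ ∑ s', ((1 + 1 / (2 * H)) * ((p h s b s').toReal * f s') +
        2 * H * (ℓ / D.visits h s b) * B) := by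
        refine Finset.sum_le_sum fun s' _ => ?_
        refine (mul_le_mul_of_nonneg_right (hD.emp_le hH hv s') (hf s').1).trans ?_
        rw [add_mul, mul_assoc]
        have := (hf s').2
        gcongr
    _ = _ := by
        rw [Finset.sum_add_distrib, ← Finset.mul_sum, Finset.sum_const, Finset.card_univ,
          Fintype.card_fin, nsmul_eq_mul, nextMean]
        ring

theorem nextMean_le (hf : ∀ s', f s' ∈ Set.Icc 0 B) : nextMean p h s b f ≤
    2 * D.empMean h s b f + 4 * H * S * B * (ℓ / D.visits h s b) := by
  have hn : (0 : ℝ) < D.visits h s b := by exact_mod_cast Nat.pos_of_ne_zero hv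
  have hk : 0 ≤ ℓ / D.visits h s b := div_nonneg hℓ hn.le
  calc _ ≤ ∑ s', (2 * ((D.N h s b s' : ℝ) / D.visits h s b * f s') +
        4 * H * (ℓ / D.visits h s b) * B) := by
        refine Finset.sum_le_sum fun s' _ => ?_
        refine (mul_le_mul_of_nonneg_right (hD.le_emp hH hv s') (hf s').1).trans ?_
        rw [add_mul, mul_assoc]
        have := (hf s').2
        gcongr
    _ = _ := by
        rw [Finset.sum_add_distrib, ← Finset.mul_sum, Finset.sum_const, Finset.card_univ,
          Fintype.card_fin, nsmul_eq_mul, empMean]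
        ring

theorem abs_empMean_sub_le (hf : ∀ s', f s' ∈ Set.Icc 0 B) :
    |D.empMean h s b f - nextMean p h s b f| ≤
      D.empMean h s b f / H + 4 * H * S * B * (ℓ / D.visits h s b) := by
  have hn : (0 : ℝ) < D.visits h s b := by exact_mod_cast Nat.pos_of_ne_zero hv
  have hk : 0 ≤ ℓ / D.visits h s b := div_nonneg hℓ hn.le
  rw [empMean, nextMean, ← Finset.sum_sub_distrib]
  refine (Finset.abs_sum_le_sum_abs _ _).trans ?_
  calc _ ≤ ∑ s', ((D.N h s b s' : ℝ) / D.visits h s b * f s' / H +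
        4 * H * (ℓ / D.visits h s b) * B) := by
        refine Finset.sum_le_sum fun s' _ => ?_
        rw [← sub_mul, abs_mul, abs_of_nonneg (hf s').1]
        refine (mul_le_mul_of_nonneg_right (hD.abs_emp_sub_le hH hℓ hv s') (hf s').1).trans ?_
        rw [add_mul, div_mul_eq_mul_div]
        have := (hf s').2
        gcongr
    _ = _ := by
        rw [Finset.sum_add_distrib, ← Finset.sum_div, Finset.sum_const, Finset.card_univ,
          Fintype.card_fin, nsmul_eq_mul]
        ring

variable (hr : ∀ h s b, r h s b ∈ Set.Icc (0 : ℝ) 1)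
include hr

omit hD hH hℓ hv in
theorem optVal_rev_mem (s' : Fin S) : optVal p r h.rev s' ∈ Set.Icc (0 : ℝ) H :=
  ⟨optVal_nonneg hr _ _, optVal_le_horizon hr h.rev.isLt.le _⟩

/-- The variance is at most the second moment about any point. Taking the empirical mean as this
point leaves a function with values in [0, H²], to which the change of measure applies. -/
theorem nextVar_le : nextVar p h s b (optVal p r h.rev) ≤
    2 * D.empVar h s b (optVal p r h.rev) + 4 * H ^ 3 * S * (ℓ / D.visits h s b) := by
  refine (nextVar_le_sub_sq (D.empMean h s b (optVal p r h.rev))).trans ?_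
  refine (hD.nextMean_le hH hℓ hv (B := (H : ℝ) ^ 2) fun s' => ⟨sq_nonneg _, ?_⟩).trans
    (le_of_eq ?_)
  · have h1 := optVal_rev_mem (p := p) (h := h) hr s'
    have h2 : 0 ≤ D.empMean h s b (optVal p r h.rev) :=
      empMean_nonneg fun s' => (optVal_rev_mem (p := p) (h := h) hr s').1
    have h3 : D.empMean h s b (optVal p r h.rev) ≤ H :=
      (empMean_mono fun s' => (optVal_rev_mem (p := p) (h := h) hr s').2).trans_eq
        (empMean_const hv)
    refine sq_le_sq' ?_ ?_ <;> linarith [h1.1, h1.2]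
  · rw [empVar]; ring

theorem empVar_le : D.empVar h s b (optVal p r h.rev) ≤
    2 * nextVar p h s b (optVal p r h.rev) + 2 * H ^ 3 * S * (ℓ / D.visits h s b) := by
  have hH1 : (1 : ℝ) ≤ H := by exact_mod_cast hH
  refine (empVar_le_sub_sq hv (nextMean p h s b (optVal p r h.rev))).trans ?_
  refine (hD.empMean_le hH hℓ hv (B := (H : ℝ) ^ 2) fun s' => ⟨sq_nonneg _, ?_⟩).trans ?_
  · have h1 := optVal_rev_mem (p := p) (h := h) hr s'
    have h2 : 0 ≤ nextMean p h s b (optVal p r h.rev) :=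
      nextMean_nonneg fun s' => (optVal_rev_mem (p := p) (h := h) hr s').1
    have h3 : nextMean p h s b (optVal p r h.rev) ≤ H :=
      MDP.nextMean_le fun s' => (optVal_rev_mem (p := p) (h := h) hr s').2
    refine sq_le_sq' ?_ ?_ <;> linarith [h1.1, h1.2]
  · have h1 : 1 / (2 * (H : ℝ)) ≤ 1 := by
      rw [div_le_one (by positivity)]; linarith
    have h2 : 0 ≤ nextVar p h s b (optVal p r h.rev) := nextVar_nonneg
    change _ * nextVar p h s b (optVal p r h.rev) + _ ≤ _
    have h3 := mul_le_mul_of_nonneg_right h1 h2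
    linarith

omit hH hℓ hr in
theorem abs_empMean_optVal_sub_le :
    |D.empMean h s b (optVal p r h.rev) - nextMean p h s b (optVal p r h.rev)| ≤
      2 * Real.sqrt (nextVar p h s b (optVal p r h.rev) * (ℓ / D.visits h s b)) +
        H * (ℓ / D.visits h s b) := by
  have hn : (0 : ℝ) < D.visits h s b := by exact_mod_cast Nat.pos_of_ne_zero hv
  have h1 := hD.bern h s b
  rw [succSum_eq hv, ← mul_sub, abs_mul, abs_of_pos hn] at h1
  have h2 : Real.sqrt (ℓ * nextVar p h s b (optVal p r h.rev) * D.visits h s b) =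
      D.visits h s b *
        Real.sqrt (nextVar p h s b (optVal p r h.rev) * (ℓ / D.visits h s b)) := by
    rw [← Real.sqrt_sq hn.le, ← Real.sqrt_mul (by positivity), Real.sqrt_sq hn.le]
    congr 1
    field_simp
  rw [h2] at h1
  refine le_of_mul_le_mul_left (h1.trans (le_of_eq ?_)) hn
  field_simp

section Bracket

variable {up low : Fin S → ℝ} (hup : ∀ s', optVal p r h.rev s' ≤ up s' ∧ up s' ≤ H)
  (hlow : ∀ s', 0 ≤ low s' ∧ low s' ≤ optVal p r h.rev s')
include hup hlow

-- V* lies between the two bounds, so its distance to their midpoint is at most half the width, and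
-- one factor of the squared width is at most H.
omit hD hH hℓ hv hr in
theorem empMean_sub_avg_sq_le :
    2 * D.empMean h s b (fun s' => (optVal p r h.rev s' - (up s' + low s') / 2) ^ 2) ≤
      H / 2 * D.empMean h s b (fun s' => up s' - low s') := by
  rw [← empMean_const_mul, ← empMean_const_mul]
  refine empMean_mono fun s' => ?_
  obtain ⟨h1, h2⟩ := hup s'
  obtain ⟨h3, h4⟩ := hlow s'
  have h5 : (optVal p r h.rev s' - (up s' + low s') / 2) ^ 2 ≤ ((up s' - low s') / 2) ^ 2 := by
    refine sq_le_sq' ?_ ?_ <;> linarith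
  nlinarith

/-- The error of the empirical mean of the optimal value is covered by the bonus. -/
theorem abs_empMean_optVal_sub_le_bonus :
    |D.empMean h s b (optVal p r h.rev) - nextMean p h s b (optVal p r h.rev)| ≤
      4 * Real.sqrt (D.empVar h s b (fun s' => (up s' + low s') / 2) * (ℓ / D.visits h s b)) +
        6 * (H ^ 2 * S * (ℓ / D.visits h s b)) +
          D.empMean h s b (fun s' => up s' - low s') / H := by
  have hn : (0 : ℝ) < D.visits h s b := by exact_mod_cast Nat.pos_of_ne_zero hv
  have hk : 0 ≤ ℓ / D.visits h s b := div_nonneg hℓ hn.le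
  have hH1 : (1 : ℝ) ≤ H := by exact_mod_cast hH
  have hS1 : (1 : ℝ) ≤ S := by exact_mod_cast (Fin.pos s)
  refine (hD.abs_empMean_optVal_sub_le hv).trans ?_
  have h1 := hD.nextVar_le hH hℓ hv hr
  have h2 := empVar_le_two_mul (f := optVal p r h.rev) (g := fun s' => (up s' + low s') / 2) hv
  have h3 := empMean_sub_avg_sq_le (D := D) (s := s) (b := b) hup hlow
  have hE : 0 ≤ D.empMean h s b (fun s' => up s' - low s') := empMean_nonneg fun s' => by
    linarith [(hup s').1, (hlow s').2]
  have hVa : 0 ≤ D.empVar h s b (fun s' => (up s' + low s') / 2) := empVar_nonneg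
  set E := D.empMean h s b (fun s' => up s' - low s')
  set Va := D.empVar h s b (fun s' => (up s' + low s') / 2)
  set k := ℓ / (D.visits h s b : ℝ)
  set V := nextVar p h s b (optVal p r h.rev)
  have h4 : V ≤ 4 * Va + H * E + 4 * H ^ 3 * S * k := by linarith
  -- The root of a sum is split into roots; HEk = (E/H)(H²k) and the arithmetic-geometric mean give
  -- the term E/H, which the correction γ of the algorithm is there to cover.
  have h5 : Real.sqrt (V * k) ≤ 2 * Real.sqrt (Va * k) + (E / H + H ^ 2 * k) / 2 +
      2 * (H ^ 2 * S * k) := by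
    refine Real.sqrt_le_iff.2 ⟨by positivity, ?_⟩
    have hx := Real.sqrt_nonneg (Va * k)
    have hx2 := Real.sq_sqrt (mul_nonneg hVa hk)
    set x := Real.sqrt (Va * k)
    have hy : 0 ≤ (E / H + H ^ 2 * k) / 2 := by positivity
    have hy2 : H * E * k ≤ ((E / H + H ^ 2 * k) / 2) ^ 2 := by
      have : H * E * k = (E / H) * (H ^ 2 * k) := by field_simp
      rw [this]
      nlinarith [sq_nonneg (E / H - H ^ 2 * k)]
    have hz : 0 ≤ 2 * (H ^ 2 * S * k) := by positivity
    have hz2 : 4 * H ^ 3 * S * k * k ≤ (2 * (H ^ 2 * S * k)) ^ 2 := by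
      have : (1 : ℝ) ≤ H * S := by nlinarith
      have h0 : 0 ≤ 4 * (H : ℝ) ^ 3 * S * k * k := by positivity
      nlinarith [mul_le_mul_of_nonneg_left this h0]
    have := mul_le_mul_of_nonneg_right h4 hk
    nlinarith [mul_nonneg hx hy, mul_nonneg hx hz, mul_nonneg hy hz]
  have h6 : (H : ℝ) * k ≤ H ^ 2 * S * k := by
    have : (H : ℝ) ≤ H ^ 2 * S := by nlinarith [mul_le_mul hH1 hS1 (by norm_num) (by positivity)]
    gcongr
  have h7 : (H : ℝ) ^ 2 * k ≤ H ^ 2 * S * k := by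
    have : (H : ℝ) ^ 2 ≤ H ^ 2 * S := by nlinarith [sq_nonneg (H : ℝ)]
    gcongr
  linarith

end Bracket

end Cell

end Confident

end AgentData

/-- The weights in the arithmetic-geometric mean inequality are chosen so that the width E appears
with coefficient only 1/H; a larger coefficient would blow up in the recursion over H steps. The
term with H²k absorbs the large constant. -/
theorem sqrt_mul_le_of_le {H S L V k E U : ℝ} (hH1 : 1 ≤ H) (hS1 : 1 ≤ S) (hL : 1 ≤ L)
    (hV : 0 ≤ V) (hk : 0 ≤ k) (hE : 0 ≤ E)
    (h10 : U ≤ 4 * V + 4 * H ^ 3 * S * (L * k) + H / 2 * E) :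
    20 * L * Real.sqrt (U * k) ≤ 40 * L * Real.sqrt (V * k) + 40 * L ^ 2 * (H ^ 2 * S * k) +
      (E / H + 50 * L ^ 2 * (H ^ 2 * k)) := by
  have hL0 : 0 < L := by linarith
  have : Real.sqrt (U * k) ≤ 2 * Real.sqrt (V * k) + 2 * L * (H ^ 2 * S * k) +
      (E / H + 50 * L ^ 2 * (H ^ 2 * k)) / (20 * L) := by
    refine Real.sqrt_le_iff.2 ⟨by positivity, ?_⟩
    have hx := Real.sqrt_nonneg (V * k)
    have hx2 := Real.sq_sqrt (mul_nonneg hV hk)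
    set x := Real.sqrt (V * k)
    have hy : 0 ≤ 2 * L * (H ^ 2 * S * k) := by positivity
    have hy2 : 4 * H ^ 3 * S * (L * k) * k ≤ (2 * L * (H ^ 2 * S * k)) ^ 2 := by
      have h1 : (1 : ℝ) ≤ L * (H * S) :=
        one_le_mul_of_one_le_of_one_le hL (one_le_mul_of_one_le_of_one_le hH1 hS1)
      have h0 : 0 ≤ 4 * H ^ 3 * S * (L * k) * k := by positivity
      nlinarith [mul_le_mul_of_nonneg_left h1 h0]
    have hz : 0 ≤ (E / H + 50 * L ^ 2 * (H ^ 2 * k)) / (20 * L) := by positivity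
    have hz2 : H / 2 * E * k ≤ ((E / H + 50 * L ^ 2 * (H ^ 2 * k)) / (20 * L)) ^ 2 := by
      rw [div_pow, le_div_iff₀ (by positivity)]
      have : H / 2 * E * k * (20 * L) ^ 2 = 4 * ((E / H) * (50 * L ^ 2 * (H ^ 2 * k))) := by
        field_simp
        ring
      rw [this]
      nlinarith [sq_nonneg (E / H - 50 * L ^ 2 * (H ^ 2 * k))]
    set y := 2 * L * (H ^ 2 * S * k)
    set z := (E / H + 50 * L ^ 2 * (H ^ 2 * k)) / (20 * L)
    have := mul_le_mul_of_nonneg_right h10 hk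
    nlinarith [mul_nonneg hx hy, mul_nonneg hx hz, mul_nonneg hy hz]
  calc _ ≤ 20 * L * (2 * Real.sqrt (V * k) + 2 * L * (H ^ 2 * S * k) +
        (E / H + 50 * L ^ 2 * (H ^ 2 * k)) / (20 * L)) := by gcongr
    _ = _ := by field_simp; ring

namespace AgentData

open MDP

variable {H S a : ℕ} [NeZero a] {D : AgentData H S a}
  {p : Fin H → Fin S → Fin a → PMF (Fin S)} {r : Fin H → Fin S → Fin a → ℝ} {q : BonusParams}

theorem upLow_succ {n : ℕ} (hn : n < H) (s : Fin S) :
    (D.upLow q (n + 1)).1 s = D.qUp q (Fin.rev ⟨n, hn⟩) (D.upLow q n).1 (D.upLow q n).2 s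
        (D.greedyPolicy q (Fin.rev ⟨n, hn⟩) s) ∧
      (D.upLow q (n + 1)).2 s = D.qLow q (Fin.rev ⟨n, hn⟩) (D.upLow q n).1 (D.upLow q n).2 s
        (D.greedyPolicy q (Fin.rev ⟨n, hn⟩) s) := by
  rw [upLow, dif_pos hn]
  simp [greedyPolicy]

theorem qUp_le_upLow_succ {n : ℕ} (hn : n < H) (s : Fin S) (b : Fin a) :
    D.qUp q (Fin.rev ⟨n, hn⟩) (D.upLow q n).1 (D.upLow q n).2 s b ≤ (D.upLow q (n + 1)).1 s := by
  rw [upLow, dif_pos hn]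
  exact argmaxFin_spec (fun b => D.qUp q (Fin.rev ⟨n, hn⟩) (D.upLow q n).1 (D.upLow q n).2 s b) b

/-- The part of the confidence width that is caused by the bonus at `(h, s, b)` after `n` visits,
truncated at the trivial bound. -/
noncomputable def widthBonus (p : Fin H → Fin S → Fin a → PMF (Fin S)) (r : Fin H → Fin S → Fin a → ℝ)
    (L ι : ℝ) (h : Fin H) (s : Fin S) (b : Fin a) (n : ℕ) : ℝ :=
  if n = 0 then H
  else min (40 * L * Real.sqrt (nextVar p h s b (optVal p r h.rev) * (ι / n)) +
    122 * L ^ 2 * (H ^ 2 * S * (ι / n))) H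

theorem widthBonus_mem {L ι : ℝ} (hL : 0 ≤ L) (hι : 0 ≤ ι) (h : Fin H) (s : Fin S) (b : Fin a)
    (n : ℕ) : widthBonus p r L ι h s b n ∈ Set.Icc (0 : ℝ) H := by
  rw [widthBonus]
  split_ifs
  · exact ⟨by positivity, le_rfl⟩
  · exact ⟨le_min (by positivity) (by positivity), min_le_right _ _⟩

namespace Confident

variable {L ι : ℝ} (hD : D.Confident p r (L * ι)) (hr : ∀ h s b, r h s b ∈ Set.Icc (0 : ℝ) 1)
  (hL : 1 ≤ L) (hι : 0 ≤ ι) (hq : q = ⟨10 * L, 2, ι⟩)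
include hD hr hL hι hq

/-- The upper bound only needs the empirical error at the fixed function V*. The lower bound
concerns the value of the greedy policy, which depends on the data, so the error at V* − V^π is
added, bounded by relative concentration through the width. This doubles the E/H term (`corr` = 2)
and turns 6 into 6 + 4 in the bonus constant 10. -/
theorem sandwich_step {n : ℕ} (hn : n < H)
    (ih : ∀ s, 0 ≤ (D.upLow q n).2 s ∧
      (D.upLow q n).2 s ≤ polEval p (D.greedyPolicy q) r n s ∧
      optVal p r n s ≤ (D.upLow q n).1 s ∧ (D.upLow q n).1 s ≤ H) (s : Fin S) :
    0 ≤ (D.upLow q (n + 1)).2 s ∧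
      (D.upLow q (n + 1)).2 s ≤ polEval p (D.greedyPolicy q) r (n + 1) s ∧
      optVal p r (n + 1) s ≤ (D.upLow q (n + 1)).1 s ∧ (D.upLow q (n + 1)).1 s ≤ H := by
  have hH : 0 < H := by omega
  have hH1 : (1 : ℝ) ≤ H := by exact_mod_cast hH
  have hS1 : (1 : ℝ) ≤ S := by exact_mod_cast (Fin.pos s)
  set h := Fin.rev ⟨n, hn⟩ with hh
  have hrev : ((h.rev : Fin H) : ℕ) = n := by simp [hh]
  set up := (D.upLow q n).1
  set low := (D.upLow q n).2
  have hℓ : 0 ≤ L * ι := by positivity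
  have hup : ∀ s', optVal p r h.rev s' ≤ up s' ∧ up s' ≤ H := fun s' => by
    rw [hrev]; exact (ih s').2.2
  have hlow : ∀ s', 0 ≤ low s' ∧ low s' ≤ optVal p r h.rev s' := fun s' => by
    rw [hrev]; exact ⟨(ih s').1, (ih s').2.1.trans (polEval_le_optVal _ _ _)⟩
  -- the bonus dominates the estimation errors at visited pairs
  have key : ∀ b, D.visits h s b ≠ 0 →
      |D.empMean h s b (optVal p r h.rev) - nextMean p h s b (optVal p r h.rev)| +
        (D.empMean h s b (fun s' => up s' - low s') / H +
          4 * (H ^ 2 * S * (L * ι / D.visits h s b))) ≤ D.totalBonus q h up low s b := by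
    intro b hv
    have hn : (0 : ℝ) < D.visits h s b := by exact_mod_cast Nat.pos_of_ne_zero hv
    have hk : 0 ≤ ι / D.visits h s b := div_nonneg hι hn.le
    have h1 := hD.abs_empMean_optVal_sub_le_bonus hH hℓ hv hr hup hlow
    have hVa : 0 ≤ D.empVar h s b (fun s' => (up s' + low s') / 2) := empVar_nonneg
    rw [totalBonus, hq]
    dsimp only
    set E := D.empMean h s b (fun s' => up s' - low s')
    set Va := D.empVar h s b (fun s' => (up s' + low s') / 2)
    have e1 : L * ι / D.visits h s b = L * (ι / D.visits h s b) := by ring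
    have e2 : Va * ι / D.visits h s b = Va * (ι / D.visits h s b) := by ring
    have e3 : (H : ℝ) ^ 2 * S * ι / D.visits h s b = H ^ 2 * S * (ι / D.visits h s b) := by ring
    rw [e1] at h1 ⊢
    rw [e2, e3]
    set k := ι / (D.visits h s b : ℝ)
    have h2 : Real.sqrt (Va * (L * k)) ≤ L * Real.sqrt (Va * k) := by
      rw [← Real.sqrt_sq (by linarith : 0 ≤ L), ← Real.sqrt_mul (by positivity),
        Real.sqrt_sq (by linarith)]
      apply Real.sqrt_le_sqrt
      nlinarith [mul_nonneg hVa hk, mul_le_mul_of_nonneg_right hL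
        (mul_nonneg (by linarith : 0 ≤ L) (mul_nonneg hVa hk))]
    have h3 : 0 ≤ L * Real.sqrt (Va * k) := by positivity
    have h4 : 2 / (H : ℝ) * E = E / H + E / H := by ring
    rw [h4]
    have h5 : (H : ℝ) ^ 2 * S * (L * k) = L * (H ^ 2 * S * k) := by ring
    rw [h5] at h1 ⊢
    linarith
  have hbound : ∀ b, r h s b + nextMean p h s b (optVal p r n) ≤ H := fun b =>
    (le_optVal_succ hn s b).trans (optVal_le_horizon hr hn s)
  obtain ⟨hu, hl⟩ := upLow_succ (D := D) (q := q) hn s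
  refine ⟨?_, ?_, ?_, ?_⟩
  · rw [hl, qLow]
    split_ifs
    · exact le_rfl
    · exact le_max_right _ _
  · rw [hl, polEval, dif_pos hn, qLow]
    set b := D.greedyPolicy q h s
    have h0 : 0 ≤ r h s b + nextMean p h s b (polEval p (D.greedyPolicy q) r n) :=
      add_nonneg (hr _ _ _).1 (nextMean_nonneg (polEval_nonneg (fun h s b => (hr h s b).1) n))
    split_ifs with hv
    · exact h0
    refine max_le ?_ h0
    rw [hD.rewards h s b hv]
    have h1 := key b hv
    -- The bound valid for all functions is used for the data-dependent difference V* − V^π, which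
    -- lies in [0, H] and below the width.
    have h2 := (abs_le.1 (hD.abs_empMean_sub_le hH hℓ hv (B := H)
      (f := fun s' => optVal p r n s' - polEval p (D.greedyPolicy q) r n s') fun s' =>
        ⟨sub_nonneg.2 (polEval_le_optVal _ _ _), by
          linarith [(hup s').1, (hup s').2, hrev ▸ (hup s').1,
            polEval_nonneg (p := p) (ν := D.greedyPolicy q) (fun h s b => (hr h s b).1) n s']⟩)).1
    have h3 : D.empMean h s b (fun s' => optVal p r n s' - polEval p (D.greedyPolicy q) r n s') ≤
        D.empMean h s b (fun s' => up s' - low s') := empMean_mono fun s' => by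
      linarith [(ih s').2.1, (ih s').2.2.1]
    have h4 : D.empMean h s b low ≤ D.empMean h s b (polEval p (D.greedyPolicy q) r n) :=
      empMean_mono fun s' => (ih s').2.1
    have h5 := neg_abs_le (D.empMean h s b (optVal p r h.rev) -
      nextMean p h s b (optVal p r h.rev))
    have h6 := le_abs_self (D.empMean h s b (optVal p r h.rev) -
      nextMean p h s b (optVal p r h.rev))
    rw [empMean_sub, MDP.nextMean_sub] at h2
    rw [empMean_sub] at h3
    rw [hrev] at h1 h5 h6
    have h7 : (D.empMean h s b (optVal p r n) -
        D.empMean h s b (polEval p (D.greedyPolicy q) r n)) / H ≤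
        D.empMean h s b (fun s' => up s' - low s') / H := by gcongr
    have h8 : 4 * (H : ℝ) * S * H * (L * ι / D.visits h s b) =
        4 * (H ^ 2 * S * (L * ι / D.visits h s b)) := by ring
    rw [h8] at h2
    linarith
  · refine optVal_succ_le hn s fun b => le_trans ?_ (qUp_le_upLow_succ hn s b)
    rw [qUp]
    split_ifs with hv
    · exact hbound b
    refine le_min ?_ (hbound b)
    rw [hD.rewards h s b hv]
    have h1 := key b hv
    have h4 : D.empMean h s b (optVal p r n) ≤ D.empMean h s b up :=
      empMean_mono fun s' => (ih s').2.2.1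
    have h5 := neg_abs_le (D.empMean h s b (optVal p r h.rev) -
      nextMean p h s b (optVal p r h.rev))
    have h6 : 0 ≤ D.empMean h s b (fun s' => up s' - low s') / H :=
      div_nonneg (empMean_nonneg fun s' => by linarith [(hup s').1, (hlow s').2]) (by positivity)
    have h7 : 0 ≤ 4 * ((H : ℝ) ^ 2 * S * (L * ι / D.visits h s b)) := by positivity
    rw [hrev] at h1 h5
    linarith
  · rw [hu, qUp]
    split_ifs
    · exact le_rfl
    · exact min_le_right _ _

/-- The lower and upper value functions bracket the value of the greedy policy and the optimal
value. -/
theorem sandwich {n : ℕ} (hn : n ≤ H) (s : Fin S) :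
    0 ≤ (D.upLow q n).2 s ∧
      (D.upLow q n).2 s ≤ polEval p (D.greedyPolicy q) r n s ∧
      optVal p r n s ≤ (D.upLow q n).1 s ∧ (D.upLow q n).1 s ≤ H := by
  induction n generalizing s with
  | zero => simp [upLow, polEval, optVal]
  | succ n ih => exact hD.sandwich_step hr hL hι hq hn (ih (Nat.le_of_lt hn)) s

/-- The difference of the two Q-values is the empirical width plus twice the bonus. Correction terms
and the square root give (1 + 5/H)E; passing to the true kernel multiplies by 1 + 1/(2H), and (1 +
5/H)(1 + 1/(2H)) ≤ 1 + 8/H. The variance becomes that of V*, and 20 + 40 + 50 + 12 = 122 collects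
the lower-order terms. -/
theorem width_step {n : ℕ} (hn : n < H) (s : Fin S) :
    (D.upLow q (n + 1)).1 s - (D.upLow q (n + 1)).2 s ≤
      widthBonus p r L ι (Fin.rev ⟨n, hn⟩) s (D.greedyPolicy q (Fin.rev ⟨n, hn⟩) s)
          (D.visits (Fin.rev ⟨n, hn⟩) s (D.greedyPolicy q (Fin.rev ⟨n, hn⟩) s)) +
        (1 + 8 / H) * nextMean p (Fin.rev ⟨n, hn⟩) s (D.greedyPolicy q (Fin.rev ⟨n, hn⟩) s)
          (fun s' => (D.upLow q n).1 s' - (D.upLow q n).2 s') := by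
  have hH : 0 < H := by omega
  have hH1 : (1 : ℝ) ≤ H := by exact_mod_cast hH
  have hS1 : (1 : ℝ) ≤ S := by exact_mod_cast (Fin.pos s)
  have ih := fun s => hD.sandwich hr hL hι hq hn.le s
  have hs := hD.sandwich hr hL hι hq (Nat.succ_le_of_lt hn) s
  obtain ⟨hu, hl⟩ := upLow_succ (D := D) (q := q) hn s
  set h := Fin.rev ⟨n, hn⟩ with hh
  have hrev : ((h.rev : Fin H) : ℕ) = n := by simp [hh]
  set up := (D.upLow q n).1
  set low := (D.upLow q n).2
  set b := D.greedyPolicy q h s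
  have hℓ : 0 ≤ L * ι := by positivity
  have hup : ∀ s', optVal p r h.rev s' ≤ up s' ∧ up s' ≤ H := fun s' => by
    rw [hrev]; exact (ih s').2.2
  have hlow : ∀ s', 0 ≤ low s' ∧ low s' ≤ optVal p r h.rev s' := fun s' => by
    rw [hrev]; exact ⟨(ih s').1, (ih s').2.1.trans (polEval_le_optVal _ _ _)⟩
  have hw : ∀ s', up s' - low s' ∈ Set.Icc (0 : ℝ) H := fun s' =>
    ⟨by linarith [(hup s').1, (hlow s').2], by linarith [(hup s').2, (hlow s').1]⟩
  have hPw : 0 ≤ nextMean p h s b (fun s' => up s' - low s') := nextMean_nonneg fun s' => (hw s').1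
  have htriv : (D.upLow q (n + 1)).1 s - (D.upLow q (n + 1)).2 s ≤
      H + (1 + 8 / H) * nextMean p h s b (fun s' => up s' - low s') := by
    have : 0 ≤ (1 + 8 / (H : ℝ)) * nextMean p h s b (fun s' => up s' - low s') := by positivity
    linarith [hs.1, hs.2.2.2]
  rw [widthBonus]
  split_ifs with hv
  · exact htriv
  rw [min_add, le_min_iff]
  refine ⟨?_, htriv⟩
  rw [hu, hl, qUp, qLow, if_neg hv, if_neg hv]
  have hn : (0 : ℝ) < D.visits h s b := by exact_mod_cast Nat.pos_of_ne_zero hv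
  have hk : 0 ≤ ι / D.visits h s b := div_nonneg hι hn.le
  have h1 := min_le_left (D.R h s b + D.empMean h s b up + D.totalBonus q h up low s b) (H : ℝ)
  have h2 := le_max_left (D.R h s b + D.empMean h s b low - D.totalBonus q h up low s b) 0
  have h3 := hD.empVar_le hH hℓ hv hr
  have h4 := empVar_le_two_mul (f := fun s' => (up s' + low s') / 2) (g := optVal p r h.rev) hv
  have h5 := empMean_sub_avg_sq_le (D := D) (s := s) (b := b) hup hlow
  have h6 : (fun s' => ((up s' + low s') / 2 - optVal p r h.rev s') ^ 2) =
      fun s' => (optVal p r h.rev s' - (up s' + low s') / 2) ^ 2 := by funext s'; ring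
  rw [h6] at h4
  have h7 := hD.empMean_le hH hℓ hv hw
  have hE : 0 ≤ D.empMean h s b (fun s' => up s' - low s') := empMean_nonneg fun s' => (hw s').1
  have hVa : 0 ≤ D.empVar h s b (fun s' => (up s' + low s') / 2) := empVar_nonneg
  have hV : 0 ≤ nextVar p h s b (optVal p r h.rev) := nextVar_nonneg
  refine (sub_le_sub h1 h2).trans ?_
  have h9 : D.R h s b + D.empMean h s b up + D.totalBonus q h up low s b -
      (D.R h s b + D.empMean h s b low - D.totalBonus q h up low s b) =
      D.empMean h s b (fun s' => up s' - low s') + 2 * D.totalBonus q h up low s b := by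
    rw [empMean_sub]; ring
  rw [h9, totalBonus, hq]
  dsimp only
  set E := D.empMean h s b (fun s' => up s' - low s')
  set Va := D.empVar h s b (fun s' => (up s' + low s') / 2)
  set V := nextVar p h s b (optVal p r h.rev)
  set W := nextMean p h s b (fun s' => up s' - low s')
  have e1 : L * ι / D.visits h s b = L * (ι / D.visits h s b) := by ring
  have e2 : Va * ι / D.visits h s b = Va * (ι / D.visits h s b) := by ring
  have e3 : (H : ℝ) ^ 2 * S * ι / D.visits h s b = H ^ 2 * S * (ι / D.visits h s b) := by ring
  rw [e1] at h3 h7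
  rw [e2, e3]
  set k := ι / (D.visits h s b : ℝ)
  have h10 : Va ≤ 4 * V + 4 * H ^ 3 * S * (L * k) + H / 2 * E := by linarith
  have hsqrt := sqrt_mul_le_of_le hH1 hS1 hL hV hk hE h10
  have h11 : (H : ℝ) ^ 2 * k ≤ H ^ 2 * S * k := by
    have : (H : ℝ) ^ 2 ≤ H ^ 2 * S := by nlinarith [sq_nonneg (H : ℝ)]
    gcongr
  have h12 : L * (H ^ 2 * S * k) ≤ L ^ 2 * (H ^ 2 * S * k) := by
    have : L ≤ L ^ 2 := by nlinarith
    gcongr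
  have h13 : L ^ 2 * ((H : ℝ) ^ 2 * k) ≤ L ^ 2 * (H ^ 2 * S * k) := by gcongr
  have h14 : (1 + 5 / (H : ℝ)) * E ≤ (1 + 8 / H) * W + 12 * (L * (H ^ 2 * S * k)) := by
    have hc : 5 / (H : ℝ) ≤ 5 := div_le_self (by norm_num) hH1
    have hc2 : (1 + 5 / (H : ℝ)) * (1 + 1 / (2 * H)) ≤ 1 + 8 / H := by
      have : (1 + 5 / (H : ℝ)) * (1 + 1 / (2 * H)) = 1 + (5 + 1 / 2 + (5 / 2) * (1 / H)) / H := by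
        field_simp
        ring
      rw [this]
      have : 1 / (H : ℝ) ≤ 1 := by rw [div_le_one (by positivity)]; exact hH1
      gcongr
      linarith
    have hp : 0 ≤ L * ((H : ℝ) ^ 2 * S * k) := by positivity
    calc (1 + 5 / (H : ℝ)) * E ≤
        (1 + 5 / H) * ((1 + 1 / (2 * H)) * W + 2 * H * S * H * (L * k)) := by gcongr
      _ = (1 + 5 / H) * (1 + 1 / (2 * H)) * W +
          (1 + 5 / H) * (2 * (L * (H ^ 2 * S * k))) := by ring
      _ ≤ (1 + 8 / H) * W + (1 + 5) * (2 * (L * (H ^ 2 * S * k))) := by gcongr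
      _ = _ := by ring
  have h15 : (1 + 5 / (H : ℝ)) * E = E + 5 * (E / H) := by ring
  have h16 : 2 / (H : ℝ) * E = 2 * (E / H) := by ring
  rw [h16]
  linarith

/-- The certified gap is at most a constant times the expected total width bonus. -/
theorem gap_le (s₁ : Fin S) : D.gap q s₁ ≤ Real.exp 8 * polEval p (D.greedyPolicy q)
    (fun h s b => widthBonus p r L ι h s b (D.visits h s b)) H s₁ := by
  have hF : ∀ h s b, 0 ≤ widthBonus p r L ι h s b (D.visits h s b) := fun h s b =>
    (widthBonus_mem (by linarith) hι h s b _).1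
  set F : Fin H → Fin S → Fin a → ℝ := fun h s b => widthBonus p r L ι h s b (D.visits h s b)
  have key : ∀ n, n ≤ H → ∀ s, (D.upLow q n).1 s - (D.upLow q n).2 s ≤
      (1 + 8 / (H : ℝ)) ^ n * polEval p (D.greedyPolicy q) F n s := by
    intro n
    induction n with
    | zero => intro _ s; simp [upLow, polEval]
    | succ n ih =>
      intro hn s
      have hn' : n < H := hn
      refine (hD.width_step hr hL hι hq hn' s).trans ?_
      rw [polEval, dif_pos hn']
      have h1 : (1 : ℝ) ≤ 1 + 8 / H := by
        have : (0 : ℝ) ≤ 8 / H := by positivity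
        linarith
      have h2 := MDP.nextMean_mono (p := p) (h := Fin.rev ⟨n, hn'⟩) (s := s)
        (b := D.greedyPolicy q (Fin.rev ⟨n, hn'⟩) s) (ih hn'.le)
      rw [nextMean_const_mul] at h2
      rw [mul_add]
      refine add_le_add (le_mul_of_one_le_left (hF _ _ _) (one_le_pow₀ h1)) ?_
      rw [pow_succ', mul_assoc]
      exact mul_le_mul_of_nonneg_left h2 (by linarith)
  have hH : (0 : ℝ) < H ∨ H = 0 := by
    rcases Nat.eq_zero_or_pos H with h0 | h0
    · exact Or.inr h0
    · exact Or.inl (by exact_mod_cast h0)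
  refine (key H le_rfl s₁).trans (mul_le_mul_of_nonneg_right ?_ (polEval_nonneg hF H s₁))
  rcases hH with hH | hH
  · calc (1 + 8 / (H : ℝ)) ^ H ≤ (Real.exp (8 / H)) ^ H := by
          gcongr
          linarith [Real.add_one_le_exp (8 / (H : ℝ))]
      _ = Real.exp 8 := by
          rw [← Real.exp_nat_mul]
          congr 1
          field_simp
  · subst hH
    simp

end Confident

end AgentData

/-! ### Counting visits -/

section Counting

open MDP MarkovGame

variable {H S m : ℕ} {A : Fin m → ℕ} {i : Fin m}

open Classical in
/-- The number of visits of a trajectory to `(h, s, b)`, as a real number. -/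
noncomputable def cellCount (i : Fin m) (τ : List (Transition H S A)) (h : Fin H) (s : Fin S)
    (b : Fin (A i)) : ℝ :=
  (τ.map fun x => if x.h = h ∧ x.s = s ∧ x.a i = b then (1 : ℝ) else 0).sum

theorem cellCount_eq_zero_or_one {τ : List (Transition H S A)}
    (hτ : (τ.map Transition.h).Nodup) (h : Fin H) (s : Fin S) (b : Fin (A i)) :
    cellCount i τ h s b = 0 ∨ cellCount i τ h s b = 1 := by
  classical
  induction τ with
  | nil => simp [cellCount]
  | cons x τ ih =>
    rw [List.map_cons, List.nodup_cons] at hτ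
    have hc : cellCount i (x :: τ) h s b =
        (if x.h = h ∧ x.s = s ∧ x.a i = b then (1 : ℝ) else 0) + cellCount i τ h s b := by
      simp [cellCount]
    rw [hc]
    split_ifs with hx
    · right
      have : cellCount i τ h s b = 0 := by
        refine List.sum_eq_zero fun y hy => ?_
        obtain ⟨z, hz, rfl⟩ := List.mem_map.1 hy
        exact if_neg fun hcon => hτ.1 (List.mem_map.2 ⟨z, hz, hcon.1.trans hx.1.symm⟩)
      rw [this, add_zero]
    · rw [zero_add]; exact ih hτ.2

theorem trajSum_eq_sum (F : Fin H → Fin S → Fin (A i) → ℝ) (τ : List (Transition H S A)) :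
    trajSum i F τ = ∑ h, ∑ s, ∑ b, F h s b * cellCount i τ h s b := by
  classical
  induction τ with
  | nil => simp [trajSum, cellCount]
  | cons x τ ih =>
    have h1 : trajSum i F (x :: τ) = F x.h x.s (x.a i) + trajSum i F τ := by simp [trajSum]
    have h2 : ∀ h s b, cellCount i (x :: τ) h s b =
        (if x.h = h ∧ x.s = s ∧ x.a i = b then (1 : ℝ) else 0) + cellCount i τ h s b := by
      simp [cellCount]
    rw [h1, ih]
    simp only [h2, mul_add, Finset.sum_add_distrib]
    congr 1
    simp only [ite_and, mul_ite, mul_one, mul_zero, Finset.sum_ite_irrel, Finset.sum_ite_eq,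
      Finset.sum_const_zero, Finset.mem_univ, if_true]

theorem visits_trainData_cons (τ : List (Transition H S A)) (w : List (List (Transition H S A)))
    (h : Fin H) (s : Fin S) (b : Fin (A i)) :
    ((trainData i (τ :: w)).visits h s b : ℝ) =
      (trainData i w).visits h s b + cellCount i τ h s b :=
  AgentData.visits_foldl_record _ _ _ _ _

/-- A history that can be observed when the others follow `π`. -/
def ValidHist (G : MarkovGame H S A) (π : PurePolicy H S A) (i : Fin m)
    (w : List (List (Transition H S A))) : Prop :=
  ∀ τ w', τ :: w' <:+ w →
    (∀ x ∈ τ, x.r i = G.indR π i x.h x.s (x.a i)) ∧ (τ.map Transition.h).Nodup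

variable {G : MarkovGame H S A} {π : PurePolicy H S A}

namespace ValidHist

theorem of_suffix {w w' : List (List (Transition H S A))} (hw : ValidHist G π i w)
    (hs : w' <:+ w) : ValidHist G π i w' := fun τ w'' h => hw τ w'' (h.trans hs)

theorem rewardsEq {w : List (List (Transition H S A))} (hw : ValidHist G π i w) :
    (trainData i w).RewardsEq (G.indR π i) := by
  induction w with
  | nil => intro h s b hv; exact absurd (by simp [trainData, AgentData.visits, AgentData.empty]) hv
  | cons τ w ih =>
    exact (ih (hw.of_suffix (List.suffix_cons τ w))).foldl_record (hw τ w List.suffix_rfl).1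

theorem visits_le {w : List (List (Transition H S A))} (hw : ValidHist G π i w) (h : Fin H)
    (s : Fin S) (b : Fin (A i)) : (trainData i w).visits h s b ≤ w.length := by
  induction w with
  | nil => simp [trainData, AgentData.visits, AgentData.empty]
  | cons τ w ih =>
    have h1 := visits_trainData_cons (i := i) τ w h s b
    have h2 := ih (hw.of_suffix (List.suffix_cons τ w))
    have h2' : ((trainData i w).visits h s b : ℝ) ≤ w.length := by exact_mod_cast h2
    have h3 : ((trainData i (τ :: w)).visits h s b : ℝ) ≤ ((τ :: w).length : ℕ) := by
      rw [h1, List.length_cons]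
      push_cast
      rcases cellCount_eq_zero_or_one (i := i) (hw τ w List.suffix_rfl).2 h s b with h | h <;>
        rw [h] <;> linarith
    exact_mod_cast h3

/-- The pigeonhole identity: a total over all episodes, sorted by the cells visited. -/
theorem histSum_trajSum {w : List (List (Transition H S A))} (hw : ValidHist G π i w)
    (F : Fin H → Fin S → Fin (A i) → ℕ → ℝ) :
    histSum (fun w τ => trajSum i (fun h s b => F h s b ((trainData i w).visits h s b)) τ) w =
      ∑ h, ∑ s, ∑ b, ∑ j ∈ Finset.range ((trainData i w).visits h s b), F h s b j := by
  induction w with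
  | nil => simp [histSum, trainData, AgentData.visits, AgentData.empty]
  | cons τ w ih =>
    rw [histSum, ih (hw.of_suffix (List.suffix_cons τ w)), trajSum_eq_sum]
    simp only [← Finset.sum_add_distrib]
    refine Finset.sum_congr rfl fun h _ => Finset.sum_congr rfl fun s _ =>
      Finset.sum_congr rfl fun b _ => ?_
    have h1 := visits_trainData_cons (i := i) τ w h s b
    rcases cellCount_eq_zero_or_one (i := i) (hw τ w List.suffix_rfl).2 h s b with h0 | h0
    · rw [h0, add_zero] at h1
      have h1' : (trainData i (τ :: w)).visits h s b = (trainData i w).visits h s b := by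
        exact_mod_cast h1
      rw [h0, h1', mul_zero, add_zero]
    -- An episode visits a cell at most once. Its weight is taken at the count before the episode,
    -- so each visit contributes the next term of the range sum.
    · rw [h0] at h1
      have h1' : (trainData i (τ :: w)).visits h s b = (trainData i w).visits h s b + 1 := by
        exact_mod_cast h1
      rw [h0, h1', mul_one, Finset.sum_range_succ]

end ValidHist

/-- The first visit costs H; the terms 1/√j sum to at most 2√n by telescoping and the terms 1/j to a
harmonic number. The variance stays under the root, to be summed over cells afterwards. -/
theorem sum_range_widthBonus_le {a : ℕ} [NeZero a] {p : Fin H → Fin S → Fin a → PMF (Fin S)}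
    {r : Fin H → Fin S → Fin a → ℝ} {L ι : ℝ} (hL : 0 ≤ L) (hι : 0 ≤ ι) (h : Fin H) (s : Fin S)
    (b : Fin a) {n K : ℕ} (hn : n ≤ K) :
    ∑ j ∈ Finset.range n, AgentData.widthBonus p r L ι h s b j ≤
      H + 80 * L * Real.sqrt ι * Real.sqrt (nextVar p h s b (optVal p r h.rev) * n) +
        122 * L ^ 2 * (H ^ 2 * S * ι) * (1 + Real.log K) := by
  set v := nextVar p h s b (optVal p r h.rev)
  have hv : 0 ≤ v := nextVar_nonneg
  have key : ∀ n : ℕ, ∑ j ∈ Finset.range (n + 1), AgentData.widthBonus p r L ι h s b j ≤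
      H + 80 * L * Real.sqrt ι * Real.sqrt (v * n) + 122 * L ^ 2 * (H ^ 2 * S * ι) * harmonic n := by
    intro n
    induction n with
    | zero => simp [AgentData.widthBonus]
    | succ n ih =>
      rw [Finset.sum_range_succ]
      have h1 : AgentData.widthBonus p r L ι h s b (n + 1) ≤
          40 * L * Real.sqrt (v * (ι / (n + 1 : ℕ))) +
            122 * L ^ 2 * (H ^ 2 * S * (ι / (n + 1 : ℕ))) := by
        rw [AgentData.widthBonus, if_neg (Nat.succ_ne_zero n)]
        exact min_le_left _ _
      have hn0 : (0 : ℝ) < (n + 1 : ℕ) := by positivity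
      -- The telescoping bound 1/√(n+1) ≤ 2(√(n+1) − √n).
      have h2 : Real.sqrt (v * (ι / (n + 1 : ℕ))) ≤
          Real.sqrt ι * (2 * (Real.sqrt (v * (n + 1 : ℕ)) - Real.sqrt (v * n))) := by
        rw [show v * (ι / (n + 1 : ℕ)) = ι * (v / (n + 1 : ℕ)) by ring, Real.sqrt_mul hι]
        refine mul_le_mul_of_nonneg_left ?_ (Real.sqrt_nonneg ι)
        rw [Real.sqrt_div hv, Real.sqrt_mul hv, Real.sqrt_mul hv, ← mul_sub,
          ← mul_assoc, mul_comm 2, mul_assoc, div_eq_mul_inv]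
        refine mul_le_mul_of_nonneg_left ?_ (Real.sqrt_nonneg v)
        have hx : 0 < Real.sqrt (n + 1 : ℕ) := Real.sqrt_pos.2 hn0
        have hx2 := Real.sq_sqrt hn0.le
        have hy2 := Real.sq_sqrt (Nat.cast_nonneg (α := ℝ) n)
        rw [inv_le_iff_one_le_mul₀ hx]
        push_cast at *
        nlinarith [sq_nonneg (Real.sqrt ((n : ℝ) + 1) - Real.sqrt n)]
      have h3 : ((harmonic (n + 1) : ℚ) : ℝ) = harmonic n + 1 / (n + 1 : ℕ) := by
        rw [harmonic_succ]
        push_cast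
        ring
      rw [h3]
      have h4 := mul_le_mul_of_nonneg_left h2 (by positivity : 0 ≤ 40 * L)
      have h5 : 122 * L ^ 2 * (H ^ 2 * S * (ι / (n + 1 : ℕ))) =
          122 * L ^ 2 * (H ^ 2 * S * ι) * (1 / (n + 1 : ℕ)) := by ring
      linarith
  have hC : 0 ≤ 122 * L ^ 2 * ((H : ℝ) ^ 2 * S * ι) := by positivity
  rcases n with _ | n
  · have : 0 ≤ Real.log K := Real.log_natCast_nonneg K
    simp only [Finset.range_zero, Finset.sum_empty]
    positivity
  · refine (key n).trans ?_
    have h1 : Real.sqrt (v * n) ≤ Real.sqrt (v * (n + 1 : ℕ)) := by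
      apply Real.sqrt_le_sqrt
      push_cast
      nlinarith
    have h2 : (harmonic n : ℝ) ≤ 1 + Real.log K := by
      refine (harmonic_le_one_add_log n).trans ?_
      rcases Nat.eq_zero_or_pos n with h0 | h0
      · subst h0
        simpa using Real.log_natCast_nonneg K
      · have : (n : ℝ) ≤ K := by exact_mod_cast (Nat.le_of_succ_le hn)
        have h0' : (0 : ℝ) < n := by exact_mod_cast h0
        gcongr
    gcongr

/-- Cauchy-Schwarz over the cells. -/
theorem sum_cells_sqrt_le {a : ℕ} (f : Fin H → Fin S → Fin a → ℝ) (hf : ∀ h s b, 0 ≤ f h s b) :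
    ∑ h, ∑ s, ∑ b, Real.sqrt (f h s b) ≤
      Real.sqrt (H * S * a * ∑ h, ∑ s, ∑ b, f h s b) := by
  refine Real.le_sqrt_of_sq_le ?_
  have h1 := sq_sum_le_card_mul_sum_sq (s := (Finset.univ : Finset (Fin H × Fin S × Fin a)))
    (f := fun x => Real.sqrt (f x.1 x.2.1 x.2.2))
  simp only [Real.sq_sqrt (hf _ _ _), Fintype.sum_prod_type] at h1
  refine h1.trans (le_of_eq ?_)
  simp [mul_assoc]

/-- The sum of all width bonuses along a history. -/
theorem histSum_widthBonus_le [∀ i, NeZero (A i)] {w : List (List (Transition H S A))}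
    (hw : ValidHist G π i w) {L ι : ℝ} (hL : 0 ≤ L) (hι : 0 ≤ ι) :
    histSum (fun w τ => trajSum i (fun h s b => AgentData.widthBonus (G.indP π i) (G.indR π i)
        L ι h s b ((trainData i w).visits h s b)) τ) w ≤
      H * S * A i * (H + 122 * L ^ 2 * (H ^ 2 * S * ι) * (1 + Real.log w.length)) +
        80 * L * Real.sqrt ι * Real.sqrt (H * S * A i * histSum (fun _ τ => trajSum i
          (fun h s b => nextVar (G.indP π i) h s b (optVal (G.indP π i) (G.indR π i) h.rev)) τ)
            w) := by
  rw [hw.histSum_trajSum,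
    -- With a weight independent of the count, the same identity gives visits times variance, the
    -- quantity under the Cauchy-Schwarz root.
    hw.histSum_trajSum fun h s b _ => nextVar (G.indP π i) h s b
      (optVal (G.indP π i) (G.indR π i) h.rev)]
  simp only [Finset.sum_const, Finset.card_range, nsmul_eq_mul]
  have h1 := sum_cells_sqrt_le (fun h s b => ((trainData i w).visits h s b : ℝ) *
    nextVar (G.indP π i) h s b (optVal (G.indP π i) (G.indR π i) h.rev))
    fun h s b => mul_nonneg (Nat.cast_nonneg _) nextVar_nonneg
  have h2 : 0 ≤ 80 * L * Real.sqrt ι := by positivity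
  refine le_trans (Finset.sum_le_sum fun h _ => Finset.sum_le_sum fun s _ =>
    Finset.sum_le_sum fun b _ => sum_range_widthBonus_le hL hι h s b (hw.visits_le h s b)) ?_
  simp only [Finset.sum_add_distrib, Finset.sum_const, Finset.card_univ, Fintype.card_fin,
    nsmul_eq_mul, ← Finset.mul_sum]
  have h3 := mul_le_mul_of_nonneg_left h1 h2
  simp only [mul_comm (((trainData i w).visits _ _ _ : ℝ))] at h3 ⊢
  linarith

end Counting

/-! ### The good event of a training run and its probability -/

section GoodEvent

open MDP MarkovGame

variable {H S m : ℕ} {A : Fin m → ℕ} [∀ i, NeZero (A i)]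

/-- The event on which UCBVI-UPLOW succeeds. -/
structure TrainGood (G : MarkovGame H S A) (q : BonusParams) (π : PurePolicy H S A) (i : Fin m)
    (F : List (List (Transition H S A)) → Fin H → Fin S → Fin (A i) → ℝ) (ℓ : ℝ)
    (w : List (List (Transition H S A))) : Prop where
  valid : ValidHist G π i w
  confident : ∀ w', w' <:+ w → (trainData i w').Confident (G.indP π i) (G.indR π i) ℓ
  lower : histSum (fun w _ => polEval (G.indP π i) ((trainData i w).greedyPolicy q) (F w)
    H G.init) w ≤ 2 * histSum (fun w τ => trajSum i (F w) τ) w + 4 * H ^ 2 * ℓ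
  upper : histSum (fun _ τ => trajSum i (fun h s b => nextVar (G.indP π i) h s b
      (optVal (G.indP π i) (G.indR π i) h.rev)) τ) w ≤
    2 * histSum (fun w _ => polEval (G.indP π i) ((trainData i w).greedyPolicy q)
      (fun h s b => nextVar (G.indP π i) h s b (optVal (G.indP π i) (G.indR π i) h.rev))
      H G.init) w + H ^ 3 * ℓ

variable {G : MarkovGame H S A} {q : BonusParams} {π : PurePolicy H S A} {i : Fin m}

theorem validHist_of_mem_support {K : ℕ} {w : List (List (Transition H S A))}
    (hw : w ∈ (adaptiveRun (trainStep G q π i) K []).support) : ValidHist G π i w := by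
  intro τ w' hs
  have h1 := mem_support_of_cons_suffix_adaptiveRun hw hs (by simp)
  have h2 := rollout_support _ h1
  exact ⟨fun x hx => (h2.1 x hx).2.2, h2.2⟩

/-- The scale at which the exponential supermartingale gives Bernstein's inequality for `n`
samples of variance `v`. -/
noncomputable def bernsteinScale (H : ℕ) (ℓ v : ℝ) (n : ℕ) : ℝ :=
  if H ^ 2 * ℓ ≤ n * v then Real.sqrt (ℓ / (n * v)) else 1 / H

theorem bernsteinScale_mem (hH : 0 < H) {ℓ v : ℝ} (hℓ : 0 < ℓ) (n : ℕ) :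
    0 ≤ bernsteinScale H ℓ v n ∧ bernsteinScale H ℓ v n * H ≤ 1 := by
  have hH' : (0 : ℝ) < H := by exact_mod_cast hH
  rw [bernsteinScale]
  split_ifs with h
  · refine ⟨Real.sqrt_nonneg _, ?_⟩
    rw [← Real.sqrt_sq hH'.le, ← Real.sqrt_mul' _ (by positivity)]
    rw [Real.sqrt_le_one, div_mul_eq_mul_div]
    have : 0 < (H : ℝ) ^ 2 * ℓ := by positivity
    rw [div_le_one (by linarith), mul_comm]
    exact h
  · exact ⟨by positivity, by rw [div_mul_cancel₀ _ hH'.ne']⟩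

/-- The best t in tx − t²vn < ℓ is √(ℓ/(vn)), giving x < 2√(ℓvn). If it exceeds the admissible 1/H,
then vn < H²ℓ, and t = 1/H gives x < vn/H + Hℓ with vn/H ≤ √(ℓvn). -/
theorem le_of_bernsteinScale (hH : 0 < H) {ℓ v x : ℝ} (hℓ : 0 < ℓ) (hv : 0 ≤ v) (n : ℕ)
    (hx : bernsteinScale H ℓ v n * x - bernsteinScale H ℓ v n ^ 2 * v * n < ℓ) :
    x ≤ 2 * Real.sqrt (ℓ * v * n) + H * ℓ := by
  have hH' : (0 : ℝ) < H := by exact_mod_cast hH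
  rw [bernsteinScale] at hx
  split_ifs at hx with h
  · have h1 : 0 < (n : ℝ) * v := lt_of_lt_of_le (by positivity) h
    have h2 : 0 < Real.sqrt (ℓ / (n * v)) := Real.sqrt_pos.2 (by positivity)
    have h3 := Real.sq_sqrt (by positivity : 0 ≤ ℓ / (n * v))
    have h4 : Real.sqrt (ℓ * v * n) = Real.sqrt (ℓ / (n * v)) * (n * v) := by
      rw [← Real.sqrt_sq h1.le, ← Real.sqrt_mul (by positivity), Real.sqrt_sq h1.le]
      congr 1
      field_simp
    have h5 : Real.sqrt (ℓ / (n * v)) ^ 2 * v * n = ℓ := by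
      rw [h3, mul_assoc, mul_comm v, div_mul_cancel₀ _ h1.ne']
    rw [h5] at hx
    have h6 : Real.sqrt (ℓ / (n * v)) * x < Real.sqrt (ℓ / (n * v)) *
        (2 * (Real.sqrt (ℓ / (n * v)) * (n * v))) := by
      have : Real.sqrt (ℓ / (n * v)) * (2 * (Real.sqrt (ℓ / (n * v)) * (n * v))) =
        2 * (Real.sqrt (ℓ / (n * v)) ^ 2 * v * n) := by ring
      rw [this, h5]; linarith
    have h7 := lt_of_mul_lt_mul_left h6 h2.le
    rw [h4]
    have : 0 ≤ (H : ℝ) * ℓ := by positivity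
    linarith
  · have h1 : x < n * v / H + H * ℓ := by
      have : (1 / (H : ℝ)) * x - (1 / H) ^ 2 * v * n = (x - n * v / H) / H := by
        field_simp
      rw [this, div_lt_iff₀ hH'] at hx
      linarith
    have h2 : n * v / H ≤ Real.sqrt (ℓ * v * n) := by
      refine Real.le_sqrt_of_sq_le ?_
      rw [div_pow, div_le_iff₀ (by positivity)]
      have : 0 ≤ (n : ℝ) * v := by positivity
      nlinarith [not_le.1 h]
    have := Real.sqrt_nonneg (ℓ * v * n)
    linarith

/-- The failure events of the concentration inequalities of one training run: those of the
Bernstein inequalities for the optimal value, those of the inequalities for the transition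
frequencies, and two for totals along trajectories. -/
abbrev TrainIndex (H S a K : ℕ) : Type :=
  (Fin H × Fin S × Fin a × Fin K × Bool) ⊕ (Fin H × Fin S × Fin a × Fin S × Bool) ⊕ Bool

def boolSign (b : Bool) : ℝ := if b then 1 else -1

theorem abs_boolSign_mul (b : Bool) {t : ℝ} (ht : 0 ≤ t) : |boolSign b * t| = t := by
  cases b <;> simp [boolSign, abs_of_nonneg ht]

theorem boolSign_mul_sq (b : Bool) (t : ℝ) : (boolSign b * t) ^ 2 = t ^ 2 := by
  cases b <;> simp [boolSign]

theorem abs_le_of_boolSign {x y : ℝ} (h : ∀ b, boolSign b * x ≤ y) : |x| ≤ y := by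
  have h1 := h true
  have h2 := h false
  simp only [boolSign, if_true, Bool.false_eq_true, if_false] at h1 h2
  rw [abs_le]
  constructor <;> linarith

theorem nextVar_optVal_mem {h : Fin H} {s : Fin S} {b : Fin (A i)} :
    nextVar (G.indP π i) h s b (optVal (G.indP π i) (G.indR π i) h.rev) ∈
      Set.Icc (0 : ℝ) (H ^ 2) := by
  refine ⟨nextVar_nonneg, (nextVar_le_sub_sq 0).trans (MDP.nextMean_le fun s' => ?_)⟩
  have h1 := AgentData.Confident.optVal_rev_mem (p := G.indP π i) (h := h) (G.indR_mem π i) s'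
  rw [sub_zero]
  exact pow_le_pow_left₀ h1.1 h1.2 2

/-- The failure event with the given index. -/
def trainFailure (G : MarkovGame H S A) (q : BonusParams) (π : PurePolicy H S A) (i : Fin m)
    (F : List (List (Transition H S A)) → Fin H → Fin S → Fin (A i) → ℝ) (ℓ : ℝ) (K : ℕ) :
    TrainIndex H S (A i) K → Set (List (List (Transition H S A)))
  | .inl (h, s, b, n, σ) => {w | ∃ w', w' <:+ w ∧
      ℓ ≤ (boolSign σ * bernsteinScale H ℓ (nextVar (G.indP π i) h s b
        (optVal (G.indP π i) (G.indR π i) h.rev)) (n + 1)) *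
          ((trainData i w').succSum h s b (optVal (G.indP π i) (G.indR π i) h.rev) -
            (trainData i w').visits h s b *
              nextMean (G.indP π i) h s b (optVal (G.indP π i) (G.indR π i) h.rev)) -
        (boolSign σ * bernsteinScale H ℓ (nextVar (G.indP π i) h s b
          (optVal (G.indP π i) (G.indR π i) h.rev)) (n + 1)) ^ 2 *
            nextVar (G.indP π i) h s b (optVal (G.indP π i) (G.indR π i) h.rev) *
              (trainData i w').visits h s b}
  | .inr (.inl (h, s, b, s', σ)) => {w | ∃ w', w' <:+ w ∧
      ℓ ≤ (boolSign σ * (1 / (2 * H))) *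
          ((trainData i w').succSum h s b (fun t => if t = s' then 1 else 0) -
            (trainData i w').visits h s b *
              nextMean (G.indP π i) h s b (fun t => if t = s' then 1 else 0)) -
        (boolSign σ * (1 / (2 * H))) ^ 2 *
            nextVar (G.indP π i) h s b (fun t => if t = s' then 1 else 0) *
              (trainData i w').visits h s b}
  | .inr (.inr true) => {w | ℓ ≤ histSum (fun w τ =>
      polEval (G.indP π i) ((trainData i w).greedyPolicy q) (F w) H G.init / (4 * (H * H)) -
        trajSum i (F w) τ / (2 * (H * H))) w}
  | .inr (.inr false) => {w | ℓ ≤ histSum (fun w τ =>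
      trajSum i (fun h s b => nextVar (G.indP π i) h s b
        (optVal (G.indP π i) (G.indR π i) h.rev)) τ / (H * H ^ 2) -
      2 * polEval (G.indP π i) ((trainData i w).greedyPolicy q) (fun h s b => nextVar (G.indP π i)
        h s b (optVal (G.indP π i) (G.indR π i) h.rev)) H G.init / (H * H ^ 2)) w}

variable {F : List (List (Transition H S A)) → Fin H → Fin S → Fin (A i) → ℝ} {ℓ : ℝ}

theorem measure_trainFailure_le (hH : 0 < H) (hF : ∀ w h s b, F w h s b ∈ Set.Icc (0 : ℝ) H)
    (hℓ : 0 < ℓ) (K : ℕ) (j : TrainIndex H S (A i) K) :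
    (adaptiveRun (trainStep G q π i) K []).toOuterMeasure (trainFailure G q π i F ℓ K j) ≤
      ENNReal.ofReal (Real.exp (-ℓ)) := by
  have hH' : (0 : ℝ) < H := by exact_mod_cast hH
  have hH1 : (1 : ℝ) ≤ H := by exact_mod_cast hH
  rcases j with ⟨h, s, b, n, σ⟩ | ⟨h, s, b, s', σ⟩ | (_ | _)
  · refine measure_bernstein_le q h s b (B := H)
      (fun s' => AgentData.Confident.optVal_rev_mem (G.indR_mem π i) s') ?_ K ℓ
    rw [abs_boolSign_mul _ (bernsteinScale_mem hH hℓ _).1]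
    exact (bernsteinScale_mem hH hℓ _).2
  · refine measure_bernstein_le q h s b (B := 1) (fun t => ?_) ?_ K ℓ
    · split_ifs <;> simp
    · rw [abs_boolSign_mul _ (by positivity), mul_one, div_le_one (by positivity)]
      linarith
  · exact ville_histSum _ (fun w => lexp_exp_upper _ hH (by positivity)
      fun h s b => nextVar_optVal_mem) K ℓ
  · exact ville_histSum _ (fun w => lexp_exp_lower _ hH hH' (hF w)) K ℓ

theorem trainGood_of_notMem (hH : 0 < H) (hℓ : 0 < ℓ) {K : ℕ} {w : List (List (Transition H S A))}
    (hsupp : w ∈ (adaptiveRun (trainStep G q π i) K []).support)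
    (hw : ∀ j, w ∉ trainFailure G q π i F ℓ K j) : TrainGood G q π i F ℓ w := by
  have hH' : (0 : ℝ) < H := by exact_mod_cast hH
  have hval := validHist_of_mem_support hsupp
  have hlen : w.length = K := by simpa using length_of_mem_support_adaptiveRun hsupp
  refine ⟨hval, fun w' hs => ⟨(hval.of_suffix hs).rewardsEq, fun h s b => ?_,
    fun h s b s' => ?_⟩, ?_, ?_⟩
  · rcases Nat.eq_zero_or_pos ((trainData i w').visits h s b) with h0 | h0
    · rw [AgentData.succSum_eq_zero h0, h0]
      simp only [Nat.cast_zero, zero_mul, sub_zero, abs_zero, mul_zero, Real.sqrt_zero, zero_add]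
      positivity
    -- The scale depends on the visit count, while a supermartingale needs a scale fixed in advance.
    -- The union therefore runs over all counts 1, …, K, index n standing for n + 1 visits.
    have hK : (trainData i w').visits h s b - 1 < K := by
      have h1 := (hval.of_suffix hs).visits_le h s b
      have h2 := hs.length_le
      omega
    refine abs_le_of_boolSign fun σ => ?_
    have h1 := hw (.inl (h, s, b, ⟨_, hK⟩, σ))
    have h2 := not_le.1 fun hc => h1 ⟨w', hs, hc⟩
    rw [boolSign_mul_sq] at h2
    simp only [Nat.sub_add_cancel h0] at h2
    refine le_of_bernsteinScale hH hℓ nextVar_nonneg _ (lt_of_le_of_lt (le_of_eq ?_) h2)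
    ring
  · refine abs_le_of_boolSign fun σ => ?_
    have h1 := hw (.inr (.inl (h, s, b, s', σ)))
    have h2 := not_le.1 fun hc => h1 ⟨w', hs, hc⟩
    have hmean : nextMean (G.indP π i) h s b (fun t => if t = s' then 1 else 0) =
        (G.indP π i h s b s').toReal := by simp [nextMean]
    have hvar : nextVar (G.indP π i) h s b (fun t => if t = s' then 1 else 0) ≤
        (G.indP π i h s b s').toReal := by
      refine (nextVar_le_sub_sq 0).trans (le_of_eq ?_)
      rw [← hmean]
      congr 1
      funext t
      split_ifs <;> simp
    rw [boolSign_mul_sq, AgentData.succSum_single, hmean] at h2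
    set P := (G.indP π i h s b s').toReal
    set n := ((trainData i w').visits h s b : ℝ) with hn
    set X := ((trainData i w').N h s b s' : ℝ) - n * P
    have hn0 : 0 ≤ n := by positivity
    have h3 := mul_le_mul_of_nonneg_right hvar hn0
    -- The fixed scale 1/(2H) produces the relative error 1/(2H), because an indicator has variance
    -- at most its mean.
    have h4 : boolSign σ * X < nextVar (G.indP π i) h s b (fun t => if t = s' then 1 else 0) * n /
        (2 * H) + 2 * H * ℓ := by
      have : boolSign σ * (1 / (2 * (H : ℝ))) * X - (1 / (2 * (H : ℝ))) ^ 2 *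
          nextVar (G.indP π i) h s b (fun t => if t = s' then 1 else 0) * n =
          (boolSign σ * X - nextVar (G.indP π i) h s b (fun t => if t = s' then 1 else 0) * n /
            (2 * H)) / (2 * H) := by
        field_simp
      rw [this, div_lt_iff₀ (by positivity)] at h2
      linarith
    have h5 : nextVar (G.indP π i) h s b (fun t => if t = s' then 1 else 0) * n / (2 * H) ≤
        n * P / (2 * H) := by
      rw [mul_comm n P]
      gcongr
    linarith
  · have h1 := hw (.inr (.inr true))
    simp only [trainFailure, Set.mem_ofPred_eq, not_le] at h1
    have h2 := histSum_sub_mul (fun w (_ : List (Transition H S A)) =>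
      polEval (G.indP π i) ((trainData i w).greedyPolicy q) (F w) H G.init)
      (fun w τ => trajSum i (F w) τ) (1 / (4 * (H * H))) (1 / (2 * (H * H))) w
    simp only [one_div_mul_eq_div] at h2
    rw [h2] at h1
    have h3 : ∀ x y : ℝ, x / (4 * (H * H)) - y / (2 * (H * H)) = (x - 2 * y) / (4 * (H * H)) :=
      fun x y => by field_simp; ring
    rw [h3, div_lt_iff₀ (by positivity)] at h1
    linarith
  · have h1 := hw (.inr (.inr false))
    simp only [trainFailure, Set.mem_ofPred_eq, not_le] at h1
    have h2 := histSum_sub_mul (fun _ τ => trajSum i (fun h s b => nextVar (G.indP π i) h s b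
        (optVal (G.indP π i) (G.indR π i) h.rev)) τ)
      (fun w (_ : List (Transition H S A)) =>
        polEval (G.indP π i) ((trainData i w).greedyPolicy q) (fun h s b => nextVar (G.indP π i)
          h s b (optVal (G.indP π i) (G.indR π i) h.rev)) H G.init)
      (1 / (H * H ^ 2)) (2 / (H * H ^ 2)) w
    simp only [div_mul_eq_mul_div, one_mul] at h2
    rw [h2, ← sub_div, div_lt_iff₀ (by positivity)] at h1
    linarith

theorem measure_not_trainGood_le (hH : 0 < H) (hF : ∀ w h s b, F w h s b ∈ Set.Icc (0 : ℝ) H)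
    (hℓ : 0 < ℓ) (K : ℕ) :
    (adaptiveRun (trainStep G q π i) K []).toOuterMeasure {w | ¬ TrainGood G q π i F ℓ w} ≤
      ((2 * (H * S * A i * K) + 2 * (H * S * A i * S) + 2 : ℕ) : ℝ≥0∞) *
        ENNReal.ofReal (Real.exp (-ℓ)) := by
  calc _ ≤ (adaptiveRun (trainStep G q π i) K []).toOuterMeasure
        (⋃ j, trainFailure G q π i F ℓ K j) := by
        refine PMF.toOuterMeasure_mono _ fun w hw => ?_
        by_contra hc
        rw [Set.mem_iUnion, not_exists] at hc
        exact hw.1 (trainGood_of_notMem hH hℓ hw.2 hc)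
    _ ≤ ∑ j, (adaptiveRun (trainStep G q π i) K []).toOuterMeasure
        (trainFailure G q π i F ℓ K j) := MeasureTheory.measure_iUnion_fintype_le _ _
    _ ≤ ∑ _j : TrainIndex H S (A i) K, ENNReal.ofReal (Real.exp (-ℓ)) :=
        Finset.sum_le_sum fun j _ => measure_trainFailure_le hH hF hℓ K j
    _ = _ := by
        rw [Finset.sum_const, Finset.card_univ, nsmul_eq_mul]
        congr 2
        simp only [Fintype.card_sum, Fintype.card_prod, Fintype.card_fin, Fintype.card_bool]
        ring

/-! ### The guarantee of UCBVI-UPLOW -/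

/-- The running minimum covers every stage at which an episode was still to be played. The gap after
the final episode is never computed, hence the extra `τ` in the hypothesis. -/
theorem trainResult_fst_le {w w' : List (List (Transition H S A))} {s₁ : Fin S}
    {τ : List (Transition H S A)} (hs : τ :: w' <:+ w) :
    (trainResult s₁ q π i w).1 ≤ (trainData i w').gap q s₁ := by
  induction w with
  | nil => simp at hs
  | cons σ w ih =>
    have hle : (trainResult s₁ q π i (σ :: w)).1 ≤ (trainResult s₁ q π i w).1 ∧
        (trainResult s₁ q π i (σ :: w)).1 ≤ (trainData i w).gap q s₁ := by
      rw [trainResult]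
      split_ifs with h
      · exact ⟨h.le, le_rfl⟩
      · exact ⟨le_rfl, not_lt.1 h⟩
    rcases List.suffix_cons_iff.1 hs with h | h
    · obtain ⟨rfl, rfl⟩ := List.cons.inj h
      exact hle.2
    · exact hle.1.trans (ih h)

theorem trainResult_eq (w : List (List (Transition H S A))) (s₁ : Fin S) :
    trainResult s₁ q π i w = (↑H, π i) ∨ ∃ w', w' <:+ w ∧ trainResult s₁ q π i w =
      ((trainData i w').gap q s₁, (trainData i w').greedyPolicy q) := by
  induction w with
  | nil => exact Or.inl rfl
  | cons σ w ih =>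
    rw [trainResult]
    split_ifs with h
    · exact Or.inr ⟨w, List.suffix_cons σ w, rfl⟩
    · exact ih.imp_right fun ⟨w', hs, he⟩ => ⟨w', hs.trans (List.suffix_cons σ w), he⟩

theorem length_mul_le_histSum {α : Type} {w : List α} {g : List α → ℝ} {c : ℝ}
    (h : ∀ τ w', τ :: w' <:+ w → c ≤ g w') : w.length * c ≤ histSum (fun w _ => g w) w := by
  induction w with
  | nil => simp [histSum]
  | cons τ w ih =>
    rw [histSum, List.length_cons]
    push_cast
    linarith [h τ w List.suffix_rfl, ih fun σ w' hs => h σ w' (hs.trans (List.suffix_cons τ w))]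

theorem histSum_le_length_mul {α : Type} {w : List α} {g : List α → ℝ} {c : ℝ}
    (h : ∀ τ w', τ :: w' <:+ w → g w' ≤ c) : histSum (fun w _ => g w) w ≤ w.length * c := by
  induction w with
  | nil => simp [histSum]
  | cons τ w ih =>
    rw [histSum, List.length_cons]
    push_cast
    linarith [h τ w List.suffix_rfl, ih fun σ w' hs => h σ w' (hs.trans (List.suffix_cons τ w))]

theorem histSum_mono {α : Type} {w : List α} {g g' : List α → ℝ}
    (h : ∀ τ w', τ :: w' <:+ w → g w' ≤ g' w') :
    histSum (fun w _ => g w) w ≤ histSum (fun w _ => g' w) w := by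
  induction w with
  | nil => simp [histSum]
  | cons τ w ih =>
    rw [histSum, histSum]
    exact add_le_add (ih fun σ w' hs => h σ w' (hs.trans (List.suffix_cons τ w)))
      (h τ w List.suffix_rfl)

theorem histSum_const_mul {α : Type} (c : ℝ) (g : List α → ℝ) (w : List α) :
    histSum (fun w _ => c * g w) w = c * histSum (fun w _ => g w) w := by
  induction w with
  | nil => simp [histSum]
  | cons τ w ih => rw [histSum, histSum, ih]; ring

/-- On the good event the returned policy is nearly optimal if there are enough episodes. -/
theorem TrainGood.optVal_sub_le {L ι δ : ℝ} (hL : 1 ≤ L) (hι : 0 ≤ ι)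
    {w : List (List (Transition H S A))}
    (hw : TrainGood G ⟨10 * L, 2, ι⟩ π i (fun w h s b => AgentData.widthBonus (G.indP π i)
      (G.indR π i) L ι h s b ((trainData i w).visits h s b)) (L * ι) w) (hδ : δ < H)
    (hpos : 0 < w.length) (hK : Real.exp 8 * (2 * (H * S * A i * (H + 122 * L ^ 2 * (H ^ 2 * S * ι) *
      (1 + Real.log w.length)) + 80 * L * Real.sqrt ι * Real.sqrt (H * S * A i *
        (2 * (w.length * H ^ 2) + H ^ 3 * (L * ι)))) + 4 * H ^ 2 * (L * ι)) ≤ w.length * δ) :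
    optVal (G.indP π i) (G.indR π i) H G.init - polEval (G.indP π i)
      (trainResult G.init ⟨10 * L, 2, ι⟩ π i w).2 (G.indR π i) H G.init ≤ δ := by
  set q : BonusParams := ⟨10 * L, 2, ι⟩ with hq
  have hr := G.indR_mem π i
  have hconf : ∀ w', w' <:+ w →
      (trainData i w').Confident (G.indP π i) (G.indR π i) (L * ι) := hw.confident
  -- If even the smallest gap exceeded δ, the gaps would add up to more than δ times the number of
  -- episodes, against the bound on the total width.
  have hbest : (trainResult G.init q π i w).1 ≤ δ := by
    by_contra hcon
    have hcon := not_le.1 hcon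
    have hK0 : (0 : ℝ) < w.length := by exact_mod_cast hpos
    have h1 := length_mul_le_histSum (w := w) (g := fun w' => (trainData i w').gap q G.init)
      (c := (trainResult G.init q π i w).1) fun τ w' hs => trainResult_fst_le hs
    have h2 := histSum_mono (w := w) fun τ w' hs => (hconf w' ((List.suffix_cons τ w').trans hs)
      ).gap_le hr hL hι hq G.init
    rw [histSum_const_mul] at h2
    have h3 := hw.lower
    have h4 := histSum_widthBonus_le hw.valid (by linarith : 0 ≤ L) hι
    have h5 := hw.upper
    have h6 := histSum_le_length_mul (w := w) (c := (H : ℝ) ^ 2)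
      (g := fun w' => polEval (G.indP π i) ((trainData i w').greedyPolicy q)
        (fun h s b => nextVar (G.indP π i) h s b (optVal (G.indP π i) (G.indR π i) h.rev))
        H G.init) fun τ w' hs => polEval_nextVar_optVal_le hr _ _
    have h7 := mul_lt_mul_of_pos_left hcon hK0
    have h8 : Real.sqrt (H * S * A i * histSum (fun _ τ => trajSum i
        (fun h s b => nextVar (G.indP π i) h s b (optVal (G.indP π i) (G.indR π i) h.rev)) τ) w) ≤
        Real.sqrt (H * S * A i * (2 * (w.length * H ^ 2) + H ^ 3 * (L * ι))) := by
      apply Real.sqrt_le_sqrt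
      gcongr
      linarith
    have h9 : 0 ≤ 80 * L * Real.sqrt ι := by positivity
    have h10 := mul_le_mul_of_nonneg_left h8 h9
    have h11 : Real.exp 8 * histSum (fun w' _ => polEval (G.indP π i)
        ((trainData i w').greedyPolicy q) (fun h s b => AgentData.widthBonus (G.indP π i)
          (G.indR π i) L ι h s b ((trainData i w').visits h s b)) H G.init) w ≤
        Real.exp 8 * (2 * (H * S * A i * (H + 122 * L ^ 2 * (H ^ 2 * S * ι) *
          (1 + Real.log w.length)) + 80 * L * Real.sqrt ι * Real.sqrt (H * S * A i *
            (2 * (w.length * H ^ 2) + H ^ 3 * (L * ι)))) + 4 * H ^ 2 * (L * ι)) := by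
      refine mul_le_mul_of_nonneg_left ?_ (Real.exp_pos 8).le
      linarith
    linarith
  rcases trainResult_eq (q := q) (π := π) w G.init with h | ⟨w', hs, h⟩
  -- The initial policy carries the trivial gap H > δ, so the output is a certified greedy policy.
  · rw [h] at hbest
    exact absurd hbest (not_le.2 hδ)
  · rw [h] at hbest ⊢
    have h1 := (hconf w' hs).sandwich hr hL hι hq le_rfl G.init
    have h2 : (trainData i w').gap q G.init =
      ((trainData i w').upLow q H).1 G.init - ((trainData i w').upLow q H).2 G.init := rfl
    dsimp only at hbest ⊢
    linarith [h1.2.1, h1.2.2.1]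

end GoodEvent

/-! ### Monte Carlo evaluation -/

section MonteCarlo

open MDP MarkovGame

variable {H S m : ℕ} {A : Fin m → ℕ} {G : MarkovGame H S A} {π : PurePolicy H S A} {i : Fin m}

theorem value_toPolicy_update (ν : PlayerPure H S (A i)) :
    G.value i (PurePolicy.toPolicy (Function.update π i ν)) =
      polEval (G.indP π i) ν (G.indR π i) H G.init := valueToGo_pure_update ν H G.init

theorem value_toPolicy :
    G.value i π.toPolicy = polEval (G.indP π i) (π i) (G.indR π i) H G.init := by
  rw [← value_toPolicy_update, Function.update_eq_self]

/-- The return of player `i` has a moment generating function of Bernstein type. -/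
theorem lexp_exp_return {t : ℝ} (ht : |t| * H ≤ 1 / 2) :
    (G.rollout π H G.init).lexp (fun τ => ENNReal.ofReal (Real.exp
      (t * (τ.map fun x => x.r i).sum - (t * G.value i π.toPolicy + t ^ 2 * H ^ 2)))) ≤ 1 := by
  have hπ : Function.update π i (π i) = π := Function.update_eq_self i π
  rw [value_toPolicy]
  set V := polEval (G.indP π i) (π i) (G.indR π i) H G.init with hV
  have hV0 : 0 ≤ V := polEval_nonneg (fun h s b => (G.indR_mem π i h s b).1) _ _
  have hVH : V ≤ H := by
    simpa using polEval_le (p := G.indP π i) (ν := π i) zero_le_one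
      (fun h s b => (G.indR_mem π i h s b).2) H G.init
  have h1 : ∀ τ ∈ (G.rollout π H G.init).support,
      ENNReal.ofReal (Real.exp (t * (τ.map fun x => x.r i).sum - (t * V + t ^ 2 * H ^ 2))) ≤
        ENNReal.ofReal (Real.exp (-(t ^ 2 * H ^ 2))) *
          ENNReal.ofReal (1 - t * V + t ^ 2 * H ^ 2 +
            trajSum i (fun h s b => t * G.indR π i h s b) τ) := by
    intro τ hτ
    rw [← hπ] at hτ
    have hsum : (τ.map fun x => x.r i).sum = trajSum i (G.indR π i) τ := by
      rw [trajSum]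
      congr 1
      exact List.map_congr_left fun x hx => ((rollout_support _ hτ).1 x hx).2.2
    obtain ⟨h0, h1⟩ := trajSum_mem zero_le_one (G.indR_mem π i)
      (length_le_of_mem_support_rollout hτ)
    rw [mul_one] at h1
    rw [← ENNReal.ofReal_mul (Real.exp_pos _).le, hsum, trajSum_const_mul]
    refine ENNReal.ofReal_le_ofReal ?_
    set R := trajSum i (G.indR π i) τ
    have h2 : t * R - (t * V + t ^ 2 * H ^ 2) = -(t ^ 2 * H ^ 2) + t * (R - V) := by ring
    rw [h2, Real.exp_add]
    refine mul_le_mul_of_nonneg_left ?_ (Real.exp_pos _).le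
    have h3 : |R - V| ≤ H := abs_le.2 ⟨by linarith, by linarith⟩
    refine (exp_le_quadratic ?_).trans ?_
    · rw [abs_mul]
      exact (mul_le_mul_of_nonneg_left h3 (abs_nonneg t)).trans (ht.trans (by norm_num))
    · have h4 : (R - V) ^ 2 ≤ (H : ℝ) ^ 2 := sq_le_sq' (abs_le.1 h3).1 (abs_le.1 h3).2
      have h5 := mul_le_mul_of_nonneg_left h4 (sq_nonneg t)
      rw [mul_pow]
      linarith
  refine (PMF.lexp_mono _ h1).trans ?_
  rw [PMF.lexp_const_mul]
  -- This keeps the affine integrand nonnegative: the offset is at least 1/2, and the return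
  -- contributes at least −1/2.
  have htV : |t * V| ≤ 1 / 2 := by
    rw [abs_mul, abs_of_nonneg hV0]
    exact (mul_le_mul_of_nonneg_left hVH (abs_nonneg t)).trans ht
  have h2 := lexp_rollout_affine (G := G) (π := π) (π i) (fun h s b => t * G.indR π i h s b)
    (c := |t|) (abs_nonneg t) (fun h s b => by
      have h0 := (G.indR_mem π i h s b).1
      have h1 := (G.indR_mem π i h s b).2
      have h3 : |t * G.indR π i h s b| ≤ |t| := by
        rw [abs_mul, abs_of_nonneg h0]
        exact mul_le_of_le_one_right (abs_nonneg t) h1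
      exact (abs_le.1 h3).1) H G.init (1 - t * V + t ^ 2 * H ^ 2) (by
      have : 0 ≤ t ^ 2 * (H : ℝ) ^ 2 := by positivity
      linarith [(abs_le.1 htV).2])
  simp only [trajSum]
  rw [hπ] at h2
  rw [h2, polEval_const_mul, ← hV, ← ENNReal.ofReal_mul (Real.exp_pos _).le,
    ENNReal.ofReal_le_one]
  have h3 := Real.add_one_le_exp (t ^ 2 * (H : ℝ) ^ 2)
  calc _ ≤ Real.exp (-(t ^ 2 * H ^ 2)) * Real.exp (t ^ 2 * H ^ 2) := by
        refine mul_le_mul_of_nonneg_left ?_ (Real.exp_pos _).le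
        linarith
    _ = 1 := by rw [← Real.exp_add]; simp

theorem sumReturns_succ (N n : ℕ) :
    sumReturns G.play π i (N + 1) n = (G.rollout π H G.init).bind fun τ =>
      (sumReturns G.play π i N (n + 1)).map fun y => ((τ.map fun x => x.r i).sum + y.1, y.2) := by
  rw [sumReturns]
  change ((G.rollout π H G.init).map _).bind _ = _
  rw [PMF.bind_map]
  rfl

theorem snd_of_mem_support_sumReturns {N n : ℕ} {x : ℝ × ℕ}
    (hx : x ∈ (sumReturns G.play π i N n : PMF (ℝ × ℕ)).support) : x.2 = n + N := by
  induction N generalizing n x with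
  | zero =>
    change x ∈ (PMF.pure ((0 : ℝ), n)).support at hx
    rw [PMF.mem_support_pure_iff] at hx
    simp [hx]
  | succ N ih =>
    rw [sumReturns_succ, PMF.mem_support_bind_iff] at hx
    obtain ⟨τ, _, hx⟩ := hx
    rw [PMF.mem_support_map_iff] at hx
    obtain ⟨y, hy, rfl⟩ := hx
    rw [ih hy]
    ring

theorem lexp_exp_sumReturns {t : ℝ} (ht : |t| * H ≤ 1 / 2) (N n : ℕ) :
    PMF.lexp (sumReturns G.play π i N n) (fun x => ENNReal.ofReal (Real.exp
      (t * x.1 - N * (t * G.value i π.toPolicy + t ^ 2 * H ^ 2)))) ≤ 1 := by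
  induction N generalizing n with
  | zero =>
    change (PMF.pure ((0 : ℝ), n)).lexp _ ≤ 1
    rw [PMF.lexp_pure]
    simp
  | succ N ih =>
    rw [sumReturns_succ, PMF.lexp_bind]
    refine le_trans (PMF.lexp_mono _ fun τ _ => ?_) (lexp_exp_return (G := G) (π := π) (i := i) ht)
    rw [PMF.lexp_map]
    set c := t * G.value i π.toPolicy + t ^ 2 * H ^ 2
    have : ∀ y : ℝ × ℕ, ENNReal.ofReal (Real.exp (t * ((τ.map fun x => x.r i).sum + y.1) -
        (N + 1 : ℕ) * c)) = ENNReal.ofReal (Real.exp (t * (τ.map fun x => x.r i).sum - c)) *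
          ENNReal.ofReal (Real.exp (t * y.1 - N * c)) := fun y => by
      rw [← ENNReal.ofReal_mul (Real.exp_pos _).le, ← Real.exp_add]
      push_cast
      ring_nf
    simp only [this]
    rw [PMF.lexp_const_mul]
    exact mul_le_of_le_one_right zero_le (ih (n + 1))

/-- The scale t = δ/(2H²) maximizes N(tδ − t²H²), with value Nδ²/(4H²), and is admissible since δ ≤
H. The two signs give the factor 2. -/
theorem mcValue_failsWithin {N : ℕ} {δ ℓ : ℝ} (hN : 0 < N) (hδ : 0 < δ) (hδH : δ ≤ H)
    (hℓ : ℓ ≤ N * δ ^ 2 / (4 * H ^ 2)) (n : ℕ) :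
    (mcValue G.play π i N).FailsWithin n
      (fun v k => |v - G.value i π.toPolicy| ≤ δ ∧ k = n + N)
      (2 * ENNReal.ofReal (Real.exp (-ℓ))) := by
  have hH : (0 : ℝ) < H := hδ.trans_le hδH
  have hN' : (0 : ℝ) < N := by exact_mod_cast hN
  set V := G.value i π.toPolicy
  have hrw : (mcValue G.play π i N n : PMF (ℝ × ℕ)) =
      (sumReturns G.play π i N n : PMF (ℝ × ℕ)).map fun x : ℝ × ℕ => (x.1 / N, x.2) := rfl
  rw [Learn.FailsWithin, hrw, PMF.toOuterMeasure_map_apply]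
  set t := δ / (2 * H ^ 2) with ht
  have ht0 : 0 < t := by positivity
  have htH : t * H ≤ 1 / 2 := by
    rw [ht, div_mul_eq_mul_div, div_le_div_iff₀ (by positivity) (by norm_num)]
    nlinarith
  have hY : ∀ σ, (sumReturns G.play π i N n : PMF (ℝ × ℕ)).toOuterMeasure {x | ℓ ≤
      (boolSign σ * t) * x.1 - N * ((boolSign σ * t) * V + (boolSign σ * t) ^ 2 * H ^ 2)} ≤
      ENNReal.ofReal (Real.exp (-ℓ)) := fun σ =>
    PMF.toOuterMeasure_le_exp _ _ ℓ
      (lexp_exp_sumReturns (by rw [abs_boolSign_mul _ ht0.le]; exact htH) N n)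
  have key : ∀ x : ℝ × ℕ, (∀ σ, ¬ ℓ ≤ (boolSign σ * t) * x.1 -
      N * ((boolSign σ * t) * V + (boolSign σ * t) ^ 2 * H ^ 2)) → |x.1 / N - V| ≤ δ := by
    intro x hx
    refine abs_le_of_boolSign fun σ => ?_
    have h1 := not_le.1 (hx σ)
    rw [boolSign_mul_sq] at h1
    have h2 : N * δ ^ 2 / (4 * (H : ℝ) ^ 2) = t * (N * δ) - N * (t ^ 2 * H ^ 2) := by
      rw [ht]
      field_simp
      ring
    have h3 : t * (boolSign σ * (x.1 - N * V)) < t * (N * δ) := by linarith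
    have h4 := lt_of_mul_lt_mul_left h3 ht0.le
    have h5 : boolSign σ * (x.1 / N - V) = boolSign σ * (x.1 - N * V) / N := by field_simp
    rw [h5, div_le_iff₀ hN', mul_comm δ]
    exact h4.le
  rw [two_mul]
  refine le_trans (PMF.toOuterMeasure_mono _ ?_)
    ((MeasureTheory.measure_union_le _ _).trans (add_le_add (hY true) (hY false)))
  rintro x ⟨hx, hs⟩
  have hs' : x.2 = n + N := snd_of_mem_support_sumReturns hs
  by_contra hc
  refine hx ⟨key x fun σ hσ => hc ?_, hs'⟩
  cases σ
  · exact Or.inr hσ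
  · exact Or.inl hσ

end MonteCarlo

/-! ### Best-response dynamics -/

section BestResponse

open MDP MarkovGame

variable {H S m : ℕ} {A : Fin m → ℕ} {G : MarkovGame H S A} {π : PurePolicy H S A}

/-- The gain of the candidate is estimated up to `2 δ`, and its policy is a best response to the
others up to `δ`. -/
def Candidate.IsAccurate (G : MarkovGame H S A) (π : PurePolicy H S A) (δ : ℝ)
    (c : Candidate H S A) : Prop :=
  |c.gain - (G.value c.player (PurePolicy.toPolicy (Function.update π c.player c.policy)) -
      G.value c.player π.toPolicy)| ≤ 2 * δ ∧
    ∀ μ, G.value c.player (Function.update π.toPolicy c.player μ) ≤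
      G.value c.player (PurePolicy.toPolicy (Function.update π c.player c.policy)) + δ

/-- The estimate is off by at most 2δ = ε/4, so an estimated gain above ε/2 is a true gain above
ε/4, and the potential rises by the same amount. -/
theorem Candidate.IsAccurate.potential_lt {c : Candidate H S A} {ε : ℝ} {Φ : Policy H S A → ℝ}
    (hΦ : G.IsPotential Φ) (hc : c.IsAccurate G π (ε / 8)) (hgain : ε / 2 < c.gain) :
    Φ π.toPolicy + ε / 4 < Φ (PurePolicy.toPolicy (Function.update π c.player c.policy)) := by
  have h1 := (abs_le.1 hc.1).2
  rw [toPolicy_update] at h1 ⊢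
  linarith [hΦ c.player π.toPolicy fun h s => PMF.pure (c.policy h s)]

/-- The errors add up to ε/2 + ε/4 + ε/8 < ε: threshold, estimation of the gain, suboptimality of
the candidate. -/
theorem isNash_of_isAccurate {ε g : ℝ} (hε : 0 < ε) (hg : g ≤ ε / 2) (h : ∀ i, ∃ c : Candidate H S A,
    c.IsAccurate G π (ε / 8) ∧ c.player = i ∧ c.gain ≤ g) : G.IsNash ε π.toPolicy := by
  intro i μ
  obtain ⟨c, hc, rfl, hcg⟩ := h i
  linarith [(abs_le.1 hc.1).1, hc.2 μ]

variable [∀ i, NeZero (A i)]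

theorem ucbviUpLow_failsWithin {i : Fin m}
    {q : BonusParams} {K : ℕ} {Good : PlayerPure H S (A i) → Prop} {η : ℝ≥0∞}
    (h : (adaptiveRun (trainStep G q π i) K []).toOuterMeasure
      {w | ¬ Good (trainResult G.init q π i w).2} ≤ η) (n : ℕ) :
    (ucbviUpLow G.play G.init q K π i).FailsWithin n (fun ν k => Good ν ∧ k = n + K) η := by
  have h1 := ucbviLoop_eq G G.init q π i K [] n
  rw [Learn.FailsWithin]
  have h2 : ucbviUpLow G.play G.init q K π i n = _ := h1
  rw [h2, PMF.toOuterMeasure_map_apply]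
  refine le_trans (MeasureTheory.measure_mono ?_) h
  exact fun w hw hg => hw ⟨hg, rfl⟩

/-- The evaluation episodes are played after the candidate is fixed, so a bound valid for every
profile and every counter value suffices. The two evaluation errors add to 2δ. -/
theorem estimateGain_failsWithin {k : Consts} {ι δ : ℝ} {i : Fin m} {η η' : ℝ≥0∞}
    (htrain : (adaptiveRun (trainStep G ⟨k.bonus, k.corr, ι⟩ π i)
      (trainEpisodes k H S (A i) ι δ) []).toOuterMeasure
        {w | ¬ optVal (G.indP π i) (G.indR π i) H G.init - polEval (G.indP π i)
          (trainResult G.init ⟨k.bonus, k.corr, ι⟩ π i w).2 (G.indR π i) H G.init ≤ δ} ≤ η)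
    (heval : ∀ (ρ : PurePolicy H S A) (n : ℕ),
      (mcValue G.play ρ i (evalEpisodes k H ι δ)).FailsWithin n
        (fun v l => |v - G.value i ρ.toPolicy| ≤ δ ∧ l = n + evalEpisodes k H ι δ) η') (n : ℕ) :
    (estimateGain k G.play G.init ι δ π i).FailsWithin n
      (fun c l => c.IsAccurate G π δ ∧ c.player = i ∧
        l = n + (trainEpisodes k H S (A i) ι δ + 2 * evalEpisodes k H ι δ)) (η + (η' + (η' + 0))) := by
  rw [estimateGain]
  refine (ucbviUpLow_failsWithin (Good := fun ν => optVal (G.indP π i) (G.indR π i) H G.init -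
    polEval (G.indP π i) ν (G.indR π i) H G.init ≤ δ) htrain n).bind ?_
  rintro ν _ ⟨hν, rfl⟩
  refine (heval _ _).bind ?_
  rintro v _ ⟨hv, rfl⟩
  refine (heval _ _).bind ?_
  rintro v' _ ⟨hv', rfl⟩
  refine Learn.FailsWithin.pure ⟨⟨?_, fun μ => ?_⟩, rfl, by ring⟩
  · dsimp only
    rw [abs_le] at hv hv' ⊢
    constructor <;> linarith [hv.1, hv.2, hv'.1, hv'.2]
  · dsimp only
    rw [value_toPolicy_update]
    have := valueToGo_update_le (G := G) (π := π) μ H G.init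
    rw [value]
    linarith

variable {k : Consts} {ι δ : ℝ} {E : Fin m → ℕ} {η : ℝ≥0∞}

theorem mapM_estimateGain_failsWithin
    (hest : ∀ (i : Fin m) (n : ℕ), (estimateGain k G.play G.init ι δ π i).FailsWithin n
      (fun c l => c.IsAccurate G π δ ∧ c.player = i ∧ l = n + E i) η) (is : List (Fin m)) (n : ℕ) :
    Learn.FailsWithin (is.mapM (estimateGain k G.play G.init ι δ π)) n
      (fun cs l => (∀ c ∈ cs, c.IsAccurate G π δ) ∧ (∀ i ∈ is, ∃ c ∈ cs, c.player = i) ∧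
        l = n + (is.map E).sum) (is.length * η) := by
  induction is generalizing n with
  | nil =>
    rw [List.mapM_nil]
    exact (Learn.FailsWithin.pure (by simp)).mono (fun _ _ h => h) zero_le
  | cons i is ih =>
    rw [List.mapM_cons]
    refine ((hest i n).bind (q' := is.length * η + 0) ?_).mono (fun _ _ h => h) ?_
    · rintro c _ ⟨hc, hci, rfl⟩
      refine (ih _).bind ?_
      rintro cs _ ⟨h1, h2, rfl⟩
      refine Learn.FailsWithin.pure ⟨?_, ?_, ?_⟩
      · intro c' hc'
        rcases List.mem_cons.1 hc' with rfl | hc'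
        · exact hc
        · exact h1 c' hc'
      · intro j hj
        rcases List.mem_cons.1 hj with rfl | hj
        · exact ⟨c, List.mem_cons_self, hci⟩
        · obtain ⟨c', hc', hj'⟩ := h2 j hj
          exact ⟨c', List.mem_cons_of_mem _ hc', hj'⟩
      · rw [List.map_cons, List.sum_cons]
        ring
    · rw [List.length_cons]
      push_cast
      rw [add_zero, add_mul, one_mul, add_comm]

theorem estimateNEGap_failsWithin [NeZero m]
    (hest : ∀ (i : Fin m) (n : ℕ), (estimateGain k G.play G.init ι δ π i).FailsWithin n
      (fun c l => c.IsAccurate G π δ ∧ c.player = i ∧ l = n + E i) η) (n : ℕ) :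
    (estimateNEGap k G.play G.init ι δ π).FailsWithin n
      (fun o l => (∃ c, o = some c ∧ c.IsAccurate G π δ ∧
        ∀ i, ∃ c' : Candidate H S A, c'.IsAccurate G π δ ∧ c'.player = i ∧ c'.gain ≤ c.gain) ∧ l = n + ∑ i, E i)
      (m * η) := by
  rw [estimateNEGap]
  refine ((mapM_estimateGain_failsWithin hest (List.finRange m) n).bind (q' := 0) ?_).mono
    (fun _ _ h => h) ?_
  · rintro cs _ ⟨h1, h2, rfl⟩
    refine Learn.FailsWithin.pure ⟨?_, ?_⟩
    · obtain ⟨c₀, hc₀, _⟩ := h2 0 (List.mem_finRange 0)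
      cases ho : cs.argmax Candidate.gain with
      | none =>
        rw [List.argmax_eq_none] at ho
        rw [ho] at hc₀
        simp at hc₀
      | some c =>
        refine ⟨c, rfl, h1 c (List.argmax_mem ho), fun i => ?_⟩
        obtain ⟨c', hc', hi⟩ := h2 i (List.mem_finRange i)
        exact ⟨c', h1 c' hc', hi, List.le_of_mem_argmax hc' ho⟩
    · rw [← List.ofFn_eq_map, List.sum_ofFn]
  · rw [List.length_finRange, add_zero]

/-- Induction on j, the potential still to be gained in units of ε/4. An accurate replacement uses
up one unit; at j = 0 it would exceed the supremum, so the algorithm stops there. At most j + 1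
rounds are played, each with cost ∑ E and failure probability at most mη. -/
theorem bestResponse_failsWithin [NeZero m] {ε : ℝ} {Φ : Policy H S A → ℝ}
    (hε : 0 < ε) (hΦ : G.IsPotential Φ) (hbdd : BddAbove (Set.range Φ))
    (hest : ∀ (π : PurePolicy H S A) (i : Fin m) (n : ℕ),
      (estimateGain k G.play G.init ι (ε / 8) π i).FailsWithin n
        (fun c l => c.IsAccurate G π (ε / 8) ∧ c.player = i ∧ l = n + E i) η)
    (j T : ℕ) (hT : j + 1 ≤ T) (π : PurePolicy H S A)
    (hπ : (⨆ ρ, Φ ρ) - Φ π.toPolicy ≤ j * (ε / 4)) (n : ℕ) :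
    (bestResponse k G.play G.init ι ε T π).FailsWithin n
      (fun o l => ∃ πhat, o = some πhat ∧ G.IsNash ε πhat.toPolicy ∧
        l ≤ n + (j + 1) * ∑ i, E i) ((j + 1 : ℕ) * (m * η)) := by
  induction j generalizing T π n with
  | zero =>
    obtain ⟨T, rfl⟩ : ∃ T', T = T' + 1 := ⟨T - 1, by omega⟩
    rw [bestResponse]
    refine ((estimateNEGap_failsWithin (hest π) n).bind (q' := 0) ?_).mono (fun _ _ h => h)
      (by simp)
    rintro o _ ⟨⟨c, rfl, hc, hall⟩, rfl⟩
    dsimp only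
    split_ifs with hg
    · have h1 := hc.potential_lt hΦ hg
      have h2 := le_ciSup hbdd (PurePolicy.toPolicy (Function.update π c.player c.policy))
      simp only [Nat.cast_zero, zero_mul] at hπ
      linarith
    · exact Learn.FailsWithin.pure ⟨π, rfl, isNash_of_isAccurate hε (not_lt.1 hg) hall, by simp⟩
  | succ j ih =>
    obtain ⟨T, rfl⟩ : ∃ T', T = T' + 1 := ⟨T - 1, by omega⟩
    rw [bestResponse]
    refine ((estimateNEGap_failsWithin (hest π) n).bind
      (q' := (j + 1 : ℕ) * (m * η)) ?_).mono (fun _ _ h => h) (le_of_eq (by push_cast; ring))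
    rintro o _ ⟨⟨c, rfl, hc, hall⟩, rfl⟩
    dsimp only
    split_ifs with hg
    · have h1 := hc.potential_lt hΦ hg
      refine (ih T (by omega) _ ?_ _).mono ?_ le_rfl
      · push_cast at hπ
        linarith
      · rintro o l ⟨πhat, ho, hn, hl⟩
        exact ⟨πhat, ho, hn, hl.trans (le_of_eq (by ring))⟩
    · refine (Learn.FailsWithin.pure ?_).mono (fun _ _ h => h) zero_le
      exact ⟨π, rfl, isNash_of_isAccurate hε (not_lt.1 hg) hall, by nlinarith [Nat.zero_le (∑ i, E i)]⟩

end BestResponse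

/-! ### The potential range -/

section Range

open MDP MarkovGame

variable {H S m : ℕ} {A : Fin m → ℕ} {G : MarkovGame H S A}

theorem valueToGo_mem (π : Policy H S A) (i : Fin m) (n : ℕ) (s : Fin S) :
    G.valueToGo π i n s ∈ Set.Icc (0 : ℝ) n := by
  induction n generalizing s with
  | zero => simp [valueToGo]
  | succ n ih =>
    by_cases hn : n < H
    · rw [valueToGo, dif_pos hn]
      have hw : ∀ a : (∀ j, Fin (A j)), 0 ≤ ∏ j, (π j (Fin.rev ⟨n, hn⟩) s (a j)).toReal :=
        fun a => Finset.prod_nonneg fun _ _ => ENNReal.toReal_nonneg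
      have hV : ∀ a, 0 ≤ ∑ s', (G.P (Fin.rev ⟨n, hn⟩) s a s').toReal * G.valueToGo π i n s' ∧
          ∑ s', (G.P (Fin.rev ⟨n, hn⟩) s a s').toReal * G.valueToGo π i n s' ≤ n := fun a => by
        constructor
        · exact Finset.sum_nonneg fun s' _ => mul_nonneg ENNReal.toReal_nonneg (ih s').1
        · refine (Finset.sum_le_sum fun s' _ =>
            mul_le_mul_of_nonneg_left (ih s').2 ENNReal.toReal_nonneg).trans ?_
          rw [← Finset.sum_mul, PMF.sum_toReal_of_fintype, one_mul]
      constructor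
      · exact Finset.sum_nonneg fun a _ => mul_nonneg (hw a) (add_nonneg (G.r_mem _ _ _ _).1 (hV a).1)
      · refine (Finset.sum_le_sum fun a _ => mul_le_mul_of_nonneg_left
          (add_le_add (G.r_mem i (Fin.rev ⟨n, hn⟩) s a).2 (hV a).2) (hw a)).trans ?_
        rw [← Finset.sum_mul, sum_prod_toReal fun j => π j (Fin.rev ⟨n, hn⟩) s]
        push_cast
        linarith
    · rw [valueToGo, dif_neg hn]
      exact ⟨le_rfl, by positivity⟩

/-- Change the policies one player at a time: each change moves Φ by a difference of two values in
[0, H]. This bounds the number of rounds by game parameters, as the union bound needs, and makes the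
real supremum and infimum of Φ meaningful. -/
theorem MarkovGame.IsPotential.sub_le {Φ : Policy H S A → ℝ} (hΦ : G.IsPotential Φ)
    (π π' : Policy H S A) : Φ π - Φ π' ≤ m * H := by
  have key : ∀ s : Finset (Fin m), Φ (s.piecewise π π') - Φ π' ≤ s.card * H := by
    intro s
    induction s using Finset.induction_on with
    | empty => simp
    | insert j s hj ih =>
      rw [Finset.piecewise_insert, Finset.card_insert_of_notMem hj]
      have h1 := hΦ j (s.piecewise π π') (π j)
      have h2 := (valueToGo_mem (G := G) (Function.update (s.piecewise π π') j (π j)) j H G.init).2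
      have h3 := (valueToGo_mem (G := G) (s.piecewise π π') j H G.init).1
      simp only [value] at h1
      push_cast
      linarith
  simpa using key Finset.univ

variable {Φ : Policy H S A → ℝ} (hΦ : G.IsPotential Φ)
include hΦ

theorem MarkovGame.IsPotential.bddAbove : BddAbove (Set.range Φ) := by
  by_cases h : Nonempty (Policy H S A)
  · obtain ⟨ρ⟩ := h
    refine ⟨Φ ρ + m * H, ?_⟩
    rintro _ ⟨π, rfl⟩
    linarith [hΦ.sub_le π ρ]
  · rw [not_nonempty_iff] at h
    simp

theorem MarkovGame.IsPotential.bddBelow : BddBelow (Set.range Φ) := by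
  by_cases h : Nonempty (Policy H S A)
  · obtain ⟨ρ⟩ := h
    refine ⟨Φ ρ - m * H, ?_⟩
    rintro _ ⟨π, rfl⟩
    linarith [hΦ.sub_le ρ π]
  · rw [not_nonempty_iff] at h
    simp

theorem MarkovGame.IsPotential.iSup_sub_le (π : Policy H S A) :
    (⨆ ρ, Φ ρ) - Φ π ≤ potentialRange Φ :=
  sub_le_sub_left (ciInf_le hΦ.bddBelow π) _

theorem MarkovGame.IsPotential.potentialRange_nonneg (π : Policy H S A) :
    0 ≤ potentialRange Φ := by
  linarith [hΦ.iSup_sub_le π, le_ciSup hΦ.bddAbove π]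

theorem MarkovGame.IsPotential.potentialRange_le (π : Policy H S A) :
    potentialRange Φ ≤ m * H := by
  have : Nonempty (Policy H S A) := ⟨π⟩
  rw [potentialRange, sub_le_iff_le_add]
  refine ciSup_le fun ρ => ?_
  rw [← sub_le_iff_le_add']
  exact le_ciInf fun ρ' => by linarith [hΦ.sub_le ρ ρ']

end Range

/-! ### Games without any choice or randomness -/

section Trivial

open MDP MarkovGame

theorem PMF.eq_pure_of_subsingleton {α : Type} [Subsingleton α] (μ : PMF α) (a : α) :
    μ = PMF.pure a := by
  ext b
  obtain rfl := Subsingleton.elim b a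
  have h := μ.tsum_coe
  rw [tsum_eq_single b fun c hc => absurd (Subsingleton.elim c b) hc] at h
  rw [h, PMF.pure_apply_self]

variable {H S m : ℕ} {A : Fin m → ℕ} {G : MarkovGame H S A}

theorem exists_rollout_eq_pure [Subsingleton (Fin S)] (π : PurePolicy H S A) (n : ℕ) (s : Fin S) :
    ∃ τ, G.rollout π n s = PMF.pure τ := by
  induction n generalizing s with
  | zero => exact ⟨[], rfl⟩
  | succ n ih =>
    rw [rollout]
    split_ifs with hn
    · dsimp only
      rw [PMF.eq_pure_of_subsingleton (G.P _ s _) s, PMF.pure_bind]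
      obtain ⟨τ, hτ⟩ := ih s
      rw [hτ, PMF.pure_map]
      exact ⟨_, rfl⟩
    · exact ⟨[], rfl⟩

theorem exists_sumReturns_eq_pure [Subsingleton (Fin S)] (π : PurePolicy H S A) (i : Fin m)
    (N : ℕ) : ∃ c : ℝ, ∀ n, sumReturns G.play π i N n = PMF.pure (c, n + N) := by
  obtain ⟨τ, hτ⟩ := exists_rollout_eq_pure (G := G) π H G.init
  induction N with
  | zero => exact ⟨0, fun n => rfl⟩
  | succ N ih =>
    obtain ⟨c, hc⟩ := ih
    refine ⟨(τ.map fun x => x.r i).sum + c, fun n => ?_⟩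
    rw [sumReturns_succ, hτ, PMF.pure_bind, hc, PMF.pure_map]
    congr 2
    ring

/-- All policies coincide and both estimates are the same number, so the estimated gain is exactly
0. This also holds when ι is so small that no evaluation episode is played and the estimate is a
division by zero. -/
theorem estimateGain_failsWithin_of_subsingleton [∀ i, NeZero (A i)] [Subsingleton (Fin S)]
    [∀ i, Subsingleton (Fin (A i))] {k : Consts} {ι δ : ℝ} (hδ : 0 ≤ δ) (π : PurePolicy H S A)
    (i : Fin m) (n : ℕ) : (estimateGain k G.play G.init ι δ π i).FailsWithin n
      (fun c l => c.IsAccurate G π δ ∧ c.player = i ∧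
        l = n + (trainEpisodes k H S (A i) ι δ + 2 * evalEpisodes k H ι δ)) 0 := by
  have hpol : ∀ ρ ρ' : Policy H S A, ρ = ρ' := fun ρ ρ' => by
    funext i h s
    rw [PMF.eq_pure_of_subsingleton (ρ i h s) 0, PMF.eq_pure_of_subsingleton (ρ' i h s) 0]
  obtain ⟨c, hc⟩ := exists_sumReturns_eq_pure (G := G) π i (evalEpisodes k H ι δ)
  have heval : ∀ ρ : PurePolicy H S A, ∀ n, (mcValue G.play ρ i (evalEpisodes k H ι δ)).FailsWithin
      n (fun v l => v = c / (evalEpisodes k H ι δ : ℕ) ∧ l = n + evalEpisodes k H ι δ) 0 := by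
    intro ρ n
    obtain rfl : ρ = π := by
      funext i h s
      exact Subsingleton.elim _ _
    have h1 : (mcValue G.play ρ i (evalEpisodes k H ι δ) n : PMF (ℝ × ℕ)) =
        (sumReturns G.play ρ i (evalEpisodes k H ι δ) n : PMF (ℝ × ℕ)).map
          fun x : ℝ × ℕ => (x.1 / (evalEpisodes k H ι δ : ℕ), x.2) := rfl
    rw [Learn.FailsWithin, h1, hc, PMF.pure_map, PMF.toOuterMeasure_pure_apply, if_neg (by simp)]
  rw [estimateGain]
  refine ((ucbviUpLow_failsWithin (Good := fun _ => True) (η := 0) (by simp) n).bind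
    (q' := 0 + (0 + 0)) ?_).mono (fun _ _ h => h) (by simp)
  rintro ν _ ⟨_, rfl⟩
  refine (heval _ _).bind ?_
  rintro v _ ⟨rfl, rfl⟩
  refine (heval _ _).bind ?_
  rintro v' _ ⟨rfl, rfl⟩
  refine Learn.FailsWithin.pure ⟨⟨?_, fun μ => ?_⟩, rfl, by ring⟩
  · dsimp only
    rw [hpol (PurePolicy.toPolicy _) π.toPolicy, sub_self, sub_self, sub_self, abs_zero]
    positivity
  · dsimp only
    rw [hpol (Function.update _ _ _) (PurePolicy.toPolicy (Function.update π i ν))]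
    linarith

end Trivial

/-! ### Choice of the constants -/

section Numerics

theorem exp_eight_le : Real.exp 8 ≤ 3000 := by
  have h := Real.exp_one_lt_d9
  have : Real.exp 8 = Real.exp 1 ^ 8 := by rw [← Real.exp_nat_mul]; norm_num
  rw [this]
  calc Real.exp 1 ^ 8 ≤ (2.7182818286 : ℝ) ^ 8 := by gcongr
    _ ≤ 3000 := by norm_num

theorem le_exp_fiftyfour : (10 : ℝ) ^ 23 ≤ Real.exp 54 := by
  have h := Real.exp_one_gt_d9
  have : Real.exp 54 = Real.exp 1 ^ 54 := by rw [← Real.exp_nat_mul]; norm_num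
  rw [this]
  calc (10 : ℝ) ^ 23 ≤ (2.7182818283 : ℝ) ^ 54 := by norm_num
    _ ≤ _ := by gcongr

/-- The choice of K makes Kδ at least about 10²³(a + b), where b measures the lower-order terms and
a the rest. The main root is about √(Kδ·a), hence a small fraction of Kδ. -/
theorem train_numerics {H S A ι δ K : ℝ} (hH : 1 ≤ H) (hS : 1 ≤ S) (hA : 1 ≤ A) (hι : 1 / 2 ≤ ι)
    (hδ : 0 < δ) (hδH : 8 * δ ≤ H)
    (hK : Real.exp 54 * (H ^ 3 * S * A * ι / δ ^ 2) * (1 + δ * S * ι) ≤ 2 * K)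
    (hlog : 1 + Real.log K ≤ 160 * ι) :
    Real.exp 8 * (2 * (H * S * A * (H + 122 * 160 ^ 2 * (H ^ 2 * S * ι) * (1 + Real.log K)) +
      80 * 160 * Real.sqrt ι * Real.sqrt (H * S * A * (2 * (K * H ^ 2) + H ^ 3 * (160 * ι)))) +
        4 * H ^ 2 * (160 * ι)) ≤ K * δ := by
  set a := H ^ 3 * S * A * ι / δ with ha
  set b := H ^ 3 * S ^ 2 * A * ι ^ 2 with hb
  have hι0 : 0 < ι := by linarith
  have ha0 : 0 ≤ a := by positivity
  have hb0 : 0 ≤ b := by positivity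
  have hSA : 1 ≤ S * A := one_le_mul_of_one_le_of_one_le hS hA
  -- lower bound on the number of episodes
  have h1 : (10 : ℝ) ^ 23 * (a + b) ≤ 2 * (K * δ) := by
    have e : Real.exp 54 * (H ^ 3 * S * A * ι / δ ^ 2) * (1 + δ * S * ι) * δ =
        Real.exp 54 * (a + b) := by
      rw [ha, hb]
      field_simp
    have := mul_le_mul_of_nonneg_right hK hδ.le
    rw [e] at this
    have h2 := mul_le_mul_of_nonneg_right le_exp_fiftyfour (add_nonneg ha0 hb0)
    linarith
  have hKδ : 0 ≤ K * δ := by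
    have : 0 ≤ (10 : ℝ) ^ 23 * (a + b) := by positivity
    linarith
  have hK0 : 0 ≤ K := nonneg_of_mul_nonneg_left hKδ hδ
  have h2 : 4 * (H ^ 2 * S * A) ≤ a := by
    rw [ha, le_div_iff₀ hδ]
    have : 4 * δ ≤ H * ι := by nlinarith
    calc 4 * (H ^ 2 * S * A) * δ = H ^ 2 * S * A * (4 * δ) := by ring
      _ ≤ H ^ 2 * S * A * (H * ι) := by gcongr
      _ = _ := by ring
  have h3 : 8 * (H ^ 2 * ι) ≤ a := by
    rw [ha, le_div_iff₀ hδ]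
    calc 8 * (H ^ 2 * ι) * δ = H ^ 2 * ι * 1 * (8 * δ) := by ring
      _ ≤ H ^ 2 * ι * (S * A) * H := by gcongr
      _ = _ := by ring
  have h4 : 160 * (H * ι) ≤ K := by
    have : 160 * (H * ι) * δ ≤ K * δ := by
      have h5 : H * ι * (8 * δ) ≤ H * ι * H := by gcongr
      nlinarith
    exact le_of_mul_le_mul_right this hδ
  -- Under the roots, K ≥ 160Hι merges the two summands into 3KH², and ι·HSA·KH² = Kδ·a.
  have h5 : Real.sqrt ι * Real.sqrt (H * S * A * (2 * (K * H ^ 2) + H ^ 3 * (160 * ι))) ≤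
      1 / 10 ^ 11 * (K * δ) := by
    rw [← Real.sqrt_mul hι0.le]
    refine Real.sqrt_le_iff.2 ⟨by positivity, ?_⟩
    have h6 : H ^ 3 * (160 * ι) ≤ K * H ^ 2 := by
      have := mul_le_mul_of_nonneg_right h4 (sq_nonneg H)
      nlinarith
    calc ι * (H * S * A * (2 * (K * H ^ 2) + H ^ 3 * (160 * ι))) ≤
        ι * (H * S * A * (2 * (K * H ^ 2) + K * H ^ 2)) := by gcongr
      _ = 3 * ((K * δ) * a) := by rw [ha]; field_simp; ring
      _ ≤ 3 * ((K * δ) * (2 / 10 ^ 23 * (K * δ))) := by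
          have : a ≤ 2 / 10 ^ 23 * (K * δ) := by linarith
          gcongr
      _ ≤ _ := by nlinarith [mul_nonneg hKδ hKδ]
  have h6 : H * S * A * (H + 122 * 160 ^ 2 * (H ^ 2 * S * ι) * (1 + Real.log K)) ≤
      a + 122 * 160 ^ 3 * b := by
    calc _ ≤ H * S * A * (H + 122 * 160 ^ 2 * (H ^ 2 * S * ι) * (160 * ι)) := by gcongr
      _ = H ^ 2 * S * A + 122 * 160 ^ 3 * b := by rw [hb]; ring
      _ ≤ _ := by
        have : 0 ≤ H ^ 2 * S * A := by positivity
        linarith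
  have h7 : Real.exp 8 * (2 * (H * S * A * (H + 122 * 160 ^ 2 * (H ^ 2 * S * ι) *
      (1 + Real.log K)) + 80 * 160 * Real.sqrt ι * Real.sqrt (H * S * A * (2 * (K * H ^ 2) +
        H ^ 3 * (160 * ι)))) + 4 * H ^ 2 * (160 * ι)) ≤
      3000 * (2 * (a + 122 * 160 ^ 3 * b + 80 * 160 * (1 / 10 ^ 11 * (K * δ))) + 80 * a) := by
    refine mul_le_mul exp_eight_le ?_ ?_ (by norm_num)
    · linarith
    · have h8 : 0 ≤ 1 + Real.log K := by
        have hK1 : 1 ≤ K := by nlinarith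
        linarith [Real.log_nonneg hK1]
      positivity
  linarith

theorem floor_ge_half {y : ℝ} (hy : 1 ≤ y) : y ≤ 2 * (⌊y⌋₊ : ℝ) := by
  have h1 := Nat.lt_floor_add_one y
  have h2 : (1 : ℝ) ≤ ⌊y⌋₊ := by exact_mod_cast (Nat.one_le_floor_iff y).2 hy
  linarith

end Numerics

/-! ### Absorbing all counts into the logarithmic factor, and the conclusion -/

section Main

open MDP MarkovGame

/-- Absolute constants for which best-response dynamics succeeds. -/
noncomputable def bestResponseConsts : Consts := ⟨10 * 160, 2, Real.exp 54, 8 * 160⟩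

section LogFactor

variable {H S m a M ε p x ι : ℝ}

/-- All sizes entering the union bounds are at most x. The number of rounds is compared with px
instead: the spare factor p becomes the total failure probability. -/
theorem log_factor_bounds (hH : 1 ≤ H) (hS : 1 ≤ S) (hm : 1 ≤ m) (ha : 1 ≤ a) (haM : a ≤ M)
    (hε : 0 < ε) (hεH : ε ≤ H) (hp : 0 < p) (hp1 : p ≤ 1)
    (hx : x = H ^ 2 * S * m * M / (ε * p)) :
    H / ε * (H * S * a) ≤ x ∧ S ≤ x ∧ H * S ≤ x ∧ m ≤ x ∧ m * (H / ε) ≤ p * x ∧ 1 ≤ H / ε ∧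
      H / ε ≤ x := by
  have hu : 1 ≤ H / ε := (one_le_div hε).2 hεH
  have hM : 1 ≤ M := ha.trans haM
  have hxp : p * x = H / ε * (H * S * m * M) := by
    rw [hx]
    field_simp
  have hx0 : 0 ≤ x := by rw [hx]; positivity
  have hpx : p * x ≤ x := mul_le_of_le_one_left hx0 hp1
  set u := H / ε
  have e : ∀ y, y ≤ u * (H * S * m * M) → y ≤ x := fun y hy => by linarith
  have hu0 : 0 ≤ u := by linarith
  refine ⟨e _ ?_, e _ ?_, e _ ?_, e _ ?_, ?_, hu, e _ ?_⟩
  · calc u * (H * S * a) = u * (H * S * 1 * a) := by ring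
      _ ≤ u * (H * S * m * M) := by gcongr
  · calc S = 1 * (1 * S * 1 * 1) := by ring
      _ ≤ u * (H * S * m * M) := by gcongr
  · calc H * S = 1 * (H * S * 1 * 1) := by ring
      _ ≤ u * (H * S * m * M) := by gcongr
  · calc m = 1 * (1 * 1 * m * 1) := by ring
      _ ≤ u * (H * S * m * M) := by gcongr
  · rw [hxp]
    calc m * u = u * (1 * 1 * m * 1) := by ring
      _ ≤ u * (H * S * m * M) := by gcongr
  · calc u = u * (1 * 1 * 1 * 1) := by ring
      _ ≤ u * (H * S * m * M) := by gcongr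

theorem half_le_log (hx : 2 ≤ x) : 1 / 2 ≤ Real.log x := by
  have h1 := Real.log_two_gt_d9
  have h2 := Real.log_le_log (by norm_num) hx
  linarith

/-- K depends on ι and the bonuses must absorb log K. A polynomial bound in x resolves this circle:
log K is then at most a constant multiple of ι. -/
theorem train_episodes_le (hS : 1 ≤ S) (hH : 1 ≤ H) (ha : 1 ≤ a) (hε : 0 < ε) (hεH : ε ≤ H)
    (hx : 2 ≤ x) (h1 : H / ε * (H * S * a) ≤ x) (h2 : H * S ≤ x) (h3 : H / ε ≤ x) :
    Real.exp 54 * (H ^ 3 * S * a * Real.log x / (ε / 8) ^ 2) * (1 + ε / 8 * S * Real.log x) ≤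
      Real.exp 54 * x ^ 11 := by
  have hι0 : 0 ≤ Real.log x := Real.log_nonneg (by linarith)
  have hιx : Real.log x ≤ x := (Real.log_le_sub_one_of_pos (by linarith)).trans (by linarith)
  have h4 : H ^ 3 * S * a * Real.log x / (ε / 8) ^ 2 ≤ 64 * x ^ 3 := by
    calc _ = 64 * ((H / ε) * (H / ε * (H * S * a)) * Real.log x) := by field_simp; ring
      _ ≤ 64 * (x * x * x) := by gcongr
      _ = _ := by ring
  have h5 : 1 + ε / 8 * S * Real.log x ≤ x ^ 2 := by
    calc 1 + ε / 8 * S * Real.log x ≤ 1 + H / 8 * S * x := by gcongr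
      _ = 1 + 1 / 8 * (H * S * x) := by ring
      _ ≤ 1 + 1 / 8 * (x * x) := by gcongr
      _ ≤ x ^ 2 := by nlinarith
  have h6 : 0 ≤ 1 + ε / 8 * S * Real.log x := by positivity
  have h7 : (64 : ℝ) ≤ x ^ 6 := by
    calc (64 : ℝ) = 2 ^ 6 := by norm_num
      _ ≤ x ^ 6 := by gcongr
  have hx0 : 0 ≤ x := by linarith
  rw [mul_assoc]
  refine mul_le_mul_of_nonneg_left ?_ (Real.exp_pos _).le
  calc _ ≤ 64 * x ^ 3 * x ^ 2 := by gcongr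
    _ ≤ x ^ 6 * x ^ 3 * x ^ 2 := by gcongr
    _ = _ := by ring

/-- All failure probabilities together. -/
theorem failure_le {J : ℝ} (hx : 2 ≤ x) (hm : 0 ≤ m) (hmx : m ≤ x)
    (hJ : J ≤ 6 * (p * x)) (hp : 0 ≤ p) :
    J * (m * (10 * (Real.exp 54 * x ^ 12) * Real.exp (-(160 * Real.log x)))) ≤ p := by
  have hx0 : 0 < x := by linarith
  have h1 : Real.exp (-(160 * Real.log x)) * x ^ 160 = 1 := by
    have : x ^ 160 = Real.exp (160 * Real.log x) := by
      rw [show (160 : ℝ) = ((160 : ℕ) : ℝ) by norm_num, Real.exp_nat_mul, Real.exp_log hx0]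
    rw [this, ← Real.exp_add]
    simp
  -- Constants are powers of x too, since log x ≥ 1/2.
  have h2 : Real.exp 54 ≤ x ^ 108 := by
    have : x ^ 108 = Real.exp (108 * Real.log x) := by
      rw [show (108 : ℝ) = ((108 : ℕ) : ℝ) by norm_num, Real.exp_nat_mul, Real.exp_log hx0]
    rw [this]
    exact Real.exp_le_exp.2 (by linarith [half_le_log hx])
  have h3 : (60 : ℝ) ≤ x ^ 6 := by
    calc (60 : ℝ) ≤ 2 ^ 6 := by norm_num
      _ ≤ x ^ 6 := by gcongr
  have hx1 : 1 ≤ x := by linarith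
  calc _ ≤ 6 * (p * x) * (x * (10 * (x ^ 108 * x ^ 12) * Real.exp (-(160 * Real.log x)))) := by
        gcongr
    _ = p * (60 * x ^ 122 * Real.exp (-(160 * Real.log x))) := by ring
    _ ≤ p * (x ^ 6 * x ^ 122 * Real.exp (-(160 * Real.log x))) := by gcongr
    _ = p * (Real.exp (-(160 * Real.log x)) * x ^ 128) := by ring
    _ ≤ p * (Real.exp (-(160 * Real.log x)) * x ^ 160) := by
        gcongr
        norm_num
    _ = p := by rw [h1, mul_one]

end LogFactor

variable {H S m : ℕ} {A : Fin m → ℕ} [∀ i, NeZero (A i)]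

theorem logFactor_pos_parts (G : MarkovGame H S A) (i : Fin m) :
    (1 : ℝ) ≤ S ∧ (1 : ℝ) ≤ m ∧ (1 : ℝ) ≤ A i ∧ (A i : ℝ) ≤ (Finset.univ.sup A : ℕ) := by
  refine ⟨?_, ?_, ?_, ?_⟩
  · exact_mod_cast Fin.pos G.init
  · exact_mod_cast Fin.pos i
  · exact_mod_cast NeZero.pos (A i)
  · exact_mod_cast Finset.le_sup (f := A) (Finset.mem_univ i)

/-- One call of the estimation routine in a game that is not trivial. -/
theorem estimateGain_failsWithin_of_two_le {G : MarkovGame H S A} {ε p x : ℝ}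
    (hε : 0 < ε) (hεH : ε ≤ H) (hp : 0 < p) (hp1 : p ≤ 1)
    (hxdef : x = (H : ℝ) ^ 2 * S * m * (Finset.univ.sup A : ℕ) / (ε * p)) (hx : 2 ≤ x)
    (π : PurePolicy H S A) (i : Fin m) (n : ℕ) :
    (estimateGain bestResponseConsts G.play G.init (Real.log x) (ε / 8) π i).FailsWithin n
      (fun c l => c.IsAccurate G π (ε / 8) ∧ c.player = i ∧
        l = n + (trainEpisodes bestResponseConsts H S (A i) (Real.log x) (ε / 8) +
          2 * evalEpisodes bestResponseConsts H (Real.log x) (ε / 8)))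
      (ENNReal.ofReal (10 * (Real.exp 54 * x ^ 12) * Real.exp (-(160 * Real.log x)))) := by
  have hHpos : 0 < H := by
    have : (0 : ℝ) < H := hε.trans_le hεH
    exact_mod_cast this
  have hH1 : (1 : ℝ) ≤ H := by exact_mod_cast hHpos
  obtain ⟨hS, hm, ha, haM⟩ := logFactor_pos_parts G i
  obtain ⟨b1, b2, b3, -, -, b6, b7⟩ :=
    log_factor_bounds hH1 hS hm ha haM hε hεH hp hp1 hxdef
  have hι := half_le_log hx
  set ι := Real.log x with hιdef
  set K := trainEpisodes bestResponseConsts H S (A i) ι (ε / 8) with hK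
  set N := evalEpisodes bestResponseConsts H ι (ε / 8) with hN
  have hx1 : 1 ≤ x := by linarith
  -- number of training episodes
  have hKy : (1 : ℝ) ≤ Real.exp 54 * (H ^ 3 * S * A i * ι / (ε / 8) ^ 2) *
      (1 + ε / 8 * S * ι) := by
    have h1 : 1 ≤ (H : ℝ) ^ 3 * S * A i * ι / (ε / 8) ^ 2 := by
      rw [one_le_div (by positivity)]
      calc (ε / 8) ^ 2 ≤ (H / 8 : ℝ) ^ 2 := by gcongr
        _ ≤ (H : ℝ) ^ 2 * 1 * 1 * 1 * (1 / 2) := by nlinarith [sq_nonneg (H : ℝ)]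
        _ ≤ (H : ℝ) ^ 2 * H * S * A i * ι := by gcongr
        _ = _ := by ring
    have h2 : (1 : ℝ) ≤ 1 + ε / 8 * S * ι := by
      have : 0 ≤ ε / 8 * S * ι := by positivity
      linarith
    have h3 : (1 : ℝ) ≤ Real.exp 54 := Real.one_le_exp (by norm_num)
    exact one_le_mul_of_one_le_of_one_le (one_le_mul_of_one_le_of_one_le h3 h1) h2
  have hK2 := floor_ge_half hKy
  have hKle : (K : ℝ) ≤ Real.exp 54 * x ^ 11 :=
    (Nat.floor_le (zero_le_one.trans hKy)).trans (train_episodes_le hS hH1 ha hε hεH hx b1 b3 b7)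
  have hK1 : 0 < K := (Nat.one_le_floor_iff _).2 hKy
  -- 1 + 54 + 11ι ≤ 121ι because ι ≥ 1/2.
  have hlog : 1 + Real.log K ≤ 160 * ι := by
    have h1 : (0 : ℝ) < K := by exact_mod_cast hK1
    have h2 := Real.log_le_log h1 hKle
    rw [Real.log_mul (Real.exp_pos _).ne' (by positivity), Real.log_exp, Real.log_pow] at h2
    push_cast at h2
    linarith
  -- number of evaluation episodes
  have hNy : (1 : ℝ) ≤ 8 * 160 * (H ^ 2 * ι / (ε / 8) ^ 2) := by
    have h1 : 1 / 2 ≤ (H : ℝ) ^ 2 * ι / (ε / 8) ^ 2 := by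
      rw [le_div_iff₀ (by positivity)]
      calc 1 / 2 * (ε / 8) ^ 2 ≤ 1 / 2 * (H / 8 : ℝ) ^ 2 := by gcongr
        _ ≤ (H : ℝ) ^ 2 * (1 / 2) := by nlinarith [sq_nonneg (H : ℝ)]
        _ ≤ _ := by gcongr
    linarith
  have hN2 := floor_ge_half hNy
  have hN1 : 0 < N := (Nat.one_le_floor_iff _).2 hNy
  have hNℓ : 160 * ι ≤ N * (ε / 8) ^ 2 / (4 * H ^ 2) := by
    rw [le_div_iff₀ (by positivity)]
    have h1 : 8 * 160 * ((H : ℝ) ^ 2 * ι / (ε / 8) ^ 2) * (ε / 8) ^ 2 = 8 * 160 * (H ^ 2 * ι) := by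
      field_simp
    have h2 : 8 * 160 * ((H : ℝ) ^ 2 * ι / (ε / 8) ^ 2) ≤ 2 * (N : ℝ) := hN2
    have h3 := mul_le_mul_of_nonneg_right h2 (sq_nonneg (ε / 8))
    linarith
  have heval : ∀ (ρ : PurePolicy H S A) (n : ℕ), (mcValue G.play ρ i N).FailsWithin n
      (fun v l => |v - G.value i ρ.toPolicy| ≤ ε / 8 ∧ l = n + N)
        (2 * ENNReal.ofReal (Real.exp (-(160 * ι)))) := fun ρ n =>
    mcValue_failsWithin hN1 (by linarith) (by linarith) hNℓ n
  have htrain : (adaptiveRun (trainStep G ⟨bestResponseConsts.bonus, bestResponseConsts.corr, ι⟩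
      π i) K []).toOuterMeasure {w | ¬ optVal (G.indP π i) (G.indR π i) H G.init -
        polEval (G.indP π i) (trainResult G.init ⟨bestResponseConsts.bonus,
          bestResponseConsts.corr, ι⟩ π i w).2 (G.indR π i) H G.init ≤ ε / 8} ≤
      ((2 * (H * S * A i * K) + 2 * (H * S * A i * S) + 2 : ℕ) : ℝ≥0∞) *
        ENNReal.ofReal (Real.exp (-(160 * ι))) := by
    refine le_trans (PMF.toOuterMeasure_mono _ ?_) (measure_not_trainGood_le hHpos
      (F := fun w h s b => AgentData.widthBonus (G.indP π i) (G.indR π i) 160 ι h s b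
        ((trainData i w).visits h s b))
      (fun w h s b => AgentData.widthBonus_mem (by norm_num) (by linarith) h s b _)
      (by linarith) K)
    rintro w ⟨hw, hsupp⟩ hgood
    have hlen : w.length = K := by simpa using length_of_mem_support_adaptiveRun hsupp
    refine hw (hgood.optVal_sub_le (L := 160) (by norm_num) (by linarith) (by linarith)
      (hlen ▸ hK1) ?_)
    rw [hlen]
    exact train_numerics hH1 hS ha hι (by linarith) (by linarith) hK2 hlog
  refine (estimateGain_failsWithin htrain heval n).mono (fun _ _ h => h) ?_
  -- The 6 consists of two trajectory totals in training and two tails for each of the two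
  -- evaluations.
  have hcount : ((2 * (H * S * A i * K) + 2 * (H * S * A i * S) + 6 : ℕ) : ℝ) ≤
      10 * (Real.exp 54 * x ^ 12) := by
    have h1 : (H : ℝ) * S * A i ≤ x := le_trans (le_mul_of_one_le_left (by positivity) b6) b1
    have h2 : (1 : ℝ) ≤ Real.exp 54 := Real.one_le_exp (by norm_num)
    have h3 : (H : ℝ) * S * A i * K ≤ Real.exp 54 * x ^ 12 := by
      calc (H : ℝ) * S * A i * K ≤ x * (Real.exp 54 * x ^ 11) := by gcongr
        _ = _ := by ring
    have h4 : (H : ℝ) * S * A i * S ≤ Real.exp 54 * x ^ 12 := by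
      calc (H : ℝ) * S * A i * S ≤ x * x := by gcongr
        _ = 1 * x ^ 2 := by ring
        _ ≤ Real.exp 54 * x ^ 12 := by
          gcongr
          norm_num
    have h5 : 1 ≤ Real.exp 54 * x ^ 12 :=
      one_le_mul_of_one_le_of_one_le h2 (one_le_pow₀ hx1)
    push_cast
    linarith
  have hsum : ∀ e : ℝ≥0∞, ((2 * (H * S * A i * K) + 2 * (H * S * A i * S) + 2 : ℕ) : ℝ≥0∞) * e +
      (2 * e + (2 * e + 0)) =
      ((2 * (H * S * A i * K) + 2 * (H * S * A i * S) + 6 : ℕ) : ℝ≥0∞) * e := fun e => by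
    push_cast
    ring
  rw [hsum, ENNReal.ofReal_mul (by positivity), ← ENNReal.ofReal_natCast]
  gcongr

/-- The episodes of one pass through the loop for one player. -/
theorem episodes_le (G : MarkovGame H S A) {ε ι : ℝ} (hε : 0 < ε) (hεH : ε ≤ H) (hι : 0 ≤ ι)
    (i : Fin m) :
    ((trainEpisodes bestResponseConsts H S (A i) ι (ε / 8) +
      2 * evalEpisodes bestResponseConsts H ι (ε / 8) : ℕ) : ℝ) ≤
      (64 * Real.exp 54 + 1024 * 160) * (H ^ 3 * S * A i * ι / ε ^ 2 * (1 + ε * S * ι)) := by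
  have hH1 : (1 : ℝ) ≤ H := by
    have : (0 : ℝ) < H := hε.trans_le hεH
    exact_mod_cast Nat.pos_of_ne_zero (by rintro rfl; simp at this)
  obtain ⟨hS, -, ha, -⟩ := logFactor_pos_parts G i
  have h1 : (trainEpisodes bestResponseConsts H S (A i) ι (ε / 8) : ℝ) ≤
      64 * Real.exp 54 * (H ^ 3 * S * A i * ι / ε ^ 2 * (1 + ε * S * ι)) := by
    refine (Nat.floor_le (by rw [bestResponseConsts]; positivity)).trans ?_
    rw [bestResponseConsts]
    calc Real.exp 54 * (H ^ 3 * S * A i * ι / (ε / 8) ^ 2) * (1 + ε / 8 * S * ι) =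
        64 * Real.exp 54 * (H ^ 3 * S * A i * ι / ε ^ 2 * (1 + ε / 8 * S * ι)) := by
          field_simp
          ring
      _ ≤ _ := by
          gcongr
          linarith
  have h2 : (evalEpisodes bestResponseConsts H ι (ε / 8) : ℝ) ≤
      512 * 160 * (H ^ 3 * S * A i * ι / ε ^ 2 * (1 + ε * S * ι)) := by
    refine (Nat.floor_le (by rw [bestResponseConsts]; positivity)).trans ?_
    rw [bestResponseConsts]
    calc 8 * 160 * ((H : ℝ) ^ 2 * ι / (ε / 8) ^ 2) =
        512 * 160 * (H ^ 2 * 1 * 1 * 1 * ι / ε ^ 2 * 1) := by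
          field_simp
          ring
      _ ≤ 512 * 160 * (H ^ 2 * H * S * A i * ι / ε ^ 2 * (1 + ε * S * ι)) := by
          gcongr
          have : 0 ≤ ε * S * ι := by positivity
          linarith
      _ = _ := by ring
  push_cast
  linarith

end Main

theorem mainTheorem2 :
    ∃ (k : Consts) (C : ℝ), 0 < k.bonus ∧ 0 < k.corr ∧ 0 < k.train ∧ 0 < k.eval ∧ 0 < C ∧
      ∀ (H S m : ℕ) (A : Fin m → ℕ) [NeZero m] [∀ i, NeZero (A i)]
        (G : MarkovGame H S A) (Φ : Policy H S A → ℝ), G.IsPotential Φ →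
      ∀ (ε p : ℝ), 0 < ε → ε ≤ H → 0 < p → p ≤ 1 →
      ∀ π₀ : PurePolicy H S A,
      ∃ T₀ : ℕ, ∀ T : ℕ, T₀ ≤ T →
        ENNReal.ofReal (1 - p) ≤
          (bestResponse k G.play G.init (logFactor H S A ε p) ε T π₀ 0).toOuterMeasure
            {x | ∃ πhat : PurePolicy H S A, x.1 = some πhat ∧ G.IsNash ε πhat.toPolicy ∧
              (x.2 : ℝ) ≤ C * episodeBound H S A (potentialRange Φ) ε p} := by
  refine ⟨bestResponseConsts, 4 * (64 * Real.exp 54 + 1024 * 160), by norm_num [bestResponseConsts],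
    by norm_num [bestResponseConsts], by rw [bestResponseConsts]; positivity,
    by norm_num [bestResponseConsts], by positivity, ?_⟩
  intro H S m A _ _ G Φ hΦ ε p hε hεH hp hp1 π₀
  have hHpos : 0 < H := by
    have : (0 : ℝ) < H := hε.trans_le hεH
    exact_mod_cast this
  have hH1 : (1 : ℝ) ≤ H := by exact_mod_cast hHpos
  set x := (H : ℝ) ^ 2 * S * m * (Finset.univ.sup A : ℕ) / (ε * p) with hxdef
  have hlogx : logFactor H S A ε p = Real.log x := rfl
  set ι := Real.log x with hιdef
  obtain ⟨hS, hm, ha, haM⟩ := logFactor_pos_parts G 0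
  obtain ⟨b1, b2, b3, b4, b5, b6, b7⟩ := log_factor_bounds hH1 hS hm ha haM hε hεH hp hp1 hxdef
  have hι : 0 ≤ ι := Real.log_nonneg (b6.trans b7)
  set range := potentialRange Φ with hrange
  have hrange0 : 0 ≤ range := hΦ.potentialRange_nonneg π₀.toPolicy
  have hrangeH : range ≤ m * H := hΦ.potentialRange_le π₀.toPolicy
  -- The number of increments of size ε/4 that fit into the potential range.
  set j := ⌈4 * range / ε⌉₊ with hj
  set E : Fin m → ℕ := fun i => trainEpisodes bestResponseConsts H S (A i) ι (ε / 8) +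
    2 * evalEpisodes bestResponseConsts H ι (ε / 8) with hE
  have hjle : (j : ℝ) + 1 ≤ 4 * range / ε + 2 := by
    have := Nat.ceil_lt_add_one (show 0 ≤ 4 * range / ε by positivity)
    linarith
  -- the total failure probability
  obtain ⟨η, hη, hest⟩ : ∃ η : ℝ≥0∞, ((j + 1 : ℕ) : ℝ≥0∞) * (m * η) ≤ ENNReal.ofReal p ∧
      ∀ (π : PurePolicy H S A) (i : Fin m) (n : ℕ),
        (estimateGain bestResponseConsts G.play G.init ι (ε / 8) π i).FailsWithin n
          (fun c l => c.IsAccurate G π (ε / 8) ∧ c.player = i ∧ l = n + E i) η := by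
    -- All four factors are positive, so a product below 2 leaves one state and one action per
    -- player. Otherwise x ≥ 2 and ι is bounded away from zero.
    by_cases htriv : H * S * m * Finset.univ.sup A < 2
    · refine ⟨0, by simp, ?_⟩
      have hm0 : 0 < m := Fin.pos 0
      have hS0 : 0 < S := Fin.pos G.init
      have hA0 : ∀ i, 0 < A i ∧ A i ≤ Finset.univ.sup A := fun i =>
        ⟨NeZero.pos (A i), Finset.le_sup (f := A) (Finset.mem_univ i)⟩
      have hM0 : 0 < Finset.univ.sup A := (hA0 0).1.trans_le (hA0 0).2
      have hS1 : S ≤ 1 := by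
        by_contra hc
        have : 1 * 2 * 1 * 1 ≤ H * S * m * Finset.univ.sup A := by
          gcongr <;> omega
        omega
      have hM1 : Finset.univ.sup A ≤ 1 := by
        by_contra hc
        have : 1 * 1 * 1 * 2 ≤ H * S * m * Finset.univ.sup A := by
          gcongr <;> omega
        omega
      have : Subsingleton (Fin S) := Fin.subsingleton_iff_le_one.2 hS1
      have : ∀ i, Subsingleton (Fin (A i)) := fun i =>
        Fin.subsingleton_iff_le_one.2 ((hA0 i).2.trans hM1)
      exact fun π i n => estimateGain_failsWithin_of_subsingleton (by linarith) π i n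
    · have hx2 : 2 ≤ x := by
        have h1 : (2 : ℝ) ≤ H * S * m * (Finset.univ.sup A : ℕ) := by
          exact_mod_cast not_lt.1 htriv
        rw [hxdef, le_div_iff₀ (by positivity)]
        calc 2 * (ε * p) ≤ (H * S * m * (Finset.univ.sup A : ℕ)) * (H * 1) := by gcongr
          _ = _ := by ring
      refine ⟨_, ?_, fun π i n =>
        estimateGain_failsWithin_of_two_le hε hεH hp hp1 hxdef hx2 π i n⟩
      -- Here range ≤ mH is used: j + 1 ≤ 4mH/ε + 2 ≤ 6mH/ε, and mH/ε ≤ px.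
      have h1 : ((j + 1 : ℕ) : ℝ) ≤ 6 * (p * x) := by
        push_cast
        have h2 : 4 * range / ε ≤ 4 * (m * (H / ε)) := by
          calc 4 * range / ε ≤ 4 * (m * H) / ε := by gcongr
            _ = _ := by ring
        have h3 : 1 ≤ m * ((H : ℝ) / ε) := one_le_mul_of_one_le_of_one_le hm b6
        linarith
      have h2 := failure_le hx2 (by linarith) b4 h1 hp.le
      rw [← ENNReal.ofReal_natCast, ← ENNReal.ofReal_natCast m,
        ← ENNReal.ofReal_mul (by positivity), ← ENNReal.ofReal_mul (by positivity)]
      exact ENNReal.ofReal_le_ofReal h2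
  refine ⟨j + 1, fun T hT => ?_⟩
  have hstart : (⨆ ρ, Φ ρ) - Φ π₀.toPolicy ≤ j * (ε / 4) := by
    refine (hΦ.iSup_sub_le _).trans ?_
    have h1 := Nat.le_ceil (4 * range / ε)
    rw [div_le_iff₀ hε] at h1
    linarith
  have hfail := (bestResponse_failsWithin hε hΦ hΦ.bddAbove hest j T hT π₀ hstart 0).mono
    (Good' := fun o l => ∃ πhat : PurePolicy H S A, o = some πhat ∧ G.IsNash ε πhat.toPolicy ∧
      (l : ℝ) ≤ 4 * (64 * Real.exp 54 + 1024 * 160) * episodeBound H S A range ε p) ?_ hη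
  · rw [hlogx]
    have h1 := PMF.toOuterMeasure_add_compl
      (bestResponse bestResponseConsts G.play G.init ι ε T π₀ 0 : PMF (Option (PurePolicy H S A) × ℕ))
      {x | ∃ πhat : PurePolicy H S A, x.1 = some πhat ∧ G.IsNash ε πhat.toPolicy ∧
        (x.2 : ℝ) ≤ 4 * (64 * Real.exp 54 + 1024 * 160) * episodeBound H S A range ε p}
    rw [ENNReal.ofReal_sub _ hp.le, ENNReal.ofReal_one, tsub_le_iff_right, ← h1]
    gcongr
    exact hfail
  · rintro o l ⟨πhat, ho, hn, hl⟩
    refine ⟨πhat, ho, hn, ?_⟩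
    have h1 : (l : ℝ) ≤ (j + 1) * ∑ i, (E i : ℝ) := by
      rw [zero_add] at hl
      exact_mod_cast hl
    have h2 : ∑ i, (E i : ℝ) ≤ ∑ i, (64 * Real.exp 54 + 1024 * 160) *
        (H ^ 3 * S * A i * ι / ε ^ 2 * (1 + ε * S * ι)) :=
      Finset.sum_le_sum fun i _ => episodes_le G hε hεH hι i
    have h3 : ∑ i, (64 * Real.exp 54 + 1024 * 160) *
        (H ^ 3 * S * A i * ι / ε ^ 2 * (1 + ε * S * ι)) =
        (64 * Real.exp 54 + 1024 * 160) *
          (H ^ 3 * S * (∑ i, (A i : ℝ)) * ι / ε ^ 2 * (1 + ε * S * ι)) := by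
      rw [← Finset.mul_sum, ← Finset.sum_mul, ← Finset.sum_div, ← Finset.sum_mul, ← Finset.mul_sum]
    have h4 : (j : ℝ) + 1 ≤ 4 * (range + ε) / ε := by
      refine hjle.trans ?_
      rw [mul_add, add_div, mul_div_assoc 4 ε, div_self hε.ne']
      linarith
    calc (l : ℝ) ≤ (j + 1) * ∑ i, (E i : ℝ) := h1
      _ ≤ (4 * (range + ε) / ε) * ((64 * Real.exp 54 + 1024 * 160) *
          (H ^ 3 * S * (∑ i, (A i : ℝ)) * ι / ε ^ 2 * (1 + ε * S * ι))) := by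
        rw [← h3]
        gcongr
      _ = _ := by
        rw [episodeBound, hlogx]
        field_simp
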